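/- **Setting.** Let $E$ be a finite-dimensional real inner product space (i.e. $\mathbb R^d$ with an inner-product norm), let $F:E\to E$ be monotone, $\langle F(u)-F(v),u-v\rangle\ge 0$, let $u^*\in E$ satisfy $F(u^*)=0$, and let $F$ be $\mu$-sharp, $\mu>0$: $\langle F(u)-F(u^*),u-u^*\rangle\ge\mu\|u-u^*\|^2$ for all $u\in E$. $F$ is accessed through a stochastic oracle $\widehat F(x,z)$, $z\sim P_z$ (jointly measurable in $(x,z)$), with $\mathbb E_z\widehat F(x,z)=F(x)$, $\mathbb E_z\|\widehat F(x,z)-F(x)\|^2\le\sigma^2$ and $\mathbb E_z\|\widehat F(u,z)-\widehat F(v,z)\|^2\le L^2\|u-v\|^2$ for all $x,u,v\in E$, where $\sigma,L>0$ (by Jensen's inequality $F$ is then $L$-Lipschitz). One query is one evaluation $\widehat F(x,z)$; the same sample $z$ may be used at two points. **E-Halpern** with start $u_0$, accuracy $\epsilon'>0$, step size $\eta_0$ and $K$ iterations. Put $M=9L^2$, $v_{-1}=u_0$, and let $\widetilde F(v_{-1})$ be the average of $\lceil 8\sigma^2/\epsilon'^2\rceil$ independent answers $\widehat F(u_0,z_i)$.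 For $k=1,\dots,K$: $$v_{k-1}=\tfrac1{k+1}u_0+\tfrac k{k+1}u_{k-1}-\eta_{k-1}\widetilde F(v_{k-2}),\qquad p_{k-1}=\min(\tfrac2k,1),$$ $$S_1=\Big\lceil\tfrac{8\sigma^2}{p_{k-1}\epsilon'^2}\Big\rceil,\qquad S_2=\Big\lceil\tfrac{8L^2\|v_{k-1}-v_{k-2}\|^2}{p_{k-1}^2\epsilon'^2}\Big\rceil;$$ with probability $p_{k-1}$ set $\widetilde F(v_{k-1})=\frac1{S_1}\sum_{i\le S_1}\widehat F(v_{k-1},z_i)$ ($S_1$ queries), and otherwise set $\widetilde F(v_{k-1})=\widetilde F(v_{k-2})+\frac1{S_2}\sum_{i\le S_2}\big(\widehat F(v_{k-1},z_i)-\widehat F(v_{k-2},z_i)\big)$ ($2S_2$ queries; the correction is $0$ if $S_2=0$); then $$u_k=\tfrac1{k+1}u_0+\tfrac k{k+1}u_{k-1}-\eta_{k-1}\widetilde F(v_{k-1}),\qquad \eta_k=\frac{\big(1-\frac1{(k+1)^2}-M\eta_{k-1}^2\big)(k+1)^2}{(1-M\eta_{k-1}^2)\,k(k+2)}\,\eta_{k-1}.$$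 All coins and all samples $z_i\sim P_z$, over all iterations and all calls, are independent. The output is $u_K$. **Restarted E-Halpern** with inputs $u_0\in E$, $\|u_0-u^*\|$, $0<\eta_0\le\frac1{3\sqrt3L}$, $L,\mu,\sigma$ and $\epsilon>0$. Put $$\underline\eta=\frac{\eta_0(1-2M\eta_0^2)}{1-M\eta_0^2},\quad N=\max\Big\{0,\Big\lceil\log_2\frac{\sqrt6\,\|u_0-u^*\|}{2\epsilon}\Big\rceil\Big\},\quad K=\Big\lceil\frac{4\sqrt{L^2\eta_0\underline\eta+1}}{\mu\underline\eta}\Big\rceil,\quad \epsilon'=\frac{\mu\epsilon\sqrt{M\underline\eta^2}}{2\sqrt{5(1+M\underline\eta\eta_0)}}$$ (with $N=0$ if $u_0=u^*$). For $k=1,\dots,N$ let $u_k$ be the output of E-Halpern started at $u_{k-1}$ with accuracy $\epsilon'$, step size $\eta_0$ and $K$ iterations, using fresh randomness. Return $u_N$. **Theorem.** For every $c>0$ there is a constant $C>0$, depending only on $c$, such that in the above setting, for all $\epsilon>0$, $u_0\in E$ and all $\eta_0$ with $\frac cL\le\eta_0\le\frac1{3\sqrt3L}$, the output of restarted E-Halpern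 satisfies $$\mathbb E\|u_N-u^*\|^2\le\epsilon^2\qquad\text{and}\qquad\mathbb E\|F(u_N)\|^2\le L^2\epsilon^2,$$ the total number of iterations satisfies $$NK\le C\,\frac L\mu\,\max\Big\{1,\log\frac{\|u_0-u^*\|}\epsilon\Big\},$$ and the expected total number of oracle queries is at most $$C\,\frac{\sigma^2(\mu+L)\max\big\{1,\log\frac{\|u_0-u^*\|}\epsilon\big\}+L^3\|u_0-u^*\|^2}{\mu^3\epsilon^2}$$ (with $\max\{1,\log\frac{\|u_0-u^*\|}{\epsilon}\}$ read as $1$ if $u_0=u^*$). -/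

import Mathlib

open MeasureTheory ProbabilityTheory
open scoped RealInnerProductSpace

noncomputable section

namespace RestartedHalpern

/-- Monotone operator. -/
def IsMonotoneOp {E : Type*} [NormedAddCommGroup E] [InnerProductSpace ℝ E] (F : E → E) : Prop :=
  ∀ u v : E, 0 ≤ ⟪F u - F v, u - v⟫

/-- `F` is `μ`-sharp at `ustar`. -/
def IsSharp {E : Type*} [NormedAddCommGroup E] [InnerProductSpace ℝ E] (F : E → E) (μ : ℝ)
    (ustar : E) : Prop :=
  ∀ u : E, μ * ‖u - ustar‖ ^ 2 ≤ ⟪F u - F ustar, u - ustar⟫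

/-- Stochastic oracle `Fhat` for `F` with sample distribution `Pz`: unbiased, with variance at most
`σ ^ 2`, and `L`-Lipschitz in mean square. A query is one evaluation of `Fhat x z`; the same sample
`z` may be used at several points `x`. -/
structure IsStochasticOracle {E Z : Type*} [NormedAddCommGroup E] [InnerProductSpace ℝ E]
    [MeasurableSpace E] [MeasurableSpace Z] (F : E → E) (Fhat : E → Z → E) (Pz : Measure Z)
    (L σ : ℝ) : Prop where
  measurable : Measurable (fun q : E × Z => Fhat q.1 q.2)
  integrable : ∀ x, Integrable (Fhat x) Pz
  unbiased : ∀ x, ∫ z, Fhat x z ∂Pz = F x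
  integrable_sq : ∀ x, Integrable (fun z => ‖Fhat x z - F x‖ ^ 2) Pz
  variance_le : ∀ x, ∫ z, ‖Fhat x z - F x‖ ^ 2 ∂Pz ≤ σ ^ 2
  lipschitz : ∀ u v, ∫ z, ‖Fhat u z - Fhat v z‖ ^ 2 ∂Pz ≤ L ^ 2 * ‖u - v‖ ^ 2

/-- Randomness used to form one estimate: the outcome of the coin (`true` means that a fresh full
batch is drawn) and a sequence of samples, of which the algorithm uses as many as it needs. -/
abbrev Seed (Z : Type*) := Bool × (ℕ → Z)

/-- `batchProb j` is the probability that the estimate formed in iteration `j` (that is, the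
estimate at `v_{j-1}`) is a fresh full batch: `1` for the initial estimate at `v_{-1}`, and
`min (2 / j) 1` in iteration `j ≥ 1`. -/
def batchProb : ℕ → unitInterval
  | 0 => 1
  | j + 1 => ⟨min (2 / ((j : ℝ) + 1)) 1, le_min (by positivity) zero_le_one, min_le_right _ _⟩

/-- Law of the seed of iteration `j`: a Bernoulli coin with success probability `batchProb j`,
independent of an i.i.d. sequence of samples from `Pz`. -/
def seedLaw {Z : Type*} [MeasurableSpace Z] (Pz : Measure Z) (j : ℕ) : Measure (Seed Z) :=
  (bernoulliMeasure true false (batchProb j)).prod (Measure.infinitePi fun _ : ℕ => Pz)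

/-- The seeds `ξ (k, j)` (call `k`, iteration `j`) are independent and have the laws `seedLaw`. -/
structure IsSeedFamily {Ω Z : Type*} [MeasurableSpace Ω] [MeasurableSpace Z] (P : Measure Ω)
    (Pz : Measure Z) (ξ : ℕ × ℕ → Ω → Seed Z) : Prop where
  measurable : ∀ t, Measurable (ξ t)
  law : ∀ t, P.map (ξ t) = seedLaw Pz t.2
  indep : iIndepFun ξ P

section Algorithm

variable {E Z : Type*} [NormedAddCommGroup E] [InnerProductSpace ℝ E]

/-- Average of `S` oracle answers at `x`. -/
def miniBatch (Fhat : E → Z → E) (x : E) (S : ℕ) (z : ℕ → Z) : E :=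
  (1 / (S : ℝ)) • ∑ i ∈ Finset.range S, Fhat x (z i)

/-- `M = 9 L ^ 2`. -/
def paramM (L : ℝ) : ℝ := 9 * L ^ 2

/-- The lower bound `η₀ (1 - 2 M η₀ ^ 2) / (1 - M η₀ ^ 2)` for the step sizes. -/
def etaLow (L η₀ : ℝ) : ℝ :=
  η₀ * (1 - 2 * paramM L * η₀ ^ 2) / (1 - paramM L * η₀ ^ 2)

/-- State of E-Halpern after `k` iterations: `u = u_k`, `v = v_{k-1}`, `est` the estimate of `F` at
`v_{k-1}`, `η = η_k`, and the number of oracle queries made so far. -/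
structure EHalpernState (E : Type*) where
  u : E
  v : E
  est : E
  η : ℝ
  queries : ℕ

/-- Initialization of E-Halpern: `v_{-1} = u_0` and a full batch of size `⌈8 σ ^ 2 / ε ^ 2⌉`. -/
def eHalpernInit (Fhat : E → Z → E) (σ ε η₀ : ℝ) (u₀ : E) (s : Seed Z) : EHalpernState E :=
  let S := ⌈8 * σ ^ 2 / ε ^ 2⌉₊
  { u := u₀, v := u₀, est := miniBatch Fhat u₀ S s.2, η := η₀, queries := S }

/-- Iteration `k ≥ 1` of E-Halpern. The estimator is the PAGE estimator: with probability
`batchProb k` a fresh batch of `S₁` samples, and otherwise the previous estimate corrected by `S₂`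
differences, each of which costs two queries. -/
def eHalpernStep (Fhat : E → Z → E) (L σ ε : ℝ) (u₀ : E) (k : ℕ) (s : Seed Z)
    (x : EHalpernState E) : EHalpernState E :=
  let anchor : E := (1 / ((k : ℝ) + 1)) • u₀ + ((k : ℝ) / ((k : ℝ) + 1)) • x.u
  let v : E := anchor - x.η • x.est
  let p : ℝ := batchProb k
  let S₁ : ℕ := ⌈8 * σ ^ 2 / (p * ε ^ 2)⌉₊
  let S₂ : ℕ := ⌈8 * L ^ 2 * ‖v - x.v‖ ^ 2 / (p ^ 2 * ε ^ 2)⌉₊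
  let est : E :=
    if s.1 = true then miniBatch Fhat v S₁ s.2
    else x.est + miniBatch (fun w z => Fhat w z - Fhat x.v z) v S₂ s.2
  { u := anchor - x.η • est
    v := v
    est := est
    η := (1 - 1 / ((k : ℝ) + 1) ^ 2 - paramM L * x.η ^ 2) * ((k : ℝ) + 1) ^ 2 /
      ((1 - paramM L * x.η ^ 2) * (k : ℝ) * ((k : ℝ) + 2)) * x.η
    queries := x.queries + if s.1 = true then S₁ else 2 * S₂ }

/-- E-Halpern started at `u₀`, after `k` iterations. -/
def eHalpern (Fhat : E → Z → E) (L σ ε η₀ : ℝ) (u₀ : E) (s : ℕ → Seed Z) : ℕ → EHalpernState E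
  | 0 => eHalpernInit Fhat σ ε η₀ u₀ (s 0)
  | k + 1 => eHalpernStep Fhat L σ ε u₀ (k + 1) (s (k + 1)) (eHalpern Fhat L σ ε η₀ u₀ s k)

/-- Number `N` of calls to E-Halpern, for `D = ‖u₀ - u*‖` (zero if the logarithm is negative). -/
def numCalls (D ε : ℝ) : ℕ := ⌈Real.logb 2 (√6 * D / (2 * ε))⌉₊

/-- Number `K` of iterations in each call. -/
def callLength (L μ η₀ : ℝ) : ℕ :=
  ⌈4 * √(L ^ 2 * η₀ * etaLow L η₀ + 1) / (μ * etaLow L η₀)⌉₊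

/-- Target accuracy `ε_k` (the same for all `k`) passed to E-Halpern in each call. -/
def callAccuracy (L μ η₀ ε : ℝ) : ℝ :=
  μ * ε * √(paramM L * etaLow L η₀ ^ 2) / (2 * √(5 * (1 + paramM L * etaLow L η₀ * η₀)))

/-- Restarted E-Halpern after `k` calls: the point `u_k` and the total number of queries. -/
def restarted (Fhat : E → Z → E) (L μ σ ε η₀ : ℝ) (u₀ : E) (s : ℕ × ℕ → Seed Z) : ℕ → E × ℕ
  | 0 => (u₀, 0)
  | k + 1 =>
    let prev := restarted Fhat L μ σ ε η₀ u₀ s k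
    let run := eHalpern Fhat L σ (callAccuracy L μ η₀ ε) η₀ prev.1 (fun j => s (k, j))
      (callLength L μ η₀)
    (run.u, prev.2 + run.queries)

/-- Output of restarted E-Halpern, with `D = ‖u₀ - u*‖` as an input. -/
def output (Fhat : E → Z → E) (L μ σ ε η₀ D : ℝ) (u₀ : E) (s : ℕ × ℕ → Seed Z) : E :=
  (restarted Fhat L μ σ ε η₀ u₀ s (numCalls D ε)).1

/-- Total number of oracle queries made by restarted E-Halpern. -/
def totalQueries (Fhat : E → Z → E) (L μ σ ε η₀ D : ℝ) (u₀ : E) (s : ℕ × ℕ → Seed Z) : ℕ :=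
  (restarted Fhat L μ σ ε η₀ u₀ s (numCalls D ε)).2

/-- Total number of (inner) iterations made by restarted E-Halpern. -/
def totalIterations (L μ ε η₀ D : ℝ) : ℕ := numCalls D ε * callLength L μ η₀

end Algorithm

end RestartedHalpern

end

/-! E-Halpern is an anchored extragradient method run with inexact values of `F`. The argument
separates a pathwise analysis, valid for arbitrary estimates `f n` of `F (y n)` (`IsTrajectory`),
from a second-moment analysis of the estimation errors.

Pathwise, with weights `a_n = (n+1)(n+2)η_n/2`, monotonicity and the Lipschitz property make the
potential `a_n‖F(u_n)‖² + (n+1)⟨F(u_n), u_n - u_0⟩ + (2/3)a_n‖F(u_n) - F(v_{n-1})‖²` nonincreasing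
up to error terms; the step-size recursion is exactly what makes the relevant quadratic form
degenerate (`weight_quad`, `potential_step_aux`). Sharpness turns the potential into a nonnegative
quantity `progress` containing both `n²‖F(u_n)‖²` and `nμ‖u_n - u*‖²`. The one error term that still
involves `F(u_{n+1})` is absorbed into `progress` with factor `1/(4K)`, and a discrete Gronwall
inequality closes the estimate (`IsTrajectory.progress_le`). For the prescribed `K`, one call
divides the squared distance by four, up to noise (`IsTrajectory.norm_sub_sq_le`).

The recursive estimator has mean square error at most `ε'² min(1/8, 1/(n+1))`
(`IsSeedSequence.meanLE_error`). Weighted by `n²` and summed, this is of order `K²ε'²`, and the `K²`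
cancels against the `K²` in `progress`. A call therefore maps a mean squared distance `b` to at most
`b/4 + ε²/4`, whose fixed point is `ε²/3`; the number of restarts brings the initial contribution
below `2ε²/3`. The bound on `F(u_N)` follows from the Lipschitz property.

For the cost, a full batch has size proportional to `1/p` but occurs with probability `p`. The same
pathwise analysis shows that `‖v_n - v_{n-1}‖` decays like `1/n`, which cancels the factor `1/p²` of
order `n²` in the correction batch (`eHalpern_queries_le`). Each iteration thus has bounded expected
cost, and the starting distances of the calls sum geometrically, so that `‖u_0 - u*‖²` is paid
without a logarithm. -/

namespace RestartedHalpern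

/-! ### Step sizes -/

/-- The step sizes of E-Halpern. -/
noncomputable def stepSize (L η₀ : ℝ) : ℕ → ℝ
  | 0 => η₀
  | n + 1 => (1 - 1 / (((n + 1 : ℕ) : ℝ) + 1) ^ 2 - paramM L * stepSize L η₀ n ^ 2) *
      (((n + 1 : ℕ) : ℝ) + 1) ^ 2 /
      ((1 - paramM L * stepSize L η₀ n ^ 2) * ((n + 1 : ℕ) : ℝ) * (((n + 1 : ℕ) : ℝ) + 2)) *
      stepSize L η₀ n

theorem paramM_mul_sq_le {L η₀ : ℝ} (hL : 0 < L) (h0 : 0 < η₀) (h : η₀ ≤ 1 / (3 * √3 * L)) :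
    paramM L * η₀ ^ 2 ≤ 1 / 3 := by
  have h3 : 0 < √3 := by positivity
  have h1 : η₀ * (3 * √3 * L) ≤ 1 := by
    rwa [le_div_iff₀ (by positivity)] at h
  have h2 : (η₀ * (3 * √3 * L)) ^ 2 ≤ 1 := by
    have : 0 ≤ η₀ * (3 * √3 * L) := by positivity
    nlinarith
  have h4 : √3 ^ 2 = 3 := Real.sq_sqrt (by norm_num)
  have h5 : (η₀ * (3 * √3 * L)) ^ 2 = 27 * (L ^ 2 * η₀ ^ 2) := by
    calc (η₀ * (3 * √3 * L)) ^ 2 = 9 * √3 ^ 2 * (L ^ 2 * η₀ ^ 2) := by ring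
      _ = _ := by rw [h4]; ring
  unfold paramM
  linarith

theorem stepSize_succ {L η₀ : ℝ} (n : ℕ) (hm : paramM L * stepSize L η₀ n ^ 2 ≤ 1 / 3) :
    stepSize L η₀ (n + 1) = stepSize L η₀ n -
      paramM L * stepSize L η₀ n ^ 2 / (1 - paramM L * stepSize L η₀ n ^ 2) /
        (((n : ℝ) + 1) * (n + 3)) * stepSize L η₀ n := by
  rw [stepSize]
  set m := paramM L * stepSize L η₀ n ^ 2
  have h1 : (1 - m) ≠ 0 := by linarith
  have h2 : (n : ℝ) + 1 ≠ 0 := by positivity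
  have h3 : (n : ℝ) + 2 ≠ 0 := by positivity
  have h4 : (n : ℝ) + 3 ≠ 0 := by positivity
  have e1 : (((n + 1 : ℕ) : ℝ) + 1) = n + 2 := by push_cast; ring
  have e2 : (((n + 1 : ℕ) : ℝ) + 2) = n + 3 := by push_cast; ring
  rw [e1, e2]
  push_cast
  field_simp
  ring

theorem etaLow_eq {L η₀ : ℝ} (hm : paramM L * η₀ ^ 2 ≤ 1 / 3) :
    etaLow L η₀ = η₀ - paramM L * η₀ ^ 2 / (1 - paramM L * η₀ ^ 2) * η₀ := by
  unfold etaLow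
  rw [mul_assoc 2]
  generalize paramM L * η₀ ^ 2 = m at hm ⊢
  have h1 : 1 - m ≠ 0 := by linarith
  field_simp
  ring

theorem paramM_nonneg (L : ℝ) : 0 ≤ paramM L := by unfold paramM; positivity

/-- By `stepSize_succ` the relative decrease is at most `ρ/((n+1)(n+3))` with `ρ = Mη₀²/(1 - Mη₀²)`.
Weakening `n+3` to `n+2` makes the losses telescope to `ρη₀ n/(n+1)`, whose limit `ρη₀` is precisely
`η₀ - etaLow L η₀`. -/
theorem stepSize_bounds {L η₀ : ℝ} (h0 : 0 < η₀) (hm : paramM L * η₀ ^ 2 ≤ 1 / 3) (n : ℕ) :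
    η₀ - paramM L * η₀ ^ 2 / (1 - paramM L * η₀ ^ 2) * η₀ * (n / (n + 1)) ≤ stepSize L η₀ n ∧
      stepSize L η₀ n ≤ η₀ := by
  have hM := paramM_nonneg L
  set ρ := paramM L * η₀ ^ 2 / (1 - paramM L * η₀ ^ 2) with hρ
  have hm0 : 0 ≤ paramM L * η₀ ^ 2 := by positivity
  have hρ0 : 0 ≤ ρ := div_nonneg hm0 (by linarith)
  have hρ1 : ρ ≤ 1 / 2 := by
    rw [hρ, div_le_iff₀ (by linarith)]; linarith
  induction n with
  | zero => simp [stepSize]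
  | succ n ih =>
    obtain ⟨hlo, hhi⟩ := ih
    set η := stepSize L η₀ n with hη
    have hη0 : 0 ≤ η := by
      have : (n : ℝ) / (n + 1) ≤ 1 := by
        rw [div_le_one (by positivity)]; linarith
      have : ρ * η₀ * (n / (n + 1)) ≤ 1 / 2 * η₀ * 1 := by gcongr
      linarith
    have hmn : paramM L * η ^ 2 ≤ paramM L * η₀ ^ 2 := by gcongr
    have hmn0 : 0 ≤ paramM L * η ^ 2 := by positivity
    have hr : paramM L * η ^ 2 / (1 - paramM L * η ^ 2) ≤ ρ := by
      rw [hρ]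
      apply div_le_div₀ hm0 hmn (by linarith) (by linarith)
    have hr0 : 0 ≤ paramM L * η ^ 2 / (1 - paramM L * η ^ 2) := div_nonneg hmn0 (by linarith)
    rw [stepSize_succ n (by rw [← hη]; linarith), ← hη]
    constructor
    · have h1 : paramM L * η ^ 2 / (1 - paramM L * η ^ 2) / (((n : ℝ) + 1) * (n + 3)) * η ≤
          ρ / (((n : ℝ) + 1) * (n + 2)) * η₀ := by
        gcongr
        linarith
      have h2 : ρ * η₀ * (((n + 1 : ℕ) : ℝ) / ((n + 1 : ℕ) + 1)) =
          ρ * η₀ * (n / (n + 1)) + ρ / (((n : ℝ) + 1) * (n + 2)) * η₀ := by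
        push_cast
        have h2 : (n : ℝ) + 1 ≠ 0 := by positivity
        have h3 : (n : ℝ) + 2 ≠ 0 := by positivity
        have h4 : (n : ℝ) + 1 + 1 ≠ 0 := by positivity
        field_simp
        ring
      rw [h2]
      linarith
    · have : 0 ≤ paramM L * η ^ 2 / (1 - paramM L * η ^ 2) / (((n : ℝ) + 1) * (n + 3)) * η := by
        positivity
      linarith

theorem half_le_etaLow {L η₀ : ℝ} (h0 : 0 < η₀) (hm : paramM L * η₀ ^ 2 ≤ 1 / 3) :
    η₀ / 2 ≤ etaLow L η₀ := by
  have hM := paramM_nonneg L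
  have hρ1 : paramM L * η₀ ^ 2 / (1 - paramM L * η₀ ^ 2) ≤ 1 / 2 := by
    rw [div_le_iff₀ (by linarith)]; linarith
  rw [etaLow_eq hm]
  nlinarith

theorem etaLow_pos {L η₀ : ℝ} (h0 : 0 < η₀) (hm : paramM L * η₀ ^ 2 ≤ 1 / 3) :
    0 < etaLow L η₀ := by
  linarith [half_le_etaLow h0 hm]

theorem etaLow_le {L η₀ : ℝ} (h0 : 0 < η₀) (hm : paramM L * η₀ ^ 2 ≤ 1 / 3) :
    etaLow L η₀ ≤ η₀ := by
  rw [etaLow_eq hm]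
  have : 0 ≤ paramM L * η₀ ^ 2 / (1 - paramM L * η₀ ^ 2) :=
    div_nonneg (mul_nonneg (paramM_nonneg L) (by positivity)) (by linarith)
  nlinarith

theorem etaLow_le_stepSize {L η₀ : ℝ} (h0 : 0 < η₀) (hm : paramM L * η₀ ^ 2 ≤ 1 / 3) (n : ℕ) :
    etaLow L η₀ ≤ stepSize L η₀ n := by
  refine le_trans ?_ (stepSize_bounds h0 hm n).1
  rw [etaLow_eq hm]
  have : 0 ≤ paramM L * η₀ ^ 2 / (1 - paramM L * η₀ ^ 2) :=
    div_nonneg (mul_nonneg (paramM_nonneg L) (by positivity)) (by linarith)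
  have h2 : (n : ℝ) / (n + 1) ≤ 1 := by
    rw [div_le_one (by positivity)]; linarith
  have : 0 ≤ paramM L * η₀ ^ 2 / (1 - paramM L * η₀ ^ 2) * η₀ := by positivity
  nlinarith

theorem stepSize_succ_le {L η₀ : ℝ} (h0 : 0 < η₀) (hm : paramM L * η₀ ^ 2 ≤ 1 / 3) (n : ℕ) :
    stepSize L η₀ (n + 1) ≤ stepSize L η₀ n := by
  have hpos : 0 < stepSize L η₀ n := (etaLow_pos h0 hm).trans_le (etaLow_le_stepSize h0 hm n)
  have hM := paramM_nonneg L
  have hmn : paramM L * stepSize L η₀ n ^ 2 ≤ paramM L * η₀ ^ 2 := by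
    have := (stepSize_bounds h0 hm n).2
    gcongr
  rw [stepSize_succ n (hmn.trans hm)]
  have : 0 ≤ paramM L * stepSize L η₀ n ^ 2 / (1 - paramM L * stepSize L η₀ n ^ 2) :=
    div_nonneg (mul_nonneg hM (by positivity)) (by linarith)
  have : 0 ≤ paramM L * stepSize L η₀ n ^ 2 / (1 - paramM L * stepSize L η₀ n ^ 2) /
    (((n : ℝ) + 1) * (n + 3)) * stepSize L η₀ n := by positivity
  linarith

theorem paramM_mul_etaLow_mul_le {L η₀ : ℝ} (hm : paramM L * η₀ ^ 2 ≤ 1 / 3) :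
    paramM L * etaLow L η₀ * η₀ ≤ 1 / 5 := by
  set m := paramM L * η₀ ^ 2 with hmdef
  have : paramM L * etaLow L η₀ * η₀ = m * (1 - 2 * m) / (1 - m) := by
    unfold etaLow
    rw [mul_assoc 2, ← hmdef]
    have h1 : (1 - m) ≠ 0 := by linarith
    field_simp
    rw [hmdef]
  rw [this, div_le_iff₀ (by linarith)]
  -- After clearing the denominator the claim is `2(m - 3/10)² + 1/50 ≥ 0`.
  nlinarith [sq_nonneg (m - 3 / 10)]

/-! ### Potential function -/

theorem norm_sub_add_sub_sq_le {E : Type*} [NormedAddCommGroup E] (G H H' e e' : E) :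
    ‖(H + e) - (H' + e')‖ ^ 2 ≤
      3 * ‖H - G‖ ^ 2 + 3 * ‖G - H'‖ ^ 2 + 6 * ‖e‖ ^ 2 + 6 * ‖e'‖ ^ 2 := by
  have h : ‖(H + e) - (H' + e')‖ ≤ ‖H - G‖ + ‖G - H'‖ + (‖e‖ + ‖e'‖) := by
    calc ‖(H + e) - (H' + e')‖ = ‖(H - G) + (G - H') + (e - e')‖ := by congr 1; abel
      _ ≤ ‖H - G‖ + ‖G - H'‖ + ‖e - e'‖ := norm_add₃_le
      _ ≤ _ := by gcongr; exact norm_sub_le _ _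
  calc ‖(H + e) - (H' + e')‖ ^ 2 ≤ (‖H - G‖ + ‖G - H'‖ + (‖e‖ + ‖e'‖)) ^ 2 := by gcongr
    _ ≤ _ := by
      nlinarith [sq_nonneg (‖H - G‖ - ‖G - H'‖), sq_nonneg (‖H - G‖ - (‖e‖ + ‖e'‖)),
        sq_nonneg (‖G - H'‖ - (‖e‖ + ‖e'‖)), sq_nonneg (‖e‖ - ‖e'‖)]

section Potential

variable {E : Type*} [NormedAddCommGroup E] [InnerProductSpace ℝ E]

/-- The discriminant vanishes, so `W - a` times the form is a perfect square. -/
theorem quadForm_nonneg {W a a' b : ℝ} (h : (W - a) * (W - a') = (W - b) ^ 2) (hWa : a < W)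
    (G' H : E) :
    0 ≤ (W - a) * ‖H‖ ^ 2 + (W - a') * ‖G'‖ ^ 2 - 2 * (W - b) * ⟪G', H⟫ := by
  have h1 : 0 ≤ ‖(W - a) • H - (W - b) • G'‖ ^ 2 := by positivity
  rw [norm_sub_sq_real, norm_smul, norm_smul, mul_pow, mul_pow, inner_smul_left, inner_smul_right,
    Real.norm_eq_abs, Real.norm_eq_abs, sq_abs, sq_abs, real_inner_comm] at h1
  simp only [conj_trivial] at h1
  have h2 : 0 ≤ (W - a) * ((W - a) * ‖H‖ ^ 2 + (W - a') * ‖G'‖ ^ 2 - 2 * (W - b) * ⟪G', H⟫) := by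
    rw [← h] at h1
    nlinarith
  exact nonneg_of_mul_nonneg_right h2 (by linarith)

/-- The algebra of one potential step: `G`, `G'` are values of `F` at consecutive iterates, `H'`,
`H` at consecutive extrapolated points, `e'`, `e` the estimation errors, and `X` the increment of
the anchored inner product. Without errors, the change of the potential is `W‖G' - H‖² - a‖H - G‖²`
minus the form of `quadForm_nonneg`. Of the two copies of `W‖G' - H‖²` in `hlip`, one pays for this,
the other covers the new third term of the potential and a Young term, since `2a'/3 + a ≤ 3a ≤ W`.
The coefficients of `a‖H - G‖²` cancel exactly: `2/3 + 1/3 - 1 = 0`. -/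
theorem potential_step_aux {a a' W s κ : ℝ} (ha : 0 < a) (hW : 3 * a ≤ W) (ha' : a' ≤ 3 * a)
    (hsk : s * κ = 2 * a)
    (hquad : (W - a) * (W - a') = (W - s * (κ + 1) / 2) ^ 2)
    {G G' H H' e e' : E} {X : ℝ}
    (hlip : 2 * W * ‖G' - H‖ ^ 2 ≤ 2 / 9 * a * ‖(H + e) - (H' + e')‖ ^ 2)
    (hmon : X ≤ -s * ((κ + 1) * ⟪G', H + e⟫ - κ * ⟪G, H + e⟫)) (hs : 0 ≤ s) :
    a' * ‖G'‖ ^ 2 + X + 2 / 3 * a' * ‖G' - H‖ ^ 2 ≤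
      a * ‖G‖ ^ 2 + 2 / 3 * a * ‖G - H'‖ ^ 2 + 16 / 3 * a * ‖e‖ ^ 2 + 4 / 3 * a * ‖e'‖ ^ 2 +
        s * ‖G'‖ * ‖e‖ := by
  have hQ := quadForm_nonneg hquad (by linarith) G' H
  have h3 := norm_sub_add_sub_sq_le G H H' e e'
  have h4 : 2 / 9 * a * ‖(H + e) - (H' + e')‖ ^ 2 ≤ 2 / 9 * a *
      (3 * ‖H - G‖ ^ 2 + 3 * ‖G - H'‖ ^ 2 + 6 * ‖e‖ ^ 2 + 6 * ‖e'‖ ^ 2) := by gcongr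
  have e1 : ‖G' - H‖ ^ 2 = ‖G'‖ ^ 2 - 2 * ⟪G', H⟫ + ‖H‖ ^ 2 := norm_sub_sq_real _ _
  have e2 : ‖H - G‖ ^ 2 = ‖H‖ ^ 2 - 2 * ⟪G, H⟫ + ‖G‖ ^ 2 := by
    rw [norm_sub_sq_real, real_inner_comm]
  have y1 : -⟪G' - H, e⟫ ≤ 1 / 2 * ‖G' - H‖ ^ 2 + 1 / 2 * ‖e‖ ^ 2 := by
    have := abs_real_inner_le_norm (G' - H) e
    nlinarith [abs_le.1 this, sq_nonneg (‖G' - H‖ - ‖e‖)]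
  have y2 : -⟪H - G, e⟫ ≤ 1 / 6 * ‖H - G‖ ^ 2 + 3 / 2 * ‖e‖ ^ 2 := by
    have := abs_real_inner_le_norm (H - G) e
    nlinarith [abs_le.1 this, sq_nonneg (‖H - G‖ - 3 * ‖e‖)]
  have y3 : -⟪G', e⟫ ≤ ‖G'‖ * ‖e‖ := by
    have := abs_real_inner_le_norm G' e
    linarith [(abs_le.1 this).1]
  have i1 : ⟪G', H + e⟫ = ⟪G', H⟫ + ⟪G', e⟫ := inner_add_right _ _ _
  have i2 : ⟪G, H + e⟫ = ⟪G, H⟫ + ⟪G, e⟫ := inner_add_right _ _ _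
  have i3 : ⟪G' - H, e⟫ = ⟪G', e⟫ - ⟪H, e⟫ := inner_sub_left _ _ _
  have i4 : ⟪H - G, e⟫ = ⟪H, e⟫ - ⟪G, e⟫ := inner_sub_left _ _ _
  rw [i1, i2] at hmon
  -- The error is paired with `sκ(G' - G) + sG'`, and `sκ = 2a`; splitting `G' - G` at `H` leaves
  -- only quantities already controlled, except for `s⟪G', e⟫`, which stays in the conclusion.
  have m1 : -s * ((κ + 1) * (⟪G', H⟫ + ⟪G', e⟫) - κ * (⟪G, H⟫ + ⟪G, e⟫)) =
      -(s * (κ + 1)) * ⟪G', H⟫ + 2 * a * ⟪G, H⟫ +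
        2 * a * (-⟪G' - H, e⟫) + 2 * a * (-⟪H - G, e⟫) + s * (-⟪G', e⟫) := by
    rw [i3, i4, ← hsk]; ring
  have z1 := mul_le_mul_of_nonneg_left y1 (by positivity : 0 ≤ 2 * a)
  have z2 := mul_le_mul_of_nonneg_left y2 (by positivity : 0 ≤ 2 * a)
  have z3 := mul_le_mul_of_nonneg_left y3 hs
  have z4 : 0 ≤ (W - 2 / 3 * a' - a) * ‖G' - H‖ ^ 2 :=
    mul_nonneg (by linarith) (by positivity)
  rw [m1] at hmon
  have key : a' * ‖G'‖ ^ 2 + (-(s * (κ + 1)) * ⟪G', H⟫ + 2 * a * ⟪G, H⟫) - a * ‖G‖ ^ 2 =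
      W * ‖G' - H‖ ^ 2 - a * ‖H - G‖ ^ 2 - ((W - a) * ‖H‖ ^ 2 + (W - a') * ‖G'‖ ^ 2 -
        2 * (W - s * (κ + 1) / 2) * ⟪G', H⟫) := by
    rw [e1, e2]; ring
  clear e1 e2 i1 i2 i3 i4 m1 y1 y2 y3 h3 hquad
  linarith

end Potential

/-! ### Weighted sum of the squared estimation errors -/

section Noise

variable {E : Type*} [NormedAddCommGroup E]

/-- Contribution of the estimation errors `g n` and `g (n + 1)` to the growth of the potential. -/
noncomputable def noiseTerm (η₀ : ℝ) (K : ℕ) (g : ℕ → E) (n : ℕ) : ℝ :=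
  η₀ * ((8 / 3 * ((n : ℝ) + 1) * (n + 2) + 8 * K) * ‖g (n + 1)‖ ^ 2 +
    2 / 3 * ((n : ℝ) + 1) * (n + 2) * ‖g n‖ ^ 2)

/-- Total contribution of the estimation errors over `K` iterations. -/
noncomputable def noise (η₀ : ℝ) (K : ℕ) (g : ℕ → E) : ℝ :=
  ∑ n ∈ Finset.range K, noiseTerm η₀ K g n

theorem noiseTerm_nonneg {η₀ : ℝ} (h0 : 0 < η₀) (K : ℕ) (g : ℕ → E) (n : ℕ) :
    0 ≤ noiseTerm η₀ K g n := by
  unfold noiseTerm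
  positivity

theorem noise_nonneg {η₀ : ℝ} (h0 : 0 < η₀) (K : ℕ) (g : ℕ → E) : 0 ≤ noise η₀ K g :=
  Finset.sum_nonneg fun n _ => noiseTerm_nonneg h0 K g n

end Noise

/-! ### Pathwise analysis with arbitrary estimates -/

section Trajectory

variable {E : Type*} [NormedAddCommGroup E] [InnerProductSpace ℝ E]

/-- The recursion of E-Halpern for the iterates `x n = u_n`, the extrapolated points `y n = v_{n-1}`
and arbitrary estimates `f n`. -/
structure IsTrajectory (L η₀ : ℝ) (x y f : ℕ → E) : Prop where
  y_zero : y 0 = x 0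
  y_succ : ∀ n : ℕ, y (n + 1) = (1 / ((n : ℝ) + 2)) • x 0 + (((n : ℝ) + 1) / (n + 2)) • x n -
    stepSize L η₀ n • f n
  x_succ : ∀ n : ℕ, x (n + 1) = (1 / ((n : ℝ) + 2)) • x 0 + (((n : ℝ) + 1) / (n + 2)) • x n -
    stepSize L η₀ n • f (n + 1)

/-- The weight of `‖F (u_n)‖ ^ 2` in the potential. -/
noncomputable def weight (L η₀ : ℝ) (n : ℕ) : ℝ := ((n : ℝ) + 1) * (n + 2) * stepSize L η₀ n / 2

/-- The potential of E-Halpern. -/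
noncomputable def potential (F : E → E) (L η₀ : ℝ) (x y : ℕ → E) (n : ℕ) : ℝ :=
  weight L η₀ n * ‖F (x n)‖ ^ 2 + ((n : ℝ) + 1) * ⟪F (x n), x n - x 0⟫ +
    2 / 3 * weight L η₀ n * ‖F (x n) - F (y n)‖ ^ 2

/-- The nonnegative quantity controlled by the potential. -/
noncomputable def progress (F : E → E) (L η₀ μ : ℝ) (ustar : E) (x y : ℕ → E) (n : ℕ) : ℝ :=
  weight L η₀ n / 2 * ‖F (x n)‖ ^ 2 + ((n : ℝ) + 1) * μ * ‖x n - ustar‖ ^ 2 +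
    2 / 3 * weight L η₀ n * ‖F (x n) - F (y n)‖ ^ 2

variable {F : E → E} {L η₀ μ : ℝ} {ustar : E} {x y f : ℕ → E}

/-- The reason for the form of the step-size recursion: with `W = a_n/(Mη_n²)`, it is the choice of
`η_{n+1}` that gives the quadratic form in `potential_step_aux` zero discriminant. -/
theorem weight_quad {n : ℕ} (hη : 0 < stepSize L η₀ n) (hL : 0 < L)
    (hm : paramM L * stepSize L η₀ n ^ 2 ≤ 1 / 3) :
    (weight L η₀ n / (paramM L * stepSize L η₀ n ^ 2) - weight L η₀ n) *
      (weight L η₀ n / (paramM L * stepSize L η₀ n ^ 2) - weight L η₀ (n + 1)) =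
    (weight L η₀ n / (paramM L * stepSize L η₀ n ^ 2) -
      stepSize L η₀ n * ((n : ℝ) + 2) * (((n : ℝ) + 1) + 1) / 2) ^ 2 := by
  have hm0 : 0 < paramM L * stepSize L η₀ n ^ 2 := by unfold paramM; positivity
  unfold weight
  rw [stepSize_succ n hm]
  generalize paramM L * stepSize L η₀ n ^ 2 = m at *
  generalize stepSize L η₀ n = η at *
  have h1 : 1 - m ≠ 0 := by linarith
  have h2 : (n : ℝ) + 1 ≠ 0 := by positivity
  have h3 : (n : ℝ) + 2 ≠ 0 := by positivity
  have h4 : (n : ℝ) + 3 ≠ 0 := by positivity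
  have e1 : (((n + 1 : ℕ) : ℝ) + 1) = n + 2 := by push_cast; ring
  have e2 : (((n + 1 : ℕ) : ℝ) + 2) = n + 3 := by push_cast; ring
  rw [e1, e2]
  generalize (n : ℝ) = t at *
  field_simp
  ring

/-- Monotonicity between `x n` and `x (n + 1)`, multiplied by `(n+1)(n+2)`. The increment `x (n + 1)
- x n` is expressed through `x n - x 0` in the pairing with `F (x n)` and through `x (n + 1) - x 0`
in the pairing with `F (x (n + 1))`. -/
theorem IsTrajectory.inner_le (h : IsTrajectory L η₀ x y f) (hF : IsMonotoneOp F) (n : ℕ) :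
    ((n : ℝ) + 2) * ⟪F (x (n + 1)), x (n + 1) - x 0⟫ - ((n : ℝ) + 1) * ⟪F (x n), x n - x 0⟫ ≤
      -(stepSize L η₀ n * ((n : ℝ) + 2)) * ((((n : ℝ) + 1) + 1) * ⟪F (x (n + 1)), f (n + 1)⟫ -
        ((n : ℝ) + 1) * ⟪F (x n), f (n + 1)⟫) := by
  set η := stepSize L η₀ n
  set t : ℝ := (n : ℝ) with ht
  have t0 : 0 ≤ t := Nat.cast_nonneg n
  have hm := hF (x (n + 1)) (x n)
  have e1 : (t + 2) • (x (n + 1) - x n) = -(x n - x 0) - (η * (t + 2)) • f (n + 1) := by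
    rw [h.x_succ n]
    match_scalars <;> field_simp <;> ring
  have e2 : (t + 1) • (x (n + 1) - x n) = -(x (n + 1) - x 0) - (η * (t + 2)) • f (n + 1) := by
    rw [h.x_succ n]
    match_scalars <;> field_simp <;> ring
  have i1 : (t + 2) * ⟪F (x n), x (n + 1) - x n⟫ =
      -⟪F (x n), x n - x 0⟫ - η * (t + 2) * ⟪F (x n), f (n + 1)⟫ := by
    rw [← real_inner_smul_right, e1, inner_sub_right, inner_neg_right, real_inner_smul_right]
  have i2 : (t + 1) * ⟪F (x (n + 1)), x (n + 1) - x n⟫ =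
      -⟪F (x (n + 1)), x (n + 1) - x 0⟫ - η * (t + 2) * ⟪F (x (n + 1)), f (n + 1)⟫ := by
    rw [← real_inner_smul_right, e2, inner_sub_right, inner_neg_right, real_inner_smul_right]
  rw [inner_sub_left] at hm
  have hm2 : 0 ≤ (t + 1) * (t + 2) * (⟪F (x (n + 1)), x (n + 1) - x n⟫ -
    ⟪F (x n), x (n + 1) - x n⟫) := by positivity
  have : (t + 1) * (t + 2) * (⟪F (x (n + 1)), x (n + 1) - x n⟫ - ⟪F (x n), x (n + 1) - x n⟫) =
      (t + 2) * ((t + 1) * ⟪F (x (n + 1)), x (n + 1) - x n⟫) -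
        (t + 1) * ((t + 2) * ⟪F (x n), x (n + 1) - x n⟫) := by ring
  rw [this, i1, i2] at hm2
  linarith

theorem IsTrajectory.x_sub_y (h : IsTrajectory L η₀ x y f) (n : ℕ) :
    x (n + 1) - y (n + 1) = -(stepSize L η₀ n) • (f (n + 1) - f n) := by
  rw [h.x_succ n, h.y_succ n]
  module

theorem weight_pos (h0 : 0 < η₀) (hm : paramM L * η₀ ^ 2 ≤ 1 / 3) (n : ℕ) :
    0 < weight L η₀ n := by
  have := (etaLow_pos h0 hm).trans_le (etaLow_le_stepSize h0 hm n)
  unfold weight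
  positivity

theorem weight_le (h0 : 0 < η₀) (hm : paramM L * η₀ ^ 2 ≤ 1 / 3) (n : ℕ) :
    weight L η₀ n ≤ ((n : ℝ) + 1) * (n + 2) * η₀ / 2 := by
  have := (stepSize_bounds h0 hm n).2
  unfold weight
  gcongr

theorem le_weight (h0 : 0 < η₀) (hm : paramM L * η₀ ^ 2 ≤ 1 / 3) (n : ℕ) :
    ((n : ℝ) + 1) * (n + 2) * etaLow L η₀ / 2 ≤ weight L η₀ n := by
  have := etaLow_le_stepSize h0 hm n
  unfold weight
  gcongr

theorem IsTrajectory.potential_succ_le (h : IsTrajectory L η₀ x y f) (hF : IsMonotoneOp F)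
    (hlip : ∀ u v, ‖F u - F v‖ ≤ L * ‖u - v‖) (hL : 0 < L) (h0 : 0 < η₀)
    (hm : paramM L * η₀ ^ 2 ≤ 1 / 3) (n : ℕ) :
    potential F L η₀ x y (n + 1) ≤ potential F L η₀ x y n +
      16 / 3 * weight L η₀ n * ‖f (n + 1) - F (y (n + 1))‖ ^ 2 +
      4 / 3 * weight L η₀ n * ‖f n - F (y n)‖ ^ 2 +
      stepSize L η₀ n * ((n : ℝ) + 2) * ‖F (x (n + 1))‖ * ‖f (n + 1) - F (y (n + 1))‖ := by
  have hη : 0 < stepSize L η₀ n := (etaLow_pos h0 hm).trans_le (etaLow_le_stepSize h0 hm n)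
  have hmn : paramM L * stepSize L η₀ n ^ 2 ≤ 1 / 3 := by
    refine le_trans ?_ hm
    have := (stepSize_bounds h0 hm n).2
    have := paramM_nonneg L
    gcongr
  have hmpos : 0 < paramM L * stepSize L η₀ n ^ 2 := by unfold paramM; positivity
  have ha := weight_pos h0 hm n
  have hW : 3 * weight L η₀ n ≤ weight L η₀ n / (paramM L * stepSize L η₀ n ^ 2) := by
    rw [le_div_iff₀ hmpos]
    nlinarith
  have ha' : weight L η₀ (n + 1) ≤ 3 * weight L η₀ n := by
    have h1 := stepSize_succ_le h0 hm n
    have h2 : weight L η₀ (n + 1) ≤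
        (((n + 1 : ℕ) : ℝ) + 1) * (((n + 1 : ℕ) : ℝ) + 2) * stepSize L η₀ n / 2 := by
      rw [weight]
      gcongr
    refine h2.trans ?_
    unfold weight
    push_cast
    have : (0 : ℝ) ≤ n := Nat.cast_nonneg n
    nlinarith [mul_nonneg hη.le this, mul_nonneg (mul_nonneg hη.le this) this]
  -- Here `M = 9L²` enters: `‖F(x) - F(y)‖² ≤ L²η²‖f_{n+1} - f_n‖²`, and the prefactor `2a/(9L²η²)`
  -- turns this into `(2/9)a‖f_{n+1} - f_n‖²`.
  have hl : 2 * (weight L η₀ n / (paramM L * stepSize L η₀ n ^ 2)) *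
      ‖F (x (n + 1)) - F (y (n + 1))‖ ^ 2 ≤ 2 / 9 * weight L η₀ n *
      ‖(F (y (n + 1)) + (f (n + 1) - F (y (n + 1)))) - (F (y n) + (f n - F (y n)))‖ ^ 2 := by
    have h1 := hlip (x (n + 1)) (y (n + 1))
    rw [h.x_sub_y, norm_smul, norm_neg, Real.norm_eq_abs, abs_of_pos hη] at h1
    rw [add_sub_cancel, add_sub_cancel]
    have h2 : ‖F (x (n + 1)) - F (y (n + 1))‖ ^ 2 ≤
        (L * (stepSize L η₀ n * ‖f (n + 1) - f n‖)) ^ 2 := by gcongr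
    calc _ ≤ 2 * (weight L η₀ n / (paramM L * stepSize L η₀ n ^ 2)) *
          (L * (stepSize L η₀ n * ‖f (n + 1) - f n‖)) ^ 2 := by gcongr
      _ = _ := by
        unfold paramM
        field_simp
  have hmon := h.inner_le hF n
  have key := potential_step_aux (a := weight L η₀ n) (a' := weight L η₀ (n + 1))
    (W := weight L η₀ n / (paramM L * stepSize L η₀ n ^ 2)) (s := stepSize L η₀ n * ((n : ℝ) + 2))
    (κ := (n : ℝ) + 1) (G := F (x n)) (G' := F (x (n + 1))) (H := F (y (n + 1))) (H' := F (y n))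
    (e := f (n + 1) - F (y (n + 1))) (e' := f n - F (y n))
    (X := ((n : ℝ) + 2) * ⟪F (x (n + 1)), x (n + 1) - x 0⟫ - ((n : ℝ) + 1) * ⟪F (x n), x n - x 0⟫)
    ha hW ha' (by unfold weight; ring) (weight_quad hη hL hmn) hl
    (by rw [add_sub_cancel]; exact hmon) (by positivity)
  have e1 : (((n + 1 : ℕ) : ℝ) + 1) = n + 2 := by push_cast; ring
  unfold potential
  rw [e1]
  linarith

/-- Split `x n - x 0` at `ustar`. Sharpness bounds the first pairing from below by `μ‖x n -
ustar‖²`; the second is absorbed, by completing a square, into half of the weight of `‖F (x n)‖²` at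
the cost of `‖x 0 - ustar‖²/etaLow`. -/
theorem progress_le_potential_add (hsharp : IsSharp F μ ustar) (hstar : F ustar = 0)
    (h0 : 0 < η₀) (hm : paramM L * η₀ ^ 2 ≤ 1 / 3) (n : ℕ) :
    progress F L η₀ μ ustar x y n ≤
      potential F L η₀ x y n + ‖x 0 - ustar‖ ^ 2 / etaLow L η₀ := by
  have hlow := etaLow_pos h0 hm
  have hw := le_weight h0 hm n
  have h1 := hsharp (x n)
  rw [hstar, sub_zero] at h1
  have h2 : ⟪F (x n), x n - x 0⟫ = ⟪F (x n), x n - ustar⟫ - ⟪F (x n), x 0 - ustar⟫ := by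
    rw [← inner_sub_right]; congr 1; abel
  have h3 : ⟪F (x n), x 0 - ustar⟫ ≤ ‖F (x n)‖ * ‖x 0 - ustar‖ := real_inner_le_norm _ _
  set g := ‖F (x n)‖
  set D := ‖x 0 - ustar‖
  have hn : (0 : ℝ) ≤ n := Nat.cast_nonneg n
  have h4 : ((n : ℝ) + 1) * (g * D) ≤ weight L η₀ n / 2 * g ^ 2 + D ^ 2 / etaLow L η₀ := by
    have h5 : ((n : ℝ) + 1) ^ 2 * etaLow L η₀ / 2 ≤ weight L η₀ n := by
      refine le_trans ?_ hw
      nlinarith [mul_pos hlow (by positivity : (0 : ℝ) < n + 1)]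
    have h6 : ((n : ℝ) + 1) * (g * D) ≤
        ((n : ℝ) + 1) ^ 2 * etaLow L η₀ / 2 / 2 * g ^ 2 + D ^ 2 / etaLow L η₀ := by
      have : ((n : ℝ) + 1) ^ 2 * etaLow L η₀ / 2 / 2 * g ^ 2 + D ^ 2 / etaLow L η₀ -
          ((n : ℝ) + 1) * (g * D) =
          (((n : ℝ) + 1) * etaLow L η₀ * g / 2 - D) ^ 2 / etaLow L η₀ := by
        field_simp
        ring
      have h7 : 0 ≤ (((n : ℝ) + 1) * etaLow L η₀ * g / 2 - D) ^ 2 / etaLow L η₀ := by positivity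
      linarith
    refine h6.trans ?_
    gcongr
  have h8 : ((n : ℝ) + 1) * (μ * ‖x n - ustar‖ ^ 2) - ((n : ℝ) + 1) * (g * D) ≤
      ((n : ℝ) + 1) * ⟪F (x n), x n - x 0⟫ := by
    rw [h2, ← mul_sub]
    gcongr
  unfold progress potential
  linarith

theorem IsTrajectory.potential_zero_le (h : IsTrajectory L η₀ x y f)
    (hlip : ∀ u v, ‖F u - F v‖ ≤ L * ‖u - v‖) (hstar : F ustar = 0) (h0 : 0 < η₀) :
    potential F L η₀ x y 0 ≤ η₀ * L ^ 2 * ‖x 0 - ustar‖ ^ 2 := by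
  have h1 := hlip (x 0) ustar
  rw [hstar, sub_zero] at h1
  have h2 : ‖F (x 0)‖ ^ 2 ≤ (L * ‖x 0 - ustar‖) ^ 2 := by gcongr
  simp only [potential, weight, stepSize, h.y_zero, sub_self, norm_zero, inner_zero_right]
  norm_num
  nlinarith

/-- The contribution of the initial distance to the bound on `progress`. -/
noncomputable def initialTerm (L η₀ D : ℝ) : ℝ :=
  (1 + L ^ 2 * η₀ * etaLow L η₀) * D ^ 2 / etaLow L η₀

theorem initialTerm_nonneg (h0 : 0 < η₀) (hm : paramM L * η₀ ^ 2 ≤ 1 / 3) (D : ℝ) :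
    0 ≤ initialTerm L η₀ D := by
  have := etaLow_pos h0 hm
  unfold initialTerm
  positivity

/-- The remaining mixed term `s‖F(x (n+1))‖‖e‖` is split by Young's inequality with parameter of
order `K`: a share `1/(4K)` of `progress` per step stays summable over `K` steps, and the price is
the `8K‖e‖²` in `noiseTerm`. The key relation is `s² ≤ 4a'η₀`. -/
theorem IsTrajectory.potential_succ_le_noise (h : IsTrajectory L η₀ x y f) (hF : IsMonotoneOp F)
    (hlip : ∀ u v, ‖F u - F v‖ ≤ L * ‖u - v‖) (hL : 0 < L) (h0 : 0 < η₀) (hμ : 0 < μ)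
    (hm : paramM L * η₀ ^ 2 ≤ 1 / 3) {K : ℕ} (hK : 0 < K) (n : ℕ) :
    potential F L η₀ x y (n + 1) ≤ potential F L η₀ x y n +
      (noiseTerm η₀ K (fun j => f j - F (y j)) n +
        1 / (4 * K) * progress F L η₀ μ ustar x y (n + 1)) := by
  have hstep := h.potential_succ_le hF hlip hL h0 hm n
  have hK' : (0 : ℝ) < K := by exact_mod_cast hK
  have hw := weight_le h0 hm n
  have hw' := weight_pos h0 hm (n + 1)
  have hηlow := half_le_etaLow h0 hm
  have hη' := etaLow_le_stepSize h0 hm (n + 1)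
  have hη0 := (stepSize_bounds h0 hm n).2
  have hηpos : 0 < stepSize L η₀ n := (etaLow_pos h0 hm).trans_le (etaLow_le_stepSize h0 hm n)
  have hn : (0 : ℝ) ≤ n := Nat.cast_nonneg n
  set e' := ‖f n - F (y n)‖
  set e := ‖f (n + 1) - F (y (n + 1))‖
  set g := ‖F (x (n + 1))‖
  set s := stepSize L η₀ n * ((n : ℝ) + 2)
  set a' := weight L η₀ (n + 1) with ha'
  have hs : s ^ 2 ≤ 4 * a' * η₀ := by
    have h1 : s ≤ η₀ * ((n : ℝ) + 2) := mul_le_mul_of_nonneg_right hη0 (by positivity)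
    have h2 : ((n : ℝ) + 2) * (n + 2) * η₀ / 4 ≤ a' := by
      rw [ha', weight]
      push_cast
      have : ((n : ℝ) + 2) * (n + 2) * η₀ / 4 = (n + 2) * (n + 2) * (η₀ / 2) / 2 := by ring
      rw [this]
      have : η₀ / 2 ≤ stepSize L η₀ (n + 1) := hηlow.trans hη'
      have h3 : ((n : ℝ) + 2) * (n + 2) ≤ ((n : ℝ) + 1 + 1) * (n + 1 + 2) := by nlinarith
      gcongr
    have h3 : s ^ 2 ≤ (η₀ * ((n : ℝ) + 2)) ^ 2 := by gcongr
    have h4 := mul_le_mul_of_nonneg_left h2 h0.le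
    nlinarith
  have hyoung : s * g * e ≤ 1 / (4 * K) * (a' / 2 * g ^ 2) + 8 * K * η₀ * e ^ 2 := by
    have h1 : 1 / (4 * K) * (a' / 2 * g ^ 2) + 8 * K * η₀ * e ^ 2 - s * g * e =
        1 / (8 * K * a') *
          ((a' * g - 4 * K * s * e) ^ 2 + 16 * K ^ 2 * (4 * a' * η₀ - s ^ 2) * e ^ 2) := by
      field_simp
      ring
    have h2 : 0 ≤ 4 * a' * η₀ - s ^ 2 := by linarith
    have h3 : 0 ≤ 1 / (8 * K * a') *
        ((a' * g - 4 * K * s * e) ^ 2 + 16 * K ^ 2 * (4 * a' * η₀ - s ^ 2) * e ^ 2) := by positivity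
    linarith
  have hT : 1 / (4 * K) * (a' / 2 * g ^ 2) ≤ 1 / (4 * K) * progress F L η₀ μ ustar x y (n + 1) := by
    have h1 : 0 ≤ (((n + 1 : ℕ) : ℝ) + 1) * μ * ‖x (n + 1) - ustar‖ ^ 2 := by positivity
    have h2 : 0 ≤ 2 / 3 * weight L η₀ (n + 1) * ‖F (x (n + 1)) - F (y (n + 1))‖ ^ 2 := by positivity
    gcongr
    unfold progress
    linarith
  have n1 := mul_le_mul_of_nonneg_right hw (by positivity : 0 ≤ 16 / 3 * e ^ 2)
  have n2 := mul_le_mul_of_nonneg_right hw (by positivity : 0 ≤ 4 / 3 * e' ^ 2)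
  unfold noiseTerm
  linarith

/-- A discrete Gronwall inequality: the coefficients add up to at most `1/4`, whence the factor
`1/(1 - 1/4) = 4/3`. The sum includes `T n` itself, which is moved to the left. -/
theorem le_of_le_add_sum {T : ℕ → ℝ} {B : ℝ} {K : ℕ} (hK : 0 < K) (hB : 0 ≤ B)
    (h : ∀ n ≤ K, T n ≤ B + ∑ j ∈ Finset.range n, 1 / (4 * (K : ℝ)) * T (j + 1)) :
    ∀ n ≤ K, T n ≤ 4 / 3 * B := by
  have hK' : (0 : ℝ) < K := by exact_mod_cast hK
  have hθK : 1 / (4 * (K : ℝ)) * K = 1 / 4 := by field_simp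
  have hθ : 0 < 1 / (4 * (K : ℝ)) := by positivity
  set θ := 1 / (4 * (K : ℝ))
  intro n
  induction n using Nat.strong_induction_on with
  | _ n ih =>
    intro hn
    rcases n with _ | n
    · have := h 0 hn
      simp at this
      linarith
    · have h1 := h (n + 1) hn
      rw [Finset.sum_range_succ] at h1
      have h2 : ∑ j ∈ Finset.range n, θ * T (j + 1) ≤ ∑ j ∈ Finset.range n, θ * (4 / 3 * B) := by
        apply Finset.sum_le_sum
        intro j hj
        have hj := Finset.mem_range.1 hj
        have := ih (j + 1) (by omega) (by omega)
        gcongr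
      rw [Finset.sum_const, Finset.card_range, nsmul_eq_mul] at h2
      have h3 : θ * ((n : ℝ) + 1) ≤ 1 / 4 := by
        rw [← hθK]
        have : ((n + 1 : ℕ) : ℝ) ≤ K := by exact_mod_cast hn
        push_cast at this
        gcongr
      have h4 : θ * ((n : ℝ) + 1) * B ≤ 1 / 4 * B := by gcongr
      have h5 : (1 - θ) * T (n + 1) ≤ (1 - θ) * (4 / 3 * B) := by nlinarith
      have hθ1 : θ < 1 := by
        have : (0 : ℝ) ≤ n := Nat.cast_nonneg n
        nlinarith
      exact le_of_mul_le_mul_left h5 (by linarith)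

theorem IsTrajectory.progress_le (h : IsTrajectory L η₀ x y f) (hF : IsMonotoneOp F)
    (hlip : ∀ u v, ‖F u - F v‖ ≤ L * ‖u - v‖) (hsharp : IsSharp F μ ustar) (hstar : F ustar = 0)
    (hL : 0 < L) (h0 : 0 < η₀) (hμ : 0 < μ) (hm : paramM L * η₀ ^ 2 ≤ 1 / 3) {K : ℕ} (hK : 0 < K)
    {n : ℕ} (hn : n ≤ K) :
    progress F L η₀ μ ustar x y n ≤
      4 / 3 * (initialTerm L η₀ ‖x 0 - ustar‖ + noise η₀ K (fun j => f j - F (y j))) := by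
  have hB : 0 ≤ initialTerm L η₀ ‖x 0 - ustar‖ + noise η₀ K (fun j => f j - F (y j)) :=
    add_nonneg (initialTerm_nonneg h0 hm _) (noise_nonneg h0 _ _)
  refine le_of_le_add_sum hK hB (fun n hn => ?_) n hn
  have hV : ∀ n, potential F L η₀ x y n ≤ potential F L η₀ x y 0 +
      ∑ j ∈ Finset.range n, (noiseTerm η₀ K (fun j => f j - F (y j)) j +
        1 / (4 * (K : ℝ)) * progress F L η₀ μ ustar x y (j + 1)) := by
    intro n
    induction n with
    | zero => simp
    | succ n ih =>
      rw [Finset.sum_range_succ]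
      have := h.potential_succ_le_noise (ustar := ustar) hF hlip hL h0 hμ hm hK n
      linarith
  have h1 := hV n
  rw [Finset.sum_add_distrib] at h1
  have h2 : ∑ j ∈ Finset.range n, noiseTerm η₀ K (fun j => f j - F (y j)) j ≤
      noise η₀ K (fun j => f j - F (y j)) := by
    apply Finset.sum_le_sum_of_subset_of_nonneg
    · exact Finset.range_mono hn
    · intro i _ _
      exact noiseTerm_nonneg h0 _ _ _
  have h3 := progress_le_potential_add (x := x) (y := y) hsharp hstar h0 hm n
  have h4 := h.potential_zero_le hlip hstar h0
  have h5 : initialTerm L η₀ ‖x 0 - ustar‖ =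
      η₀ * L ^ 2 * ‖x 0 - ustar‖ ^ 2 + ‖x 0 - ustar‖ ^ 2 / etaLow L η₀ := by
    have := etaLow_pos h0 hm
    unfold initialTerm
    field_simp
    ring
  linarith

end Trajectory

/-- One summand of `noise` suffices: the error of index `n + 1` appears as the new error in summand
`n`, and the error of index `0` as the old error in summand `0`. -/
theorem sq_mul_norm_sq_le_noise {E : Type*} [NormedAddCommGroup E] {η₀ : ℝ} (h0 : 0 < η₀) {K : ℕ}
    (hK : 0 < K) (g : ℕ → E) {n : ℕ} (hn : n ≤ K) :
    ((n : ℝ) + 1) ^ 2 * η₀ * ‖g n‖ ^ 2 ≤ noise η₀ K g := by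
  have hle : ∀ j < K, noiseTerm η₀ K g j ≤ noise η₀ K g := fun j hj =>
    Finset.single_le_sum (f := fun j => noiseTerm η₀ K g j)
      (fun i _ => noiseTerm_nonneg h0 K g i) (Finset.mem_range.2 hj)
  rcases n with _ | n
  · refine le_trans ?_ (hle 0 hK)
    unfold noiseTerm
    have : 0 ≤ η₀ * ((8 / 3 * (((0 : ℕ) : ℝ) + 1) * ((0 : ℕ) + 2) + 8 * K) * ‖g (0 + 1)‖ ^ 2) := by
      positivity
    have h2 : 0 ≤ η₀ * ‖g 0‖ ^ 2 := by positivity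
    push_cast at this ⊢
    linarith
  · refine le_trans ?_ (hle n hn)
    unfold noiseTerm
    have h1 : 0 ≤ η₀ * (2 / 3 * ((n : ℝ) + 1) * (n + 2) * ‖g n‖ ^ 2) := by positivity
    have h2 : 0 ≤ η₀ * ‖g (n + 1)‖ ^ 2 := by positivity
    have h3 : 0 ≤ (8 / 3 * ((n : ℝ) + 1) * (n + 2) + 8 * K) - ((n : ℝ) + 2) ^ 2 := by
      have : (0 : ℝ) ≤ n := Nat.cast_nonneg n
      have : (0 : ℝ) ≤ K := Nat.cast_nonneg K
      nlinarith
    have h4 := mul_nonneg h2 h3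
    push_cast
    linarith

/-! ### Contraction of one call and decay of the displacements -/

section Trajectory

variable {E : Type*} [NormedAddCommGroup E] [InnerProductSpace ℝ E]
  {F : E → E} {L η₀ μ : ℝ} {ustar : E} {x y f : ℕ → E}

theorem mul_norm_le_of_isSharp (hsharp : IsSharp F μ ustar) (hstar : F ustar = 0) (u : E) :
    μ * ‖u - ustar‖ ≤ ‖F u‖ := by
  rcases eq_or_ne u ustar with rfl | hu
  · simp
  have hpos : 0 < ‖u - ustar‖ := norm_pos_iff.2 (sub_ne_zero.2 hu)
  have h1 := hsharp u
  rw [hstar, sub_zero] at h1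
  have h2 : ⟪F u, u - ustar⟫ ≤ ‖F u‖ * ‖u - ustar‖ := real_inner_le_norm _ _
  refine le_of_mul_le_mul_right ?_ hpos
  nlinarith

theorem sq_mul_le_progress (hsharp : IsSharp F μ ustar) (hstar : F ustar = 0) (hμ : 0 < μ)
    (h0 : 0 < η₀) (hm : paramM L * η₀ ^ 2 ≤ 1 / 3) (n : ℕ) :
    (etaLow L η₀ * n ^ 2 * μ ^ 2 / 4 + n * μ) * ‖x n - ustar‖ ^ 2 ≤
      progress F L η₀ μ ustar x y n := by
  have hlow := etaLow_pos h0 hm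
  have hw := le_weight h0 hm n
  have hw0 := weight_pos h0 hm n
  have hn : (0 : ℝ) ≤ n := Nat.cast_nonneg n
  have h1 : (μ * ‖x n - ustar‖) ^ 2 ≤ ‖F (x n)‖ ^ 2 := by
    have := mul_norm_le_of_isSharp hsharp hstar (x n)
    gcongr
  have h2 : (n : ℝ) ^ 2 * etaLow L η₀ / 2 ≤ weight L η₀ n := by
    refine le_trans ?_ hw
    have : (n : ℝ) ^ 2 ≤ (n + 1) * (n + 2) := by nlinarith
    gcongr
  have h3 : (n : ℝ) ^ 2 * etaLow L η₀ / 2 / 2 * (μ * ‖x n - ustar‖) ^ 2 ≤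
      weight L η₀ n / 2 * ‖F (x n)‖ ^ 2 := by gcongr
  have h4 : 0 ≤ 2 / 3 * weight L η₀ n * ‖F (x n) - F (y n)‖ ^ 2 := by positivity
  have h5 : 0 ≤ μ * ‖x n - ustar‖ ^ 2 := by positivity
  unfold progress
  linarith

theorem mul_etaLow_le (hm : paramM L * η₀ ^ 2 ≤ 1 / 3) : L ^ 2 * η₀ * etaLow L η₀ ≤ 1 / 45 := by
  have := paramM_mul_etaLow_mul_le hm
  unfold paramM at this
  linarith

theorem four_le_callLength_mul (h0 : 0 < η₀) (hμ : 0 < μ) (hm : paramM L * η₀ ^ 2 ≤ 1 / 3) :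
    4 * √(L ^ 2 * η₀ * etaLow L η₀ + 1) ≤ callLength L μ η₀ * (μ * etaLow L η₀) := by
  have hlow := etaLow_pos h0 hm
  have := Nat.le_ceil (4 * √(L ^ 2 * η₀ * etaLow L η₀ + 1) / (μ * etaLow L η₀))
  rwa [div_le_iff₀ (by positivity)] at this

theorem callLength_pos (h0 : 0 < η₀) (hμ : 0 < μ) (hm : paramM L * η₀ ^ 2 ≤ 1 / 3) :
    0 < callLength L μ η₀ := by
  have hlow := etaLow_pos h0 hm
  exact Nat.ceil_pos.2 (by positivity)

/-- Compare the lower bound `sq_mul_le_progress` with the upper bound `IsTrajectory.progress_le`.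
With `q = √(L²η₀ etaLow + 1)`, the length `K` is chosen so that `Kμ·etaLow ≥ 4q`. The term quadratic
in `K` alone would give a contraction by `1/3`; the term `Kμ` improves it to `1/4`. -/
theorem IsTrajectory.norm_sub_sq_le (h : IsTrajectory L η₀ x y f) (hF : IsMonotoneOp F)
    (hlip : ∀ u v, ‖F u - F v‖ ≤ L * ‖u - v‖) (hsharp : IsSharp F μ ustar) (hstar : F ustar = 0)
    (hL : 0 < L) (h0 : 0 < η₀) (hμ : 0 < μ) (hm : paramM L * η₀ ^ 2 ≤ 1 / 3) {K : ℕ}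
    (hK : K = callLength L μ η₀) :
    ‖x K - ustar‖ ^ 2 ≤ ‖x 0 - ustar‖ ^ 2 / 4 +
      16 / (3 * (etaLow L η₀ * K ^ 2 * μ ^ 2)) * noise η₀ K (fun j => f j - F (y j)) := by
  have hKpos : 0 < K := hK ▸ callLength_pos h0 hμ hm
  have hlow := etaLow_pos h0 hm
  have hprog := h.progress_le hF hlip hsharp hstar hL h0 hμ hm hKpos le_rfl
  have hsq := (sq_mul_le_progress (x := x) (y := y) hsharp hstar hμ h0 hm K).trans hprog
  have hN := noise_nonneg h0 K (fun j => f j - F (y j))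
  set N := noise η₀ K (fun j => f j - F (y j))
  set X := ‖x K - ustar‖ ^ 2
  set D := ‖x 0 - ustar‖
  have h4 := four_le_callLength_mul h0 hμ hm
  rw [← hK] at h4
  have hqle := mul_etaLow_le hm
  have hqs : √(L ^ 2 * η₀ * etaLow L η₀ + 1) ^ 2 = L ^ 2 * η₀ * etaLow L η₀ + 1 :=
    Real.sq_sqrt (by positivity)
  have hq0 : 0 < √(L ^ 2 * η₀ * etaLow L η₀ + 1) := by positivity
  unfold initialTerm at hsq
  rw [add_comm 1, ← hqs] at hsq
  have hq3 : √(L ^ 2 * η₀ * etaLow L η₀ + 1) ≤ 3 := by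
    rw [Real.sqrt_le_left (by norm_num)]; linarith
  set q := √(L ^ 2 * η₀ * etaLow L η₀ + 1)
  set l := etaLow L η₀
  have hK' : (0 : ℝ) < K := by exact_mod_cast hKpos
  have hP : 4 * q ^ 2 / l ≤ l * K ^ 2 * μ ^ 2 / 4 := by
    rw [div_le_iff₀ hlow]
    have : (4 * q) ^ 2 ≤ (K * (μ * l)) ^ 2 := by gcongr
    linarith
  have hQ : 4 * q / l ≤ K * μ := by
    rw [div_le_iff₀ hlow]; linarith
  -- This amounts to `(4/3)q² ≤ q² + q`, that is `q ≤ 3`.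
  have hR : 4 / 3 * (q ^ 2 * D ^ 2 / l) ≤ (l * K ^ 2 * μ ^ 2 / 4 + K * μ) * (D ^ 2 / 4) := by
    have h1 : 4 / 3 * (q ^ 2 * D ^ 2 / l) ≤ (4 * q ^ 2 / l + 4 * q / l) * (D ^ 2 / 4) := by
      have : (4 * q ^ 2 / l + 4 * q / l) * (D ^ 2 / 4) - 4 / 3 * (q ^ 2 * D ^ 2 / l) =
          q * (3 - q) / 3 * D ^ 2 / l := by
        field_simp
        ring
      have h3 : 0 ≤ q * (3 - q) / 3 * D ^ 2 / l := by
        have : 0 ≤ 3 - q := by linarith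
        positivity
      linarith
    refine h1.trans ?_
    gcongr
  have hS : 4 / 3 * N ≤ (l * K ^ 2 * μ ^ 2 / 4 + K * μ) * (16 / (3 * (l * K ^ 2 * μ ^ 2)) * N) := by
    have : 4 / 3 * N = (l * K ^ 2 * μ ^ 2 / 4) * (16 / (3 * (l * K ^ 2 * μ ^ 2)) * N) := by
      field_simp
      ring
    rw [this]
    gcongr
    have : 0 < K * μ := by positivity
    linarith
  have hpos : 0 < l * K ^ 2 * μ ^ 2 / 4 + K * μ := by positivity
  refine le_of_mul_le_mul_left ?_ hpos
  linarith

/-- The estimates decay like `1/n`: `progress` controls `‖F (x n)‖` and `‖F (x n) - F (y n)‖` with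
weight of order `n²`, and `noise` controls the error with the same weight. -/
theorem IsTrajectory.mul_norm_est_le (h : IsTrajectory L η₀ x y f) (hF : IsMonotoneOp F)
    (hlip : ∀ u v, ‖F u - F v‖ ≤ L * ‖u - v‖) (hsharp : IsSharp F μ ustar) (hstar : F ustar = 0)
    (hL : 0 < L) (h0 : 0 < η₀) (hμ : 0 < μ) (hm : paramM L * η₀ ^ 2 ≤ 1 / 3) {K : ℕ}
    (hK : 0 < K) {n : ℕ} (hn : n ≤ K) :
    ((n : ℝ) + 1) * η₀ * ‖f n‖ ≤ √(60 * η₀ * (initialTerm L η₀ ‖x 0 - ustar‖ +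
      noise η₀ K (fun j => f j - F (y j)))) := by
  have hprog := h.progress_le hF hlip hsharp hstar hL h0 hμ hm hK hn
  have hN := sq_mul_norm_sq_le_noise h0 hK (fun j => f j - F (y j)) hn
  have hR := initialTerm_nonneg h0 hm ‖x 0 - ustar‖
  set N := noise η₀ K (fun j => f j - F (y j))
  set R := initialTerm L η₀ ‖x 0 - ustar‖
  have hw : ((n : ℝ) + 1) ^ 2 * η₀ / 4 ≤ weight L η₀ n := by
    refine le_trans ?_ (le_weight h0 hm n)
    have h1 := half_le_etaLow h0 hm
    have h2 : ((n : ℝ) + 1) ^ 2 ≤ (n + 1) * (n + 2) := by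
      have : (0 : ℝ) ≤ n := Nat.cast_nonneg n
      nlinarith
    calc ((n : ℝ) + 1) ^ 2 * η₀ / 4 = ((n : ℝ) + 1) ^ 2 * (η₀ / 2) / 2 := by ring
      _ ≤ _ := by gcongr
  have hw0 := weight_pos h0 hm n
  have h1 : ‖f n‖ ^ 2 ≤ 3 * ‖F (x n)‖ ^ 2 + 3 * ‖F (x n) - F (y n)‖ ^ 2 +
      3 * ‖f n - F (y n)‖ ^ 2 := by
    have h2 : ‖f n‖ ≤ ‖F (x n)‖ + ‖F (x n) - F (y n)‖ + ‖f n - F (y n)‖ := by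
      calc ‖f n‖ = ‖F (x n) - (F (x n) - F (y n)) + (f n - F (y n))‖ := by congr 1; abel
        _ ≤ ‖F (x n) - (F (x n) - F (y n))‖ + ‖f n - F (y n)‖ := norm_add_le _ _
        _ ≤ _ := by gcongr; exact norm_sub_le _ _
    calc ‖f n‖ ^ 2 ≤ (‖F (x n)‖ + ‖F (x n) - F (y n)‖ + ‖f n - F (y n)‖) ^ 2 := by gcongr
      _ ≤ _ := by
        nlinarith [sq_nonneg (‖F (x n)‖ - ‖F (x n) - F (y n)‖),
          sq_nonneg (‖F (x n)‖ - ‖f n - F (y n)‖),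
          sq_nonneg (‖F (x n) - F (y n)‖ - ‖f n - F (y n)‖)]
  have h2 : ((n : ℝ) + 1) ^ 2 * η₀ * ‖f n‖ ^ 2 ≤ 60 * (R + N) := by
    have a1 := mul_le_mul_of_nonneg_left h1 (by positivity : 0 ≤ ((n : ℝ) + 1) ^ 2 * η₀)
    have a2 := mul_le_mul_of_nonneg_right hw (by positivity : 0 ≤ ‖F (x n)‖ ^ 2)
    have a3 := mul_le_mul_of_nonneg_right hw (by positivity : 0 ≤ ‖F (x n) - F (y n)‖ ^ 2)
    have a4 : 0 ≤ ((n : ℝ) + 1) * μ * ‖x n - ustar‖ ^ 2 := by positivity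
    have a5 : 0 ≤ weight L η₀ n * ‖F (x n)‖ ^ 2 := by positivity
    have a6 : 0 ≤ weight L η₀ n * ‖F (x n) - F (y n)‖ ^ 2 := by positivity
    have a7 : 0 ≤ N := noise_nonneg h0 _ _
    unfold progress at hprog
    linarith
  apply Real.le_sqrt_of_sq_le
  calc (((n : ℝ) + 1) * η₀ * ‖f n‖) ^ 2 = η₀ * (((n : ℝ) + 1) ^ 2 * η₀ * ‖f n‖ ^ 2) := by ring
    _ ≤ η₀ * (60 * (R + N)) := by gcongr
    _ = _ := by ring

/-- Since `(n+2)(x (n+1) - ustar)` is `(n+1)(x n - ustar)` plus `x 0 - ustar` minus a vector of norm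
at most `Γ`, the quantity `(n+1)‖x n - ustar‖` increases by at most `‖x 0 - ustar‖ + Γ` per step. -/
theorem IsTrajectory.norm_sub_le_add (h : IsTrajectory L η₀ x y f) (h0 : 0 < η₀)
    (hm : paramM L * η₀ ^ 2 ≤ 1 / 3) {K : ℕ} {Γ : ℝ} (hΓ : 0 ≤ Γ)
    (hf : ∀ n ≤ K, ((n : ℝ) + 1) * η₀ * ‖f n‖ ≤ Γ) {n : ℕ} (hn : n ≤ K) :
    ‖x n - ustar‖ ≤ ‖x 0 - ustar‖ + Γ := by
  induction n with
  | zero => linarith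
  | succ n ih =>
    have ih := ih (by omega)
    have e : ((n : ℝ) + 2) • (x (n + 1) - ustar) = (x 0 - ustar) +
        ((n : ℝ) + 1) • (x n - ustar) - (((n : ℝ) + 2) * stepSize L η₀ n) • f (n + 1) := by
      rw [h.x_succ n]
      match_scalars <;> field_simp; ring
    have hpos : 0 < stepSize L η₀ n := (etaLow_pos h0 hm).trans_le (etaLow_le_stepSize h0 hm n)
    have h1 : ((n : ℝ) + 2) * ‖x (n + 1) - ustar‖ ≤ ‖x 0 - ustar‖ +
        ((n : ℝ) + 1) * ‖x n - ustar‖ + ((n : ℝ) + 2) * stepSize L η₀ n * ‖f (n + 1)‖ := by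
      have := congrArg norm e
      rw [norm_smul, Real.norm_of_nonneg (by positivity)] at this
      rw [this]
      refine (norm_sub_le _ _).trans ?_
      rw [norm_smul, Real.norm_of_nonneg (by positivity)]
      gcongr
      refine (norm_add_le _ _).trans ?_
      rw [norm_smul, Real.norm_of_nonneg (by positivity)]
    have h2 := hf (n + 1) hn
    rw [show ((n + 1 : ℕ) : ℝ) + 1 = n + 2 by push_cast; ring] at h2
    have h3 : ((n : ℝ) + 2) * stepSize L η₀ n * ‖f (n + 1)‖ ≤ Γ := by
      refine le_trans ?_ h2
      have := (stepSize_bounds h0 hm n).2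
      gcongr
    refine le_of_mul_le_mul_left ?_ (by positivity : (0 : ℝ) < n + 2)
    have h4 : ((n : ℝ) + 1) * ‖x n - ustar‖ ≤ ((n : ℝ) + 1) * (‖x 0 - ustar‖ + Γ) := by gcongr
    linarith

/-- Consecutive extrapolated points differ by an anchor pull of size `1/(n+3)` and by multiples of
estimates, all of order `1/n`. This decay keeps the correction batches bounded. -/
theorem IsTrajectory.mul_norm_displacement_le (h : IsTrajectory L η₀ x y f) (h0 : 0 < η₀)
    (hm : paramM L * η₀ ^ 2 ≤ 1 / 3) {K : ℕ} {Γ : ℝ} (hΓ : 0 ≤ Γ)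
    (hf : ∀ n ≤ K, ((n : ℝ) + 1) * η₀ * ‖f n‖ ≤ Γ) {n : ℕ} (hn : n ≤ K) :
    ((n : ℝ) + 1) * ‖y (n + 1) - y n‖ ≤ 2 * ‖x 0 - ustar‖ + 5 * Γ := by
  have hpos : ∀ n, 0 < stepSize L η₀ n := fun n =>
    (etaLow_pos h0 hm).trans_le (etaLow_le_stepSize h0 hm n)
  have hle : ∀ n, stepSize L η₀ n ≤ η₀ := fun n => (stepSize_bounds h0 hm n).2
  rcases n with _ | n
  · have e : y (0 + 1) - y 0 = -(stepSize L η₀ 0 • f 0) := by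
      rw [h.y_succ 0, h.y_zero]
      match_scalars <;> norm_num
    rw [e, norm_neg, norm_smul, Real.norm_of_nonneg (hpos 0).le]
    have h1 := hf 0 (by omega)
    have h2 : 0 ≤ ‖x 0 - ustar‖ := norm_nonneg _
    have h3 : stepSize L η₀ 0 * ‖f 0‖ ≤ η₀ * ‖f 0‖ := by
      gcongr
      exact hle 0
    push_cast at h1 ⊢
    linarith
  · have hx := h.norm_sub_le_add (ustar := ustar) h0 hm hΓ hf hn
    have e : y (n + 1 + 1) - y (n + 1) = (1 / ((n : ℝ) + 3)) • (x 0 - x (n + 1)) -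
        stepSize L η₀ (n + 1) • f (n + 1) - stepSize L η₀ n • (f (n + 1) - f n) := by
      have h1 := h.x_sub_y n
      have h2 : y (n + 1) = x (n + 1) + stepSize L η₀ n • (f (n + 1) - f n) := by
        rw [← sub_sub_cancel (x (n + 1)) (y (n + 1)), h1, neg_smul, sub_neg_eq_add]
      rw [h.y_succ (n + 1), h2]
      push_cast
      match_scalars <;> field_simp <;> ring
    have h1 := hf (n + 1) hn
    have h2 := hf n (by omega)
    have h3 : ‖x 0 - x (n + 1)‖ ≤ 2 * ‖x 0 - ustar‖ + Γ := by
      calc ‖x 0 - x (n + 1)‖ = ‖(x 0 - ustar) - (x (n + 1) - ustar)‖ := by congr 1; abel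
        _ ≤ ‖x 0 - ustar‖ + ‖x (n + 1) - ustar‖ := norm_sub_le _ _
        _ ≤ _ := by linarith
    have h4 : ‖y (n + 1 + 1) - y (n + 1)‖ ≤ (1 / ((n : ℝ) + 3)) * ‖x 0 - x (n + 1)‖ +
        η₀ * ‖f (n + 1)‖ + η₀ * (‖f (n + 1)‖ + ‖f n‖) := by
      rw [e]
      refine (norm_sub_le _ _).trans (add_le_add ((norm_sub_le _ _).trans (add_le_add ?_ ?_)) ?_)
      · rw [norm_smul, Real.norm_of_nonneg (by positivity)]
      · rw [norm_smul, Real.norm_of_nonneg (hpos _).le]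
        gcongr
        exact hle _
      · rw [norm_smul, Real.norm_of_nonneg (hpos _).le]
        gcongr
        · exact hle _
        · exact norm_sub_le _ _
    push_cast at h1 ⊢
    have hn0 : (0 : ℝ) ≤ n := Nat.cast_nonneg n
    have h5 : ((n : ℝ) + 2) * ((1 / ((n : ℝ) + 3)) * ‖x 0 - x (n + 1)‖) ≤
        2 * ‖x 0 - ustar‖ + Γ := by
      refine le_trans ?_ h3
      rw [← mul_assoc]
      apply mul_le_of_le_one_left (norm_nonneg _)
      rw [mul_one_div, div_le_one (by positivity)]
      linarith
    have h6 : ((n : ℝ) + 2) * (η₀ * ‖f n‖) ≤ 2 * Γ := by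
      have : 0 ≤ η₀ * ‖f n‖ := by positivity
      nlinarith
    have h7 := mul_le_mul_of_nonneg_left h4 (by positivity : (0 : ℝ) ≤ n + 2)
    linarith

theorem IsTrajectory.sq_displacement_le (h : IsTrajectory L η₀ x y f) (hF : IsMonotoneOp F)
    (hlip : ∀ u v, ‖F u - F v‖ ≤ L * ‖u - v‖) (hsharp : IsSharp F μ ustar) (hstar : F ustar = 0)
    (hL : 0 < L) (h0 : 0 < η₀) (hμ : 0 < μ) (hm : paramM L * η₀ ^ 2 ≤ 1 / 3) {K : ℕ}
    (hK : 0 < K) {n : ℕ} (hn : n ≤ K) :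
    ((n : ℝ) + 1) ^ 2 * ‖y (n + 1) - y n‖ ^ 2 ≤
      7000 * (‖x 0 - ustar‖ ^ 2 + η₀ * noise η₀ K (fun j => f j - F (y j))) := by
  have hf := fun n hn => h.mul_norm_est_le (n := n) hF hlip hsharp hstar hL h0 hμ hm hK hn
  have hd := h.mul_norm_displacement_le (ustar := ustar) h0 hm (Real.sqrt_nonneg _) hf hn
  have hN := noise_nonneg h0 K (fun j => f j - F (y j))
  have hR := initialTerm_nonneg h0 hm ‖x 0 - ustar‖
  have hs := Real.sq_sqrt (by positivity : 0 ≤ 60 * η₀ * (initialTerm L η₀ ‖x 0 - ustar‖ +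
      noise η₀ K (fun j => f j - F (y j))))
  set N := noise η₀ K (fun j => f j - F (y j))
  set D := ‖x 0 - ustar‖
  set Γ := √(60 * η₀ * (initialTerm L η₀ D + N))
  have hlow := etaLow_pos h0 hm
  -- With this bound the coefficient of `D²` below is `8 + 50·60·21/10 = 6308`, and that of `η₀ * N`
  -- is `3000`; `7000` covers both.
  have hI : η₀ * initialTerm L η₀ D ≤ 21 / 10 * D ^ 2 := by
    have h1 : η₀ / etaLow L η₀ ≤ 2 := by
      rw [div_le_iff₀ hlow]
      linarith [half_le_etaLow h0 hm]
    have h2 := mul_etaLow_le hm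
    calc η₀ * initialTerm L η₀ D =
        (1 + L ^ 2 * η₀ * etaLow L η₀) * (η₀ / etaLow L η₀) * D ^ 2 := by
          unfold initialTerm; ring
      _ ≤ (1 + 1 / 45) * 2 * D ^ 2 := by gcongr
      _ ≤ _ := by nlinarith [sq_nonneg D]
  calc ((n : ℝ) + 1) ^ 2 * ‖y (n + 1) - y n‖ ^ 2 = (((n : ℝ) + 1) * ‖y (n + 1) - y n‖) ^ 2 := by
        ring
    _ ≤ (2 * D + 5 * Γ) ^ 2 := by gcongr
    _ ≤ 8 * D ^ 2 + 50 * Γ ^ 2 := by nlinarith [sq_nonneg (2 * D - 5 * Γ)]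
    _ ≤ _ := by
      rw [hs]
      have : 0 ≤ η₀ * N := by positivity
      nlinarith [sq_nonneg D]

end Trajectory

/-! ### Bounded means -/

/-- `X` is integrable with mean at most `b`. -/
def MeanLE {Ω : Type*} [MeasurableSpace Ω] (P : Measure Ω) (X : Ω → ℝ) (b : ℝ) : Prop :=
  Integrable X P ∧ ∫ ω, X ω ∂P ≤ b

section MeanLE

variable {Ω : Type*} [MeasurableSpace Ω] {P : Measure Ω} {X Y : Ω → ℝ} {a b : ℝ}

theorem MeanLE.mono (h : MeanLE P X a) (hab : a ≤ b) : MeanLE P X b := ⟨h.1, h.2.trans hab⟩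

theorem MeanLE.add (hX : MeanLE P X a) (hY : MeanLE P Y b) :
    MeanLE P (fun ω => X ω + Y ω) (a + b) := by
  refine ⟨hX.1.add hY.1, ?_⟩
  rw [integral_add hX.1 hY.1]
  exact add_le_add hX.2 hY.2

theorem MeanLE.const_mul (hX : MeanLE P X a) {r : ℝ} (hr : 0 ≤ r) :
    MeanLE P (fun ω => r * X ω) (r * a) := by
  refine ⟨hX.1.const_mul r, ?_⟩
  rw [integral_const_mul]
  exact mul_le_mul_of_nonneg_left hX.2 hr

theorem meanLE_const [IsProbabilityMeasure P] (r : ℝ) : MeanLE P (fun _ => r) r :=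
  ⟨integrable_const r, by simp⟩

theorem MeanLE.sum {ι : Type*} {s : Finset ι} {X : ι → Ω → ℝ} {a : ι → ℝ}
    (h : ∀ i ∈ s, MeanLE P (X i) (a i)) :
    MeanLE P (fun ω => ∑ i ∈ s, X i ω) (∑ i ∈ s, a i) := by
  refine ⟨integrable_finsetSum s fun i hi => (h i hi).1, ?_⟩
  rw [integral_finsetSum s fun i hi => (h i hi).1]
  exact Finset.sum_le_sum fun i hi => (h i hi).2

theorem MeanLE.of_le (hY : MeanLE P Y b) (hX : AEStronglyMeasurable X P) (h0 : ∀ ω, 0 ≤ X ω)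
    (h : ∀ ω, X ω ≤ Y ω) : MeanLE P X b := by
  have hint : Integrable X P := hY.1.mono' hX (Filter.Eventually.of_forall fun ω => by
    rw [Real.norm_of_nonneg (h0 ω)]; exact h ω)
  exact ⟨hint, (integral_mono hint hY.1 h).trans hY.2⟩

/-- For nonnegative variables integrability is part of the bound, so that conditioning arguments can
use Tonelli's theorem with no prior integrability. -/
theorem meanLE_of_lintegral_le (hX : AEStronglyMeasurable X P) (h0 : ∀ ω, 0 ≤ X ω) (hb : 0 ≤ b)
    (h : ∫⁻ ω, ENNReal.ofReal (X ω) ∂P ≤ ENNReal.ofReal b) : MeanLE P X b := by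
  refine ⟨⟨hX, (hasFiniteIntegral_iff_ofReal (Filter.Eventually.of_forall h0)).2
    (h.trans_lt ENNReal.ofReal_lt_top)⟩, ?_⟩
  rw [integral_eq_lintegral_of_nonneg_ae (Filter.Eventually.of_forall h0) hX]
  exact ENNReal.toReal_le_of_le_ofReal hb h

theorem MeanLE.lintegral_le (h : MeanLE P X b) (h0 : ∀ ω, 0 ≤ X ω) :
    ∫⁻ ω, ENNReal.ofReal (X ω) ∂P ≤ ENNReal.ofReal b := by
  rw [← ofReal_integral_eq_lintegral_ofReal h.1 (Filter.Eventually.of_forall h0)]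
  exact ENNReal.ofReal_le_ofReal h.2

theorem MeanLE.nonneg (h : MeanLE P X b) (h0 : ∀ ω, 0 ≤ X ω) : 0 ≤ b :=
  (integral_nonneg h0).trans h.2

theorem MeanLE.comp_map {A : Type*} [MeasurableSpace A] {S : Ω → A} {φ : A → ℝ} (hS : Measurable S)
    (h : MeanLE (P.map S) φ b) : MeanLE P (fun ω => φ (S ω)) b := by
  refine ⟨h.1.comp_measurable hS, ?_⟩
  rw [← integral_map hS.aemeasurable h.1.aestronglyMeasurable]
  exact h.2

/-- Integrating out a random variable `S` that is independent of `V`. -/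
theorem MeanLE.of_indepFun [IsProbabilityMeasure P] {A B : Type*} [MeasurableSpace A]
    [MeasurableSpace B] {V : Ω → A} {S : Ω → B} {φ : A × B → ℝ} {ψ : A → ℝ} (hV : Measurable V)
    (hS : Measurable S) (hind : IndepFun V S P) (hφ : Measurable φ) (hφ0 : ∀ q, 0 ≤ φ q)
    (hψ0 : ∀ a, 0 ≤ ψ a) (h : ∀ a, MeanLE (P.map S) (fun s => φ (a, s)) (ψ a))
    (hψ : MeanLE P (fun ω => ψ (V ω)) b) : MeanLE P (fun ω => φ (V ω, S ω)) b := by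
  have : IsProbabilityMeasure (P.map S) := Measure.isProbabilityMeasure_map hS.aemeasurable
  refine meanLE_of_lintegral_le (hφ.comp (hV.prodMk hS)).aestronglyMeasurable (fun _ => hφ0 _)
    (hψ.nonneg fun _ => hψ0 _) ?_
  have hφ' : Measurable fun q => ENNReal.ofReal (φ q) := hφ.ennreal_ofReal
  have hmap := hind.map_prod_eq_prod_map_map hV.aemeasurable hS.aemeasurable
  calc ∫⁻ ω, ENNReal.ofReal (φ (V ω, S ω)) ∂P
      = ∫⁻ q, ENNReal.ofReal (φ q) ∂(P.map fun ω => (V ω, S ω)) := by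
        rw [lintegral_map hφ' (hV.prodMk hS)]
    _ = ∫⁻ a, ∫⁻ s, ENNReal.ofReal (φ (a, s)) ∂(P.map S) ∂(P.map V) := by
        rw [hmap, lintegral_prod _ hφ'.aemeasurable]
    _ = ∫⁻ ω, ∫⁻ s, ENNReal.ofReal (φ (V ω, s)) ∂(P.map S) ∂P := by
        rw [lintegral_map hφ'.lintegral_prod_right' hV]
    _ ≤ ∫⁻ ω, ENNReal.ofReal (ψ (V ω)) ∂P :=
        lintegral_mono fun ω => (h (V ω)).lintegral_le fun s => hφ0 _
    _ ≤ ENNReal.ofReal b := hψ.lintegral_le fun _ => hψ0 _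

end MeanLE

/-! ### Averages of independent samples -/

section Average

variable {E : Type*} [NormedAddCommGroup E] [InnerProductSpace ℝ E] [FiniteDimensional ℝ E]
  [MeasurableSpace E] [BorelSpace E]

/-- The second moment of a sum of pairwise independent centred random vectors. -/
theorem meanLE_norm_add_smul_sum_sq {Ω : Type*} [MeasurableSpace Ω] {P : Measure Ω}
    [IsProbabilityMeasure P] {Y : ℕ → Ω → E} {V : ℝ} (hint : ∀ i, Integrable (Y i) P)
    (hzero : ∀ i, ∫ ω, Y i ω ∂P = 0) (hsq : ∀ i, MeanLE P (fun ω => ‖Y i ω‖ ^ 2) V)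
    (hind : ∀ i j, i ≠ j → IndepFun (Y i) (Y j) P) (c : E) (r : ℝ) (n : ℕ) :
    MeanLE P (fun ω => ‖c + r • ∑ i ∈ Finset.range n, Y i ω‖ ^ 2) (‖c‖ ^ 2 + n * (r ^ 2 * V)) := by
  induction n with
  | zero => simpa using meanLE_const (P := P) (‖c‖ ^ 2)
  | succ n ih =>
    -- Independence makes the cross terms integrable and lets the inner product be evaluated at the
    -- means, which are zero.
    have hcross : ∀ i < n, Integrable (fun ω => ⟪Y i ω, Y n ω⟫) P ∧
        ∫ ω, ⟪Y i ω, Y n ω⟫ ∂P = 0 := by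
      intro i hi
      have h1 := (hind i n hi.ne).integrable_bilin (hint i) (hint n)
        (innerSL ℝ : E →L[ℝ] E →L[ℝ] ℝ)
      have h2 := (hind i n hi.ne).integral_bilin (hint i) (hint n)
        (innerSL ℝ : E →L[ℝ] E →L[ℝ] ℝ)
      refine ⟨h1, h2.trans ?_⟩
      rw [hzero i]
      simp
    have hc : Integrable (fun ω => ⟪c, Y n ω⟫) P ∧ ∫ ω, ⟪c, Y n ω⟫ ∂P = 0 := by
      refine ⟨(hint n).const_inner c, ?_⟩
      rw [integral_inner (hint n), hzero n, inner_zero_right]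
    have hlin : MeanLE P (fun ω => 2 * r * (⟪c, Y n ω⟫ +
        r * ∑ i ∈ Finset.range n, ⟪Y i ω, Y n ω⟫)) 0 := by
      have hi2 : Integrable (fun ω => r * ∑ i ∈ Finset.range n, ⟪Y i ω, Y n ω⟫) P :=
        (integrable_finsetSum _ fun i hi => (hcross i (Finset.mem_range.1 hi)).1).const_mul r
      refine ⟨(hc.1.add hi2).const_mul _, le_of_eq ?_⟩
      rw [integral_const_mul, integral_add hc.1 hi2, hc.2, integral_const_mul,
        integral_finsetSum _ fun i hi => (hcross i (Finset.mem_range.1 hi)).1,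
        Finset.sum_eq_zero fun i hi => (hcross i (Finset.mem_range.1 hi)).2]
      simp
    have hall := (ih.add hlin).add ((hsq n).const_mul (sq_nonneg r))
    convert hall using 1
    · funext ω
      have e : c + r • ∑ i ∈ Finset.range (n + 1), Y i ω =
          (c + r • ∑ i ∈ Finset.range n, Y i ω) + r • Y n ω := by
        rw [Finset.sum_range_succ, smul_add, add_assoc]
      rw [e, norm_add_sq_real, norm_smul, mul_pow, Real.norm_eq_abs, sq_abs, inner_smul_right,
        inner_add_left, inner_smul_left, sum_inner]
      simp only [conj_trivial]
      ring
    · push_cast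
      ring

/-- Second moment of a minibatch estimator. -/
theorem meanLE_norm_miniBatch_sq {Z : Type*} [MeasurableSpace Z] {Pz : Measure Z}
    [IsProbabilityMeasure Pz] {G : E → Z → E} {x m : E} {V : ℝ} (hmeas : Measurable (G x))
    (hint : Integrable (G x) Pz) (hmean : ∫ z, G x z ∂Pz = m)
    (hsq : MeanLE Pz (fun z => ‖G x z - m‖ ^ 2) V) (c : E) {S : ℕ} (hS : 0 < S) :
    MeanLE (Measure.infinitePi fun _ : ℕ => Pz) (fun z => ‖c + (miniBatch G x S z - m)‖ ^ 2)
      (‖c‖ ^ 2 + V / S) := by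
  have hev : ∀ i : ℕ, (Measure.infinitePi fun _ : ℕ => Pz).map (fun z : ℕ → Z => z i) = Pz :=
    fun i => Measure.infinitePi_map_eval (fun _ : ℕ => Pz) i
  have hm : ∀ i : ℕ, Measurable fun z : ℕ → Z => z i := fun i => measurable_pi_apply i
  have hcm : Measurable fun z => G x z - m := hmeas.sub_const m
  have hY : Integrable (fun z => G x z - m) Pz := hint.sub (integrable_const m)
  have hind := iIndepFun_infinitePi (P := fun _ : ℕ => Pz) (X := fun _ z => G x z - m)
    fun _ => hcm
  have key := meanLE_norm_add_smul_sum_sq (P := Measure.infinitePi fun _ : ℕ => Pz)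
    (Y := fun i z => G x (z i) - m) (V := V)
    (fun i => by
      have := hY
      rw [← hev i] at this
      exact this.comp_measurable (hm i))
    (fun i => by
      have h1 : ∫ z : ℕ → Z, (G x (z i) - m) ∂(Measure.infinitePi fun _ : ℕ => Pz) =
          ∫ z, (G x z - m) ∂((Measure.infinitePi fun _ : ℕ => Pz).map (fun z : ℕ → Z => z i)) := by
        rw [integral_map (hm i).aemeasurable hcm.aestronglyMeasurable]
      rw [h1, hev i, integral_sub hint (integrable_const m), hmean]
      simp)
    (fun i => by
      have := hsq
      rw [← hev i] at this
      exact this.comp_map (hm i))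
    (fun i j hij => hind.indepFun hij) c (1 / (S : ℝ)) S
  have hS' : (0 : ℝ) < S := by exact_mod_cast hS
  convert key using 1
  · funext z
    congr 3
    rw [miniBatch, Finset.sum_sub_distrib, Finset.sum_const, Finset.card_range, smul_sub,
      ← Nat.cast_smul_eq_nsmul ℝ, smul_smul]
    rw [one_div_mul_cancel hS'.ne', one_smul]
  · field_simp

end Average

/-! ### One step of the estimator -/

theorem meanLE_seedLaw {Z : Type*} [MeasurableSpace Z] {Pz : Measure Z} [IsProbabilityMeasure Pz]
    {j : ℕ} {g : Seed Z → ℝ} (hg : Measurable g) (h0 : ∀ s, 0 ≤ g s) {a b : ℝ}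
    (ht : MeanLE (Measure.infinitePi fun _ : ℕ => Pz) (fun z => g (true, z)) a)
    (hf : MeanLE (Measure.infinitePi fun _ : ℕ => Pz) (fun z => g (false, z)) b) :
    MeanLE (seedLaw Pz j) g (batchProb j * a + (1 - batchProb j) * b) := by
  have ha := ht.nonneg fun _ => h0 _
  have hb := hf.nonneg fun _ => h0 _
  have hp0 : (0 : ℝ) ≤ batchProb j := (batchProb j).2.1
  have hp1 : (0 : ℝ) ≤ 1 - batchProb j := sub_nonneg.2 (batchProb j).2.2
  refine meanLE_of_lintegral_le hg.aestronglyMeasurable h0 (by positivity) ?_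
  rw [seedLaw, lintegral_prod _ hg.ennreal_ofReal.aemeasurable, bernoulliMeasure_def,
    lintegral_add_measure, lintegral_smul_measure, lintegral_smul_measure, lintegral_dirac,
    lintegral_dirac, ENNReal.ofReal_add (by positivity) (by positivity), ENNReal.ofReal_mul hp0,
    ENNReal.ofReal_mul hp1]
  have e1 : ENNReal.ofReal (batchProb j) = unitInterval.toNNReal (batchProb j) :=
    ENNReal.ofReal_eq_coe_nnreal hp0
  have e2 : ENNReal.ofReal (1 - batchProb j) =
      unitInterval.toNNReal (unitInterval.symm (batchProb j)) :=
    ENNReal.ofReal_eq_coe_nnreal hp1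
  rw [e1, e2, ENNReal.smul_def, ENNReal.smul_def, smul_eq_mul, smul_eq_mul]
  gcongr
  · exact ht.lintegral_le fun _ => h0 _
  · exact hf.lintegral_le fun _ => h0 _

theorem IsStochasticOracle.measurable_apply {E Z : Type*} [NormedAddCommGroup E]
    [InnerProductSpace ℝ E] [MeasurableSpace E] [MeasurableSpace Z] {F : E → E} {Fhat : E → Z → E}
    {Pz : Measure Z} {L σ : ℝ} (h : IsStochasticOracle F Fhat Pz L σ) (x : E) :
    Measurable (Fhat x) :=
  h.measurable.comp (measurable_const.prodMk measurable_id)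

section Estimator

variable {E Z : Type*} [NormedAddCommGroup E] [InnerProductSpace ℝ E]

/-- The estimate of `F v`, given the estimate `est` of `F w` and the two batch sizes. -/
noncomputable def pageEstimate (Fhat : E → Z → E) (S₁ S₂ : ℕ) (v w est : E) (s : Seed Z) : E :=
  if s.1 = true then miniBatch Fhat v S₁ s.2
  else est + miniBatch (fun x z => Fhat x z - Fhat w z) v S₂ s.2

variable [FiniteDimensional ℝ E] [MeasurableSpace E] [BorelSpace E] [MeasurableSpace Z]
  {F : E → E} {Fhat : E → Z → E} {Pz : Measure Z} {L σ : ℝ}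

/-- The batch size is an argument because correction batches have random size; as `ℕ` is countable,
each fixed size may be treated separately. -/
theorem measurable_miniBatch (h : Measurable fun q : E × Z => Fhat q.1 q.2) :
    Measurable fun q : ℕ × E × (ℕ → Z) => miniBatch Fhat q.2.1 q.1 q.2.2 := by
  refine measurable_from_prod_countable_right fun S => ?_
  have : ProperSpace E := FiniteDimensional.proper_real E
  have hs : Measurable fun q : E × (ℕ → Z) => ∑ i ∈ Finset.range S, Fhat q.1 (q.2 i) :=
    Finset.measurable_fun_sum _ fun i _ =>
      h.comp (measurable_fst.prodMk ((measurable_pi_apply i).comp measurable_snd))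
  exact hs.const_smul (1 / (S : ℝ))

theorem measurable_pageEstimate (h : Measurable fun q : E × Z => Fhat q.1 q.2) {Ω : Type*}
    [MeasurableSpace Ω] {S₁ S₂ : Ω → ℕ} {v w est : Ω → E} {s : Ω → Seed Z} (hS₁ : Measurable S₁)
    (hS₂ : Measurable S₂) (hv : Measurable v) (hw : Measurable w) (he : Measurable est)
    (hs : Measurable s) :
    Measurable fun ω => pageEstimate Fhat (S₁ ω) (S₂ ω) (v ω) (w ω) (est ω) (s ω) := by
  have : ProperSpace E := FiniteDimensional.proper_real E
  have hb : ∀ {S : Ω → ℕ} {v : Ω → E}, Measurable S → Measurable v →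
      Measurable fun ω => miniBatch Fhat (v ω) (S ω) (s ω).2 := fun hS hv =>
    (measurable_miniBatch h).comp (hS.prodMk (hv.prodMk (measurable_snd.comp hs)))
  unfold pageEstimate
  refine Measurable.ite ((measurable_fst.comp hs) (measurableSet_singleton true)) (hb hS₁ hv) ?_
  have e : ∀ (v w : E) (S : ℕ) (z : ℕ → Z), miniBatch (fun x z => Fhat x z - Fhat w z) v S z =
      miniBatch Fhat v S z - miniBatch Fhat w S z := by
    intro v w S z
    simp only [miniBatch, Finset.sum_sub_distrib, smul_sub]
  simp_rw [e]
  exact he.add ((hb hS₂ hv).sub (hb hS₂ hw))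

theorem IsStochasticOracle.integrable_diff_sq [IsProbabilityMeasure Pz]
    (h : IsStochasticOracle F Fhat Pz L σ) (u v : E) :
    Integrable (fun z => ‖Fhat u z - Fhat v z‖ ^ 2) Pz := by
  have hm : Measurable fun z => ‖Fhat u z - Fhat v z‖ ^ 2 :=
    ((h.measurable_apply u).sub (h.measurable_apply v)).norm.pow_const 2
  refine Integrable.mono' (((h.integrable_sq u).const_mul 3).add
    (((h.integrable_sq v).const_mul 3).add (integrable_const (3 * ‖F u - F v‖ ^ 2))))
    hm.aestronglyMeasurable (Filter.Eventually.of_forall fun z => ?_)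
  rw [Real.norm_of_nonneg (by positivity)]
  have h1 : ‖Fhat u z - Fhat v z‖ ≤ ‖Fhat u z - F u‖ + ‖Fhat v z - F v‖ + ‖F u - F v‖ := by
    calc ‖Fhat u z - Fhat v z‖ = ‖(Fhat u z - F u) - (Fhat v z - F v) + (F u - F v)‖ := by
          congr 1; abel
      _ ≤ ‖(Fhat u z - F u) - (Fhat v z - F v)‖ + ‖F u - F v‖ := norm_add_le _ _
      _ ≤ _ := by gcongr; exact norm_sub_le _ _
  have h2 : ‖Fhat u z - Fhat v z‖ ^ 2 ≤
      (‖Fhat u z - F u‖ + ‖Fhat v z - F v‖ + ‖F u - F v‖) ^ 2 := by gcongr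
  simp only [Pi.add_apply]
  nlinarith [sq_nonneg (‖Fhat u z - F u‖ - ‖Fhat v z - F v‖),
    sq_nonneg (‖Fhat u z - F u‖ - ‖F u - F v‖), sq_nonneg (‖Fhat v z - F v‖ - ‖F u - F v‖)]

/-- Jensen's inequality, in the form of the variance decomposition. -/
theorem IsStochasticOracle.integral_centered_sq [IsProbabilityMeasure Pz]
    (h : IsStochasticOracle F Fhat Pz L σ) (u v : E) :
    MeanLE Pz (fun z => ‖(Fhat u z - Fhat v z) - (F u - F v)‖ ^ 2)
      (L ^ 2 * ‖u - v‖ ^ 2 - ‖F u - F v‖ ^ 2) := by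
  have hint : Integrable (fun z => Fhat u z - Fhat v z) Pz := (h.integrable u).sub (h.integrable v)
  have hmean : ∫ z, (Fhat u z - Fhat v z) ∂Pz = F u - F v := by
    rw [integral_sub (h.integrable u) (h.integrable v), h.unbiased, h.unbiased]
  have e : (fun z => ‖(Fhat u z - Fhat v z) - (F u - F v)‖ ^ 2) = fun z =>
      ‖Fhat u z - Fhat v z‖ ^ 2 + (-2 * ⟪F u - F v, Fhat u z - Fhat v z⟫ + ‖F u - F v‖ ^ 2) := by
    funext z
    rw [norm_sub_sq_real, real_inner_comm]
    ring
  have hi : Integrable (fun z => -2 * ⟪F u - F v, Fhat u z - Fhat v z⟫) Pz :=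
    (hint.const_inner _).const_mul _
  have hi2 : Integrable (fun z => -2 * ⟪F u - F v, Fhat u z - Fhat v z⟫ + ‖F u - F v‖ ^ 2) Pz :=
    hi.add (integrable_const _)
  rw [e]
  refine ⟨(h.integrable_diff_sq u v).add hi2, ?_⟩
  rw [integral_add (h.integrable_diff_sq u v) hi2, integral_add hi (integrable_const _),
    integral_const_mul, integral_inner hint, hmean, real_inner_self_eq_norm_sq]
  have := h.lipschitz u v
  simp
  linarith

theorem IsStochasticOracle.lipschitz_norm [IsProbabilityMeasure Pz]
    (h : IsStochasticOracle F Fhat Pz L σ) (hL : 0 < L) (u v : E) :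
    ‖F u - F v‖ ≤ L * ‖u - v‖ := by
  have h1 := (h.integral_centered_sq u v).nonneg fun _ => by positivity
  have h2 : ‖F u - F v‖ ^ 2 ≤ (L * ‖u - v‖) ^ 2 := by
    rw [mul_pow]; linarith
  exact (sq_le_sq₀ (norm_nonneg _) (by positivity)).1 h2

theorem IsStochasticOracle.continuous [IsProbabilityMeasure Pz]
    (h : IsStochasticOracle F Fhat Pz L σ) (hL : 0 < L) : Continuous F := by
  refine (LipschitzWith.of_dist_le_mul (K := ⟨L, hL.le⟩) fun u v => ?_).continuous
  rw [dist_eq_norm, dist_eq_norm]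
  exact h.lipschitz_norm hL u v

theorem IsStochasticOracle.meanLE_fullBatch [IsProbabilityMeasure Pz]
    (h : IsStochasticOracle F Fhat Pz L σ) (v : E) {S : ℕ} (hS : 0 < S) :
    MeanLE (Measure.infinitePi fun _ : ℕ => Pz) (fun z => ‖miniBatch Fhat v S z - F v‖ ^ 2)
      (σ ^ 2 / S) := by
  have := meanLE_norm_miniBatch_sq (h.measurable_apply v) (h.integrable v) (h.unbiased v)
    ⟨h.integrable_sq v, h.variance_le v⟩ 0 hS
  simpa using this

/-- The new error is the old error `est - F w` plus an average of independent centred differences,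
so the squares add without a cross term. An empty batch occurs only for `v = w`, where no correction
is needed. -/
theorem IsStochasticOracle.meanLE_correction [IsProbabilityMeasure Pz]
    (h : IsStochasticOracle F Fhat Pz L σ) (v w est : E) {S : ℕ} {τ : ℝ} (hτ : 0 ≤ τ)
    (hS : L ^ 2 * ‖v - w‖ ^ 2 ≤ τ * S) (hS0 : S = 0 → v = w) :
    MeanLE (Measure.infinitePi fun _ : ℕ => Pz)
      (fun z => ‖est + miniBatch (fun x z => Fhat x z - Fhat w z) v S z - F v‖ ^ 2)
      (‖est - F w‖ ^ 2 + τ) := by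
  rcases Nat.eq_zero_or_pos S with rfl | hpos
  · obtain rfl := hS0 rfl
    simpa [miniBatch] using (meanLE_const (‖est - F v‖ ^ 2)).mono (le_add_of_nonneg_right hτ)
  have hc := (h.integral_centered_sq v w).mono
    (sub_le_self _ (by positivity) : _ ≤ L ^ 2 * ‖v - w‖ ^ 2)
  have := meanLE_norm_miniBatch_sq (G := fun x z => Fhat x z - Fhat w z) (x := v) (m := F v - F w)
    ((h.measurable_apply v).sub (h.measurable_apply w)) ((h.integrable v).sub (h.integrable w))
    (by rw [integral_sub (h.integrable v) (h.integrable w), h.unbiased, h.unbiased])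
    hc (est - F w) hpos
  have hS' : (0 : ℝ) < S := by exact_mod_cast hpos
  have hle : L ^ 2 * ‖v - w‖ ^ 2 / S ≤ τ := by
    rwa [div_le_iff₀ hS']
  convert this.mono (add_le_add_right hle _) using 3 with z
  · congr 1; abel

theorem IsStochasticOracle.meanLE_pageEstimate [IsProbabilityMeasure Pz]
    (h : IsStochasticOracle F Fhat Pz L σ) (j : ℕ) (v w est : E) {S₁ S₂ : ℕ} {τ τ' : ℝ}
    (hS₁ : σ ^ 2 ≤ τ * S₁) (hS₁0 : 0 < S₁) (hτ' : 0 ≤ τ')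
    (hS₂ : L ^ 2 * ‖v - w‖ ^ 2 ≤ τ' * S₂) (hS₂0 : S₂ = 0 → v = w) :
    MeanLE (seedLaw Pz j) (fun s => ‖pageEstimate Fhat S₁ S₂ v w est s - F v‖ ^ 2)
      (batchProb j * τ + (1 - batchProb j) * (‖est - F w‖ ^ 2 + τ')) := by
  have hm : Measurable fun s : Seed Z => pageEstimate Fhat S₁ S₂ v w est s :=
    measurable_pageEstimate h.measurable measurable_const measurable_const measurable_const
      measurable_const measurable_const measurable_id
  refine meanLE_seedLaw ((hm.sub_const _).norm.pow_const 2) (fun _ => by positivity) ?_ ?_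
  · have hS' : (0 : ℝ) < S₁ := by exact_mod_cast hS₁0
    simpa [pageEstimate] using (h.meanLE_fullBatch v hS₁0).mono ((div_le_iff₀ hS').2 hS₁)
  · simpa [pageEstimate] using h.meanLE_correction v w est hτ' hS₂ hS₂0

end Estimator

/-! ### E-Halpern with random start -/

/-- Size of the full batch of iteration `k`. -/
noncomputable def fullSize (σ ε : ℝ) (k : ℕ) : ℕ := ⌈8 * σ ^ 2 / ((batchProb k : ℝ) * ε ^ 2)⌉₊

/-- Size of the batch of differences between `v` and `w` in iteration `k`. -/
noncomputable def corrSize {E : Type*} [NormedAddCommGroup E] (L ε : ℝ) (k : ℕ) (v w : E) : ℕ :=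
  ⌈8 * L ^ 2 * ‖v - w‖ ^ 2 / ((batchProb k : ℝ) ^ 2 * ε ^ 2)⌉₊

section EHalpern

variable {E Z : Type*} [NormedAddCommGroup E] [InnerProductSpace ℝ E]

variable (Fhat : E → Z → E) (L σ ε η₀ : ℝ) (u₀ : E) (s : ℕ → Seed Z)

theorem eHalpern_η (n : ℕ) : (eHalpern Fhat L σ ε η₀ u₀ s n).η = stepSize L η₀ n := by
  induction n with
  | zero => rfl
  | succ n ih => rw [stepSize, ← ih]; rfl

theorem eHalpern_v_succ (n : ℕ) : (eHalpern Fhat L σ ε η₀ u₀ s (n + 1)).v =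
    (1 / ((n : ℝ) + 2)) • u₀ + (((n : ℝ) + 1) / (n + 2)) • (eHalpern Fhat L σ ε η₀ u₀ s n).u -
      stepSize L η₀ n • (eHalpern Fhat L σ ε η₀ u₀ s n).est := by
  have e1 : (n : ℝ) + 2 = ((n + 1 : ℕ) : ℝ) + 1 := by push_cast; ring
  have e2 : (n : ℝ) + 1 = ((n + 1 : ℕ) : ℝ) := by push_cast; ring
  rw [e1, e2, ← eHalpern_η Fhat L σ ε η₀ u₀ s]
  rfl

theorem eHalpern_u_succ (n : ℕ) : (eHalpern Fhat L σ ε η₀ u₀ s (n + 1)).u =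
    (1 / ((n : ℝ) + 2)) • u₀ + (((n : ℝ) + 1) / (n + 2)) • (eHalpern Fhat L σ ε η₀ u₀ s n).u -
      stepSize L η₀ n • (eHalpern Fhat L σ ε η₀ u₀ s (n + 1)).est := by
  have e1 : (n : ℝ) + 2 = ((n + 1 : ℕ) : ℝ) + 1 := by push_cast; ring
  have e2 : (n : ℝ) + 1 = ((n + 1 : ℕ) : ℝ) := by push_cast; ring
  rw [e1, e2, ← eHalpern_η Fhat L σ ε η₀ u₀ s]
  rfl

theorem eHalpern_est_succ (n : ℕ) : (eHalpern Fhat L σ ε η₀ u₀ s (n + 1)).est =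
    pageEstimate Fhat (fullSize σ ε (n + 1))
      (corrSize L ε (n + 1) (eHalpern Fhat L σ ε η₀ u₀ s (n + 1)).v
        (eHalpern Fhat L σ ε η₀ u₀ s n).v)
      (eHalpern Fhat L σ ε η₀ u₀ s (n + 1)).v (eHalpern Fhat L σ ε η₀ u₀ s n).v
      (eHalpern Fhat L σ ε η₀ u₀ s n).est (s (n + 1)) := rfl

theorem eHalpern_queries_succ (n : ℕ) : (eHalpern Fhat L σ ε η₀ u₀ s (n + 1)).queries =
    (eHalpern Fhat L σ ε η₀ u₀ s n).queries + if (s (n + 1)).1 = true then fullSize σ ε (n + 1)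
      else 2 * corrSize L ε (n + 1) (eHalpern Fhat L σ ε η₀ u₀ s (n + 1)).v
        (eHalpern Fhat L σ ε η₀ u₀ s n).v := rfl

/-- The link to the pathwise analysis, for every start and every realization of the seeds. -/
theorem isTrajectory_eHalpern : IsTrajectory L η₀
    (fun n => (eHalpern Fhat L σ ε η₀ u₀ s n).u) (fun n => (eHalpern Fhat L σ ε η₀ u₀ s n).v)
    (fun n => (eHalpern Fhat L σ ε η₀ u₀ s n).est) where
  y_zero := rfl
  y_succ n := eHalpern_v_succ Fhat L σ ε η₀ u₀ s n
  x_succ n := eHalpern_u_succ Fhat L σ ε η₀ u₀ s n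

end EHalpern

theorem batchProb_pos (j : ℕ) : 0 < (batchProb j : ℝ) := by
  rcases j with _ | j
  · simp [batchProb]
  · exact lt_min (by positivity) one_pos

theorem batchProb_le_one (j : ℕ) : (batchProb j : ℝ) ≤ 1 := (batchProb j).2.2

theorem batchProb_succ (j : ℕ) : (batchProb (j + 1) : ℝ) = min (2 / ((j : ℝ) + 1)) 1 := rfl

theorem fullSize_pos {σ ε : ℝ} (hσ : 0 < σ) (hε : 0 < ε) (k : ℕ) : 0 < fullSize σ ε k := by
  have hp := batchProb_pos k
  exact Nat.ceil_pos.2 (by positivity)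

theorem sq_le_mul_fullSize {σ ε : ℝ} (hε : 0 < ε) (k : ℕ) :
    σ ^ 2 ≤ (batchProb k : ℝ) * ε ^ 2 / 8 * fullSize σ ε k := by
  have hp := batchProb_pos k
  have := Nat.le_ceil (8 * σ ^ 2 / ((batchProb k : ℝ) * ε ^ 2))
  rw [div_le_iff₀ (by positivity)] at this
  unfold fullSize
  linarith

theorem mul_sq_le_mul_corrSize {E : Type*} [NormedAddCommGroup E] {L ε : ℝ} (hε : 0 < ε) (k : ℕ)
    {v w : E} :
    L ^ 2 * ‖v - w‖ ^ 2 ≤ (batchProb k : ℝ) ^ 2 * ε ^ 2 / 8 * corrSize L ε k v w := by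
  have hp := batchProb_pos k
  have := Nat.le_ceil (8 * L ^ 2 * ‖v - w‖ ^ 2 / ((batchProb k : ℝ) ^ 2 * ε ^ 2))
  rw [div_le_iff₀ (by positivity)] at this
  unfold corrSize
  linarith

theorem eq_of_corrSize_eq_zero {E : Type*} [NormedAddCommGroup E] {L ε : ℝ} (hL : 0 < L)
    (hε : 0 < ε) (k : ℕ) {v w : E} (h : corrSize L ε k v w = 0) : v = w := by
  have hp := batchProb_pos k
  have h1 := Nat.ceil_eq_zero.1 h
  by_contra hne
  have : 0 < ‖v - w‖ := norm_pos_iff.2 (sub_ne_zero.2 hne)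
  have : 0 < 8 * L ^ 2 * ‖v - w‖ ^ 2 / ((batchProb k : ℝ) ^ 2 * ε ^ 2) := by positivity
  linarith

/-! ### Measurability of the states -/

section Measurability

variable {E Z : Type*} [NormedAddCommGroup E] [InnerProductSpace ℝ E] [FiniteDimensional ℝ E]
  [MeasurableSpace E] [BorelSpace E] [MeasurableSpace Z] {Fhat : E → Z → E}

theorem measurable_corrSize (L ε : ℝ) (k : ℕ) {Ω : Type*} [MeasurableSpace Ω] {v w : Ω → E}
    (hv : Measurable v) (hw : Measurable w) : Measurable fun ω => corrSize L ε k (v ω) (w ω) := by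
  have : ProperSpace E := FiniteDimensional.proper_real E
  unfold corrSize
  exact Nat.measurable_ceil.comp (by fun_prop)

/-- The σ-algebra on `Ω` is arbitrary and only the seeds up to `n` are required to be measurable, so
the lemma also yields measurability with respect to the past. -/
theorem measurable_eHalpern (h : Measurable fun q : E × Z => Fhat q.1 q.2) (L σ ε η₀ : ℝ)
    {Ω : Type*} [MeasurableSpace Ω] {U : Ω → E} {ζ : ℕ → Ω → Seed Z} (hU : Measurable U) {n : ℕ}
    (hζ : ∀ j ≤ n, Measurable (ζ j)) :
    Measurable (fun ω => (eHalpern Fhat L σ ε η₀ (U ω) (fun j => ζ j ω) n).u) ∧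
    Measurable (fun ω => (eHalpern Fhat L σ ε η₀ (U ω) (fun j => ζ j ω) n).v) ∧
    Measurable (fun ω => (eHalpern Fhat L σ ε η₀ (U ω) (fun j => ζ j ω) n).est) ∧
    Measurable (fun ω => (eHalpern Fhat L σ ε η₀ (U ω) (fun j => ζ j ω) n).queries) := by
  have : ProperSpace E := FiniteDimensional.proper_real E
  induction n with
  | zero =>
    refine ⟨hU, hU, ?_, measurable_const⟩
    exact (measurable_miniBatch h).comp (f := fun ω => (⌈8 * σ ^ 2 / ε ^ 2⌉₊, U ω, (ζ 0 ω).2))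
      (measurable_const.prodMk (hU.prodMk (measurable_snd.comp (hζ 0 le_rfl))))
  | succ n ih =>
    obtain ⟨hu, hv, he, hq⟩ := ih fun j hj => hζ j (by omega)
    have hz := hζ (n + 1) le_rfl
    have hanchor : Measurable fun ω => (1 / ((n : ℝ) + 2)) • U ω + (((n : ℝ) + 1) / (n + 2)) •
        (eHalpern Fhat L σ ε η₀ (U ω) (fun j => ζ j ω) n).u :=
      (hU.const_smul (1 / ((n : ℝ) + 2))).add (hu.const_smul (((n : ℝ) + 1) / (n + 2)))
    have hv' : Measurable fun ω => (eHalpern Fhat L σ ε η₀ (U ω) (fun j => ζ j ω) (n + 1)).v := by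
      simp_rw [eHalpern_v_succ]
      exact hanchor.sub (he.const_smul (stepSize L η₀ n))
    have hc : Measurable fun ω => corrSize L ε (n + 1)
        (eHalpern Fhat L σ ε η₀ (U ω) (fun j => ζ j ω) (n + 1)).v
        (eHalpern Fhat L σ ε η₀ (U ω) (fun j => ζ j ω) n).v :=
      measurable_corrSize L ε (n + 1) hv' hv
    have he' : Measurable fun ω =>
        (eHalpern Fhat L σ ε η₀ (U ω) (fun j => ζ j ω) (n + 1)).est := by
      simp_rw [eHalpern_est_succ]
      exact measurable_pageEstimate h measurable_const hc hv' hv he hz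
    refine ⟨?_, hv', he', ?_⟩
    · simp_rw [eHalpern_u_succ]
      exact hanchor.sub (he'.const_smul (stepSize L η₀ n))
    · simp_rw [eHalpern_queries_succ]
      refine hq.add (Measurable.ite ?_ measurable_const (hc.const_mul 2))
      exact (measurable_fst.comp hz) (measurableSet_singleton true)

end Measurability

/-- A random start `U` and seeds `ζ j` such that `ζ j` has law `seedLaw Pz j` and is independent of
the past `𝒢 j`. -/
structure IsSeedSequence {Ω E Z : Type*} [mΩ : MeasurableSpace Ω] [MeasurableSpace E]
    [MeasurableSpace Z] (P : Measure Ω) (Pz : Measure Z) (𝒢 : ℕ → MeasurableSpace Ω)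
    (ζ : ℕ → Ω → Seed Z) (U : Ω → E) : Prop where
  le : ∀ j, 𝒢 j ≤ mΩ
  mono : Monotone 𝒢
  start : Measurable[𝒢 0] U
  adapted : ∀ j, Measurable[𝒢 (j + 1)] (ζ j)
  law : ∀ j, P.map (ζ j) = seedLaw Pz j
  indep : ∀ j, Indep (𝒢 j) (MeasurableSpace.comap (ζ j) inferInstance) P

section Basic

variable {Ω E Z : Type*} [mΩ : MeasurableSpace Ω] [MeasurableSpace E] [MeasurableSpace Z]
  {P : Measure Ω} {Pz : Measure Z} {𝒢 : ℕ → MeasurableSpace Ω} {ζ : ℕ → Ω → Seed Z} {U : Ω → E}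

theorem IsSeedSequence.indepFun (h : IsSeedSequence P Pz 𝒢 ζ U) {A : Type*} [MeasurableSpace A]
    {V : Ω → A} {j : ℕ} (hV : Measurable[𝒢 j] V) : IndepFun V (ζ j) P :=
  (IndepFun_iff_Indep _ _ _).2 (indep_of_indep_of_le_left (h.indep j) hV.comap_le)

theorem IsSeedSequence.measurable_seed (h : IsSeedSequence P Pz 𝒢 ζ U) (j : ℕ) :
    Measurable (ζ j) :=
  (h.adapted j).mono (h.le _) le_rfl

theorem IsSeedSequence.measurable_start (h : IsSeedSequence P Pz 𝒢 ζ U) : Measurable U :=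
  h.start.mono (h.le _) le_rfl

end Basic

/-! ### Mean square error of the estimates -/

section RandomStart

variable {Ω E Z : Type*} [mΩ : MeasurableSpace Ω] [NormedAddCommGroup E] [InnerProductSpace ℝ E]
  [FiniteDimensional ℝ E] [MeasurableSpace E] [BorelSpace E] [MeasurableSpace Z] {P : Measure Ω}
  [IsProbabilityMeasure P] {Pz : Measure Z} [IsProbabilityMeasure Pz] {𝒢 : ℕ → MeasurableSpace Ω}
  {ζ : ℕ → Ω → Seed Z} {U : Ω → E} {F : E → E} {Fhat : E → Z → E} {L σ ε η₀ : ℝ}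

theorem IsSeedSequence.meanLE_error_zero (h : IsSeedSequence P Pz 𝒢 ζ U)
    (hO : IsStochasticOracle F Fhat Pz L σ) (hL : 0 < L) (hσ : 0 < σ) (hε : 0 < ε) :
    MeanLE P (fun ω => ‖(eHalpern Fhat L σ ε η₀ (U ω) (fun j => ζ j ω) 0).est -
      F (eHalpern Fhat L σ ε η₀ (U ω) (fun j => ζ j ω) 0).v‖ ^ 2) (ε ^ 2 / 8) := by
  have : ProperSpace E := FiniteDimensional.proper_real E
  have hF := (hO.continuous hL).measurable
  set S := ⌈8 * σ ^ 2 / ε ^ 2⌉₊ with hSdef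
  have hS : 0 < S := Nat.ceil_pos.2 (by positivity)
  have hS' : (0 : ℝ) < S := by exact_mod_cast hS
  have hle : σ ^ 2 / S ≤ ε ^ 2 / 8 := by
    have := Nat.le_ceil (8 * σ ^ 2 / ε ^ 2)
    rw [div_le_iff₀ (by positivity)] at this
    rw [div_le_iff₀ hS']
    linarith
  have hφ : Measurable fun q : E × Seed Z => ‖miniBatch Fhat q.1 S q.2.2 - F q.1‖ ^ 2 := by
    have h1 : Measurable fun q : E × Seed Z => miniBatch Fhat q.1 S q.2.2 :=
      (measurable_miniBatch hO.measurable).comp (f := fun q : E × Seed Z => (S, q.1, q.2.2))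
        (by fun_prop)
    exact (h1.sub (hF.comp measurable_fst)).norm.pow_const 2
  refine MeanLE.of_indepFun (V := U) (S := ζ 0)
    (φ := fun q : E × Seed Z => ‖miniBatch Fhat q.1 S q.2.2 - F q.1‖ ^ 2)
    (ψ := fun _ => ε ^ 2 / 8) h.measurable_start (h.measurable_seed 0) (h.indepFun h.start) hφ
    (fun _ => by positivity) (fun _ => by positivity) (fun a => ?_) (meanLE_const _)
  rw [h.law 0]
  have h1 := (hO.meanLE_fullBatch a hS).mono hle
  -- The initial estimate ignores the coin, so both outcomes have the same bound `h1`.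
  have h2 := meanLE_seedLaw (Pz := Pz) (j := 0)
    (hφ.comp (measurable_const.prodMk measurable_id : Measurable fun s : Seed Z => (a, s)))
    (fun _ => sq_nonneg _) h1 h1
  refine h2.mono (le_of_eq ?_)
  ring

/-- The points, the old estimate and the batch sizes are determined by the past. Freezing them and
integrating over the independent seed leaves an affine function of the old squared error. -/
theorem IsSeedSequence.meanLE_pageEstimate (h : IsSeedSequence P Pz 𝒢 ζ U)
    (hO : IsStochasticOracle F Fhat Pz L σ) (hL : 0 < L) (hσ : 0 < σ) (hε : 0 < ε) {k : ℕ} {b : ℝ}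
    {v w est : Ω → E} (hv : Measurable[𝒢 k] v) (hw : Measurable[𝒢 k] w) (he : Measurable[𝒢 k] est)
    (hb : MeanLE P (fun ω => ‖est ω - F (w ω)‖ ^ 2) b) :
    MeanLE P (fun ω => ‖pageEstimate Fhat (fullSize σ ε k) (corrSize L ε k (v ω) (w ω)) (v ω) (w ω)
      (est ω) (ζ k ω) - F (v ω)‖ ^ 2)
      (batchProb k * (batchProb k * ε ^ 2 / 8) +
        (1 - batchProb k) * (b + (batchProb k : ℝ) ^ 2 * ε ^ 2 / 8)) := by
  have : ProperSpace E := FiniteDimensional.proper_real E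
  have hF := (hO.continuous hL).measurable
  have hp := batchProb_pos k
  have hp1 := batchProb_le_one k
  have hV := hv.prodMk (hw.prodMk he)
  set p : ℝ := ((batchProb k : unitInterval) : ℝ)
  set φ : (E × E × E) × Seed Z → ℝ := fun q => ‖pageEstimate Fhat (fullSize σ ε k)
    (corrSize L ε k q.1.1 q.1.2.1) q.1.1 q.1.2.1 q.1.2.2 q.2 - F q.1.1‖ ^ 2 with hφdef
  have hφ : Measurable φ := by
    have hv : Measurable fun q : (E × E × E) × Seed Z => q.1.1 := by fun_prop
    have hw : Measurable fun q : (E × E × E) × Seed Z => q.1.2.1 := by fun_prop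
    have he : Measurable fun q : (E × E × E) × Seed Z => q.1.2.2 := by fun_prop
    have h1 := measurable_pageEstimate hO.measurable
      (measurable_const (a := fullSize σ ε k)) (measurable_corrSize L ε k hv hw) hv hw he
      measurable_snd
    exact (h1.sub (hF.comp hv)).norm.pow_const 2
  have hpage : ∀ v w est : E, MeanLE (seedLaw Pz k) (fun s => ‖pageEstimate Fhat (fullSize σ ε k)
      (corrSize L ε k v w) v w est s - F v‖ ^ 2)
      (p * (p * ε ^ 2 / 8) + (1 - p) * (‖est - F w‖ ^ 2 + p ^ 2 * ε ^ 2 / 8)) := by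
    intro v w est
    have h1 : σ ^ 2 ≤ p * ε ^ 2 / 8 * fullSize σ ε k := sq_le_mul_fullSize hε k
    have h2 : L ^ 2 * ‖v - w‖ ^ 2 ≤ p ^ 2 * ε ^ 2 / 8 * corrSize L ε k v w :=
      mul_sq_le_mul_corrSize hε k
    have h3 : 0 ≤ p ^ 2 * ε ^ 2 / 8 := by positivity
    exact hO.meanLE_pageEstimate k v w est h1 (fullSize_pos hσ hε k) h3 h2
      (eq_of_corrSize_eq_zero hL hε k)
  have hψ := (meanLE_const (P := P) (p * (p * ε ^ 2 / 8))).add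
    ((hb.add (meanLE_const (P := P) (p ^ 2 * ε ^ 2 / 8))).const_mul (sub_nonneg.2 hp1))
  refine MeanLE.of_indepFun (S := ζ k) (φ := φ)
    (V := fun ω => (v ω, w ω, est ω))
    (ψ := fun a => p * (p * ε ^ 2 / 8) + (1 - p) * (‖a.2.2 - F a.2.1‖ ^ 2 + p ^ 2 * ε ^ 2 / 8))
    (hV.mono (h.le _) le_rfl) (h.measurable_seed _) (h.indepFun hV) hφ (fun _ => by positivity)
    (fun a => ?_) (fun a => ?_) ?_
  · have : 0 ≤ 1 - p := by linarith
    positivity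
  · rw [h.law]
    exact hpage a.1 a.2.1 a.2.2
  · exact hψ

theorem IsSeedSequence.meanLE_error_succ (h : IsSeedSequence P Pz 𝒢 ζ U)
    (hO : IsStochasticOracle F Fhat Pz L σ) (hL : 0 < L) (hσ : 0 < σ) (hε : 0 < ε) {n : ℕ} {b : ℝ}
    (hb : MeanLE P (fun ω => ‖(eHalpern Fhat L σ ε η₀ (U ω) (fun j => ζ j ω) n).est -
      F (eHalpern Fhat L σ ε η₀ (U ω) (fun j => ζ j ω) n).v‖ ^ 2) b) :
    MeanLE P (fun ω => ‖(eHalpern Fhat L σ ε η₀ (U ω) (fun j => ζ j ω) (n + 1)).est -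
      F (eHalpern Fhat L σ ε η₀ (U ω) (fun j => ζ j ω) (n + 1)).v‖ ^ 2)
      (batchProb (n + 1) * (batchProb (n + 1) * ε ^ 2 / 8) +
        (1 - batchProb (n + 1)) * (b + (batchProb (n + 1) : ℝ) ^ 2 * ε ^ 2 / 8)) := by
  have hU : Measurable[𝒢 (n + 1)] U := h.start.mono (h.mono (by omega)) le_rfl
  obtain ⟨hu, hv, he, -⟩ := @measurable_eHalpern E Z _ _ _ _ _ _ Fhat hO.measurable L σ ε η₀ Ω
    (𝒢 (n + 1)) U ζ hU n (fun j hj => (h.adapted j).mono (h.mono (by omega)) le_rfl)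
  have hv' : Measurable[𝒢 (n + 1)] fun ω =>
      (eHalpern Fhat L σ ε η₀ (U ω) (fun j => ζ j ω) (n + 1)).v := by
    have : ProperSpace E := FiniteDimensional.proper_real E
    simp_rw [eHalpern_v_succ]
    exact ((hU.const_smul (1 / ((n : ℝ) + 2))).add
      (hu.const_smul (((n : ℝ) + 1) / (n + 2)))).sub (he.const_smul (stepSize L η₀ n))
  simp_rw [eHalpern_est_succ]
  exact h.meanLE_pageEstimate hO hL hσ hε hv' hv he hb

/-- In units of `ε²`, the error bound evolves by `c ↦ p²(2 - p)/8 + (1 - p)c`. For `p = 2/(n+1)`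
this preserves the rate `1/(n+1)`. The constant bound `1/8` is carried along because it keeps the
part of `noiseTerm` with factor `8K` from producing a logarithm. -/
theorem IsSeedSequence.meanLE_error (h : IsSeedSequence P Pz 𝒢 ζ U)
    (hO : IsStochasticOracle F Fhat Pz L σ) (hL : 0 < L) (hσ : 0 < σ) (hε : 0 < ε) (n : ℕ) :
    MeanLE P (fun ω => ‖(eHalpern Fhat L σ ε η₀ (U ω) (fun j => ζ j ω) n).est -
      F (eHalpern Fhat L σ ε η₀ (U ω) (fun j => ζ j ω) n).v‖ ^ 2)
      (ε ^ 2 * min (1 / 8) (1 / ((n : ℝ) + 1))) := by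
  induction n with
  | zero =>
    refine (h.meanLE_error_zero hO hL hσ hε).mono (le_of_eq ?_)
    norm_num
    ring
  | succ n ih =>
    refine (h.meanLE_error_succ hO hL hσ hε ih).mono ?_
    have hp := batchProb_pos (n + 1)
    have hp1 := batchProb_le_one (n + 1)
    have hps := batchProb_succ n
    set p : ℝ := ((batchProb (n + 1) : unitInterval) : ℝ)
    set c := min (1 / 8) (1 / ((n : ℝ) + 1)) with hc
    have hc8 : c ≤ 1 / 8 := min_le_left _ _
    have hcn : c ≤ 1 / ((n : ℝ) + 1) := min_le_right _ _
    have e : p * (p * ε ^ 2 / 8) + (1 - p) * (ε ^ 2 * c + p ^ 2 * ε ^ 2 / 8) =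
        ε ^ 2 * (p ^ 2 * (2 - p) / 8 + (1 - p) * c) := by ring
    rw [e]
    refine mul_le_mul_of_nonneg_left (le_min ?_ ?_) (by positivity)
    · have h1 : (1 - p) * c ≤ (1 - p) * (1 / 8) := mul_le_mul_of_nonneg_left hc8 (by linarith)
      -- The claim reduces to `p²(2 - p) ≤ p`, that is `p(1 - p)² ≥ 0`.
      nlinarith [mul_nonneg hp.le (sq_nonneg (1 - p))]
    · push_cast
      by_cases hn : n ≤ 1
      · have : p = 1 := by
          rw [hps, min_eq_right]
          rw [le_div_iff₀ (by positivity)]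
          have : (n : ℝ) ≤ 1 := by exact_mod_cast hn
          linarith
        rw [this]
        have : (n : ℝ) ≤ 1 := by exact_mod_cast hn
        rw [le_div_iff₀ (by positivity)]
        linarith
      · have h2 : (2 : ℝ) ≤ n := by exact_mod_cast (by omega : 2 ≤ n)
        have hpe : p = 2 / ((n : ℝ) + 1) := by
          rw [hps, min_eq_left]
          rw [div_le_one (by positivity)]
          linarith
        have h1 : (1 - p) * c ≤ (1 - p) * (1 / ((n : ℝ) + 1)) :=
          mul_le_mul_of_nonneg_left hcn (by linarith)
        have h3 : p ^ 2 * (2 - p) / 8 + (1 - p) * (1 / ((n : ℝ) + 1)) ≤ 1 / ((n : ℝ) + 1 + 1) := by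
          rw [hpe]
          have h4 : 1 / ((n : ℝ) + 1 + 1) - ((2 / ((n : ℝ) + 1)) ^ 2 * (2 - 2 / ((n : ℝ) + 1)) / 8 +
              (1 - 2 / ((n : ℝ) + 1)) * (1 / ((n : ℝ) + 1))) =
              (2 * (n : ℝ) + 3) / (((n : ℝ) + 1) ^ 3 * (n + 2)) := by
            have : (n : ℝ) + 1 + 1 = n + 2 := by ring
            rw [this]
            field_simp
            ring
          have h5 : 0 ≤ (2 * (n : ℝ) + 3) / (((n : ℝ) + 1) ^ 3 * (n + 2)) := by positivity
          linarith
        linarith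

theorem IsSeedSequence.meanLE_noise (h : IsSeedSequence P Pz 𝒢 ζ U)
    (hO : IsStochasticOracle F Fhat Pz L σ) (hL : 0 < L) (hσ : 0 < σ) (hε : 0 < ε) (h0 : 0 < η₀)
    (K : ℕ) :
    MeanLE P (fun ω => noise η₀ K fun n =>
      (eHalpern Fhat L σ ε η₀ (U ω) (fun j => ζ j ω) n).est -
        F (eHalpern Fhat L σ ε η₀ (U ω) (fun j => ζ j ω) n).v) (4 * η₀ * K ^ 2 * ε ^ 2) := by
  have hK : (0 : ℝ) ≤ K := Nat.cast_nonneg K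
  -- The shape `6n + 3 + K` sums exactly to `4K²`. The rate `1/(n+1)` gives `10n/3 + 4` for the
  -- parts without `8K`, which is below `6n + 3` only from `n = 1` on; for `n = 0` the bound `1/8`
  -- is used instead.
  have hterm : ∀ n : ℕ, MeanLE P (fun ω => noiseTerm η₀ K (fun n =>
      (eHalpern Fhat L σ ε η₀ (U ω) (fun j => ζ j ω) n).est -
        F (eHalpern Fhat L σ ε η₀ (U ω) (fun j => ζ j ω) n).v) n)
      (η₀ * ε ^ 2 * (6 * n + 3 + K)) := by
    intro n
    have h1 := h.meanLE_error (η₀ := η₀) hO hL hσ hε (n + 1)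
    have h2 := h.meanLE_error (η₀ := η₀) hO hL hσ hε n
    have hsum := ((h1.const_mul (by positivity : 0 ≤ 8 / 3 * ((n : ℝ) + 1) * (n + 2) + 8 * K)).add
      (h2.const_mul (by positivity : 0 ≤ 2 / 3 * ((n : ℝ) + 1) * (n + 2)))).const_mul h0.le
    refine hsum.mono ?_
    set c := min (1 / 8) (1 / ((n : ℝ) + 1)) with hc
    set c' := min (1 / 8) (1 / (((n + 1 : ℕ) : ℝ) + 1)) with hc'
    have hc8 : c ≤ 1 / 8 := min_le_left _ _
    have hc'8 : c' ≤ 1 / 8 := min_le_left _ _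
    have hcn : ((n : ℝ) + 1) * c ≤ 1 := by
      rw [mul_comm, ← le_div_iff₀ (by positivity)]; exact min_le_right _ _
    have hc'n : ((n : ℝ) + 2) * c' ≤ 1 := by
      rw [mul_comm, ← le_div_iff₀ (by positivity)]
      refine (min_le_right _ _).trans (le_of_eq ?_)
      push_cast; ring
    have e : η₀ * ((8 / 3 * ((n : ℝ) + 1) * (n + 2) + 8 * K) * (ε ^ 2 * c') +
        2 / 3 * ((n : ℝ) + 1) * (n + 2) * (ε ^ 2 * c)) = η₀ * ε ^ 2 *
        (8 / 3 * ((n : ℝ) + 1) * ((n + 2) * c') + 8 * K * c' +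
          2 / 3 * (n + 2) * (((n : ℝ) + 1) * c)) := by ring
    rw [e]
    refine mul_le_mul_of_nonneg_left ?_ (by positivity)
    have k1 : 8 * K * c' ≤ K := by nlinarith
    rcases n with _ | n
    · push_cast at *
      linarith
    · have k2 : 8 / 3 * (((n + 1 : ℕ) : ℝ) + 1) * ((((n + 1 : ℕ) : ℝ) + 2) * c') ≤
          8 / 3 * (((n + 1 : ℕ) : ℝ) + 1) * 1 := by gcongr
      have k3 : 2 / 3 * (((n + 1 : ℕ) : ℝ) + 2) * ((((n + 1 : ℕ) : ℝ) + 1) * c) ≤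
          2 / 3 * (((n + 1 : ℕ) : ℝ) + 2) * 1 := by gcongr
      have : (0 : ℝ) ≤ n := Nat.cast_nonneg n
      push_cast at *
      linarith
  refine (MeanLE.sum (s := Finset.range K) fun n _ => hterm n).mono ?_
  have hs : ∀ m : ℕ, ∑ n ∈ Finset.range m, (6 * (n : ℝ) + 3 + K) = 3 * m ^ 2 + m * K := by
    intro m
    induction m with
    | zero => simp
    | succ m ih => rw [Finset.sum_range_succ, ih]; push_cast; ring
  rw [← Finset.mul_sum, hs]
  exact le_of_eq (by ring)

end RandomStart

/-! ### One call of E-Halpern -/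

theorem callAccuracy_pos {L μ η₀ ε : ℝ} (hL : 0 < L) (h0 : 0 < η₀) (hμ : 0 < μ) (hε : 0 < ε)
    (hm : paramM L * η₀ ^ 2 ≤ 1 / 3) : 0 < callAccuracy L μ η₀ ε := by
  have hlow := etaLow_pos h0 hm
  have hM : 0 < paramM L := by unfold paramM; positivity
  unfold callAccuracy
  positivity

theorem callAccuracy_sq {L μ η₀ ε : ℝ} (hL : 0 < L) (h0 : 0 < η₀)
    (hm : paramM L * η₀ ^ 2 ≤ 1 / 3) :
    callAccuracy L μ η₀ ε ^ 2 * (20 * (1 + paramM L * etaLow L η₀ * η₀)) =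
      μ ^ 2 * ε ^ 2 * (paramM L * etaLow L η₀ ^ 2) := by
  have hlow := etaLow_pos h0 hm
  have hM : 0 < paramM L := by unfold paramM; positivity
  unfold callAccuracy
  rw [div_pow, mul_pow, mul_pow, mul_pow, Real.sq_sqrt (by positivity),
    Real.sq_sqrt (by positivity)]
  field_simp
  ring

theorem callAccuracy_sq_le {L μ η₀ ε : ℝ} (hL : 0 < L) (h0 : 0 < η₀)
    (hm : paramM L * η₀ ^ 2 ≤ 1 / 3) :
    callAccuracy L μ η₀ ε ^ 2 * 20 ≤ μ ^ 2 * ε ^ 2 * (paramM L * etaLow L η₀ ^ 2) := by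
  have hlow := etaLow_pos h0 hm
  have hM : 0 < paramM L := by unfold paramM; positivity
  rw [← callAccuracy_sq hL h0 hm]
  have : 0 ≤ callAccuracy L μ η₀ ε ^ 2 * (paramM L * etaLow L η₀ * η₀) := by positivity
  linarith

theorem IsSeedSequence.meanLE_coin {Ω E Z : Type*} [MeasurableSpace Ω] [MeasurableSpace E]
    [MeasurableSpace Z] {P : Measure Ω} {Pz : Measure Z} [IsProbabilityMeasure Pz]
    {𝒢 : ℕ → MeasurableSpace Ω} {ζ : ℕ → Ω → Seed Z} {U : Ω → E}
    (h : IsSeedSequence P Pz 𝒢 ζ U) (j : ℕ)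
    {r : ℝ} (hr : 0 ≤ r) :
    MeanLE P (fun ω => if (ζ j ω).1 = true then r else 0) (batchProb j * r) := by
  have hm : Measurable fun s : Seed Z => if s.1 = true then r else 0 :=
    Measurable.ite (measurable_fst (measurableSet_singleton true)) measurable_const measurable_const
  have h1 := meanLE_seedLaw (Pz := Pz) (j := j) hm (fun s => by split_ifs <;> simp [hr])
    (a := r) (b := 0) (by simpa using meanLE_const _) (by simpa using meanLE_const _)
  rw [← h.law j] at h1
  simpa using h1.comp_map (h.measurable_seed j)

section Call

variable {Ω E Z : Type*} [mΩ : MeasurableSpace Ω] [NormedAddCommGroup E] [InnerProductSpace ℝ E]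
  [FiniteDimensional ℝ E] [MeasurableSpace E] [BorelSpace E] [MeasurableSpace Z] {P : Measure Ω}
  [IsProbabilityMeasure P] {Pz : Measure Z} [IsProbabilityMeasure Pz] {𝒢 : ℕ → MeasurableSpace Ω}
  {ζ : ℕ → Ω → Seed Z} {U : Ω → E} {F : E → E} {Fhat : E → Z → E} {L μ σ ε η₀ b : ℝ} {ustar : E}

/-- The mean of `noise` is of order `K²δ²` and is divided by `K²`, so the length of the call drops
out. The choice of `callAccuracy` then leaves at most `(16/15)ε²·M·etaLow·η₀`, which by
`paramM_mul_etaLow_mul_le` is at most `(16/75)ε² ≤ ε²/4`. -/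
theorem IsSeedSequence.meanLE_norm_sub_sq (h : IsSeedSequence P Pz 𝒢 ζ U)
    (hO : IsStochasticOracle F Fhat Pz L σ) (hF : IsMonotoneOp F) (hsharp : IsSharp F μ ustar)
    (hstar : F ustar = 0) (hL : 0 < L) (hμ : 0 < μ) (hσ : 0 < σ) (hε : 0 < ε) (h0 : 0 < η₀)
    (hm : paramM L * η₀ ^ 2 ≤ 1 / 3) (hb : MeanLE P (fun ω => ‖U ω - ustar‖ ^ 2) b) :
    MeanLE P (fun ω => ‖(eHalpern Fhat L σ (callAccuracy L μ η₀ ε) η₀ (U ω) (fun j => ζ j ω)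
      (callLength L μ η₀)).u - ustar‖ ^ 2) (b / 4 + ε ^ 2 / 4) := by
  have : ProperSpace E := FiniteDimensional.proper_real E
  have hacc := callAccuracy_pos hL h0 hμ hε hm
  have hacc2 := callAccuracy_sq_le (μ := μ) (ε := ε) hL h0 hm
  set δ := callAccuracy L μ η₀ ε
  set K := callLength L μ η₀ with hK
  have hKpos : (0 : ℝ) < K := by exact_mod_cast callLength_pos h0 hμ hm
  have hlow := etaLow_pos h0 hm
  have hmeas := (measurable_eHalpern hO.measurable L σ δ η₀ h.measurable_start (n := K)
    fun j _ => h.measurable_seed j).1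
  have hN := (h.meanLE_noise (η₀ := η₀) hO hL hσ hacc h0 K).const_mul
    (by positivity : 0 ≤ 16 / (3 * (etaLow L η₀ * K ^ 2 * μ ^ 2)))
  have hD := hb.const_mul (by norm_num : (0 : ℝ) ≤ 1 / 4)
  have hsum := (hD.add hN).of_le (X := fun ω => ‖(eHalpern Fhat L σ δ η₀ (U ω)
    (fun j => ζ j ω) K).u - ustar‖ ^ 2) ((hmeas.sub_const ustar).norm.pow_const
      2).aestronglyMeasurable (fun _ => by positivity) (fun ω => ?_)
  · refine hsum.mono ?_
    have e : 16 / (3 * (etaLow L η₀ * K ^ 2 * μ ^ 2)) * (4 * η₀ * K ^ 2 * δ ^ 2) =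
        16 / 15 * (η₀ / (etaLow L η₀ * μ ^ 2)) * (δ ^ 2 * 20) := by
      field_simp
      ring
    have e2 : 16 / 15 * (η₀ / (etaLow L η₀ * μ ^ 2)) *
        (μ ^ 2 * ε ^ 2 * (paramM L * etaLow L η₀ ^ 2)) =
        16 / 15 * ε ^ 2 * (paramM L * etaLow L η₀ * η₀) := by
      field_simp
    have h1 : 16 / 15 * (η₀ / (etaLow L η₀ * μ ^ 2)) * (δ ^ 2 * 20) ≤
        16 / 15 * (η₀ / (etaLow L η₀ * μ ^ 2)) *
        (μ ^ 2 * ε ^ 2 * (paramM L * etaLow L η₀ ^ 2)) := by gcongr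
    have h2 : 16 / 15 * ε ^ 2 * (paramM L * etaLow L η₀ * η₀) ≤ 16 / 15 * ε ^ 2 * (1 / 5) := by
      have := paramM_mul_etaLow_mul_le hm
      gcongr
    rw [e]
    nlinarith [sq_nonneg ε]
  · have := (isTrajectory_eHalpern Fhat L σ δ η₀ (U ω) (fun j => ζ j ω)).norm_sub_sq_le hF
      (hO.lipschitz_norm hL) hsharp hstar hL h0 hμ hm hK
    refine this.trans (le_of_eq ?_)
    change ‖U ω - ustar‖ ^ 2 / 4 + _ = _
    ring

/-- A pathwise bound that charges a correction batch in every iteration, whatever the coin. Since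
`p(n+1) ≥ 1`, the factor `1/p²` is at most `(n+1)²`, which `IsTrajectory.sq_displacement_le`
compensates; `112000 = 2·8·7000`. -/
theorem eHalpern_queries_le (hO : IsStochasticOracle F Fhat Pz L σ) (hF : IsMonotoneOp F)
    (hsharp : IsSharp F μ ustar) (hstar : F ustar = 0) (hL : 0 < L) (hμ : 0 < μ) (hε : 0 < ε)
    (h0 : 0 < η₀) (hm : paramM L * η₀ ^ 2 ≤ 1 / 3) (u₀ : E) (s : ℕ → Seed Z) {K : ℕ} (hK : 0 < K)
    {n : ℕ} (hn : n ≤ K) :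
    ((eHalpern Fhat L σ ε η₀ u₀ s n).queries : ℝ) ≤ 8 * σ ^ 2 / ε ^ 2 + 1 +
      ∑ j ∈ Finset.range n, ((if (s (j + 1)).1 = true then (fullSize σ ε (j + 1) : ℝ) else 0) +
        (2 + 112000 * L ^ 2 / ε ^ 2 * (‖u₀ - ustar‖ ^ 2 + η₀ * noise η₀ K fun n =>
          (eHalpern Fhat L σ ε η₀ u₀ s n).est - F (eHalpern Fhat L σ ε η₀ u₀ s n).v))) := by
  have hN := noise_nonneg h0 K fun n =>
    (eHalpern Fhat L σ ε η₀ u₀ s n).est - F (eHalpern Fhat L σ ε η₀ u₀ s n).v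
  induction n with
  | zero =>
    simp only [Finset.range_zero, Finset.sum_empty, add_zero]
    exact (Nat.ceil_lt_add_one (by positivity)).le
  | succ n ih =>
    have ih := ih (by omega)
    have hd := (isTrajectory_eHalpern Fhat L σ ε η₀ u₀ s).sq_displacement_le hF
      (hO.lipschitz_norm hL) hsharp hstar hL h0 hμ hm hK (by omega : n ≤ K)
    have hd : ((n : ℝ) + 1) ^ 2 * ‖(eHalpern Fhat L σ ε η₀ u₀ s (n + 1)).v -
        (eHalpern Fhat L σ ε η₀ u₀ s n).v‖ ^ 2 ≤ 7000 * (‖u₀ - ustar‖ ^ 2 + η₀ * noise η₀ K fun n =>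
          (eHalpern Fhat L σ ε η₀ u₀ s n).est - F (eHalpern Fhat L σ ε η₀ u₀ s n).v) := hd
    rw [Finset.sum_range_succ, eHalpern_queries_succ]
    set B := ‖u₀ - ustar‖ ^ 2 + η₀ * noise η₀ K fun n =>
          (eHalpern Fhat L σ ε η₀ u₀ s n).est - F (eHalpern Fhat L σ ε η₀ u₀ s n).v
    have hB : 0 ≤ B := by positivity
    set v := (eHalpern Fhat L σ ε η₀ u₀ s (n + 1)).v
    set w := (eHalpern Fhat L σ ε η₀ u₀ s n).v
    have hc : (corrSize L ε (n + 1) v w : ℝ) ≤ 1 + 56000 * L ^ 2 / ε ^ 2 * B := by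
      have hp := batchProb_pos (n + 1)
      have hpn : 1 ≤ ((batchProb (n + 1) : unitInterval) : ℝ) * ((n : ℝ) + 1) := by
        rw [← div_le_iff₀ (by positivity), batchProb_succ]
        refine le_min ?_ ?_
        · gcongr; norm_num
        · rw [div_le_one (by positivity)]
          linarith [(Nat.cast_nonneg n : (0 : ℝ) ≤ n)]
      have h1 : (corrSize L ε (n + 1) v w : ℝ) ≤ 8 * L ^ 2 * ‖v - w‖ ^ 2 /
          (((batchProb (n + 1) : unitInterval) : ℝ) ^ 2 * ε ^ 2) + 1 :=
        (Nat.ceil_lt_add_one (by positivity)).le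
      set p := ((batchProb (n + 1) : unitInterval) : ℝ)
      have h2 : 8 * L ^ 2 * ‖v - w‖ ^ 2 / (p ^ 2 * ε ^ 2) ≤
          8 * L ^ 2 / ε ^ 2 * (((n : ℝ) + 1) ^ 2 * ‖v - w‖ ^ 2) := by
        rw [div_le_iff₀ (by positivity)]
        have e : 8 * L ^ 2 / ε ^ 2 * (((n : ℝ) + 1) ^ 2 * ‖v - w‖ ^ 2) * (p ^ 2 * ε ^ 2) =
            8 * L ^ 2 * ‖v - w‖ ^ 2 * (p * ((n : ℝ) + 1)) ^ 2 := by
          field_simp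
        rw [e]
        exact le_mul_of_one_le_right (by positivity) (one_le_pow₀ hpn)
      have h3 : 8 * L ^ 2 / ε ^ 2 * (((n : ℝ) + 1) ^ 2 * ‖v - w‖ ^ 2) ≤
          8 * L ^ 2 / ε ^ 2 * (7000 * B) := by gcongr
      have e : 8 * L ^ 2 / ε ^ 2 * (7000 * B) = 56000 * L ^ 2 / ε ^ 2 * B := by ring
      linarith
    have hB' : 0 ≤ 112000 * L ^ 2 / ε ^ 2 * B := by positivity
    have e : 112000 * L ^ 2 / ε ^ 2 * B = 2 * (56000 * L ^ 2 / ε ^ 2 * B) := by ring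
    push_cast
    split_ifs <;> linarith

theorem IsSeedSequence.meanLE_queries (h : IsSeedSequence P Pz 𝒢 ζ U)
    (hO : IsStochasticOracle F Fhat Pz L σ) (hF : IsMonotoneOp F) (hsharp : IsSharp F μ ustar)
    (hstar : F ustar = 0) (hL : 0 < L) (hμ : 0 < μ) (hσ : 0 < σ) (hε : 0 < ε) (h0 : 0 < η₀)
    (hm : paramM L * η₀ ^ 2 ≤ 1 / 3) (hb : MeanLE P (fun ω => ‖U ω - ustar‖ ^ 2) b) {K : ℕ}
    (hK : 0 < K) :
    MeanLE P (fun ω => ((eHalpern Fhat L σ ε η₀ (U ω) (fun j => ζ j ω) K).queries : ℝ))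
      ((K + 1) * (8 * σ ^ 2 / ε ^ 2 + 3) +
        K * (112000 * L ^ 2 / ε ^ 2 * (b + 4 * η₀ ^ 2 * K ^ 2 * ε ^ 2))) := by
  have hmeas := (measurable_eHalpern hO.measurable L σ ε η₀ h.measurable_start (n := K)
    fun j _ => h.measurable_seed j).2.2.2
  have hmeas' : Measurable fun ω =>
      ((eHalpern Fhat L σ ε η₀ (U ω) (fun j => ζ j ω) K).queries : ℝ) :=
    measurable_from_nat.comp hmeas
  -- The probability `p` of a full batch cancels the `1/p` in its size; rounding costs at most `p ≤
  -- 1`.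
  have hcoin : ∀ j ∈ Finset.range K, MeanLE P (fun ω =>
      if (ζ (j + 1) ω).1 = true then (fullSize σ ε (j + 1) : ℝ) else 0)
      (8 * σ ^ 2 / ε ^ 2 + 1) := by
    intro j _
    refine (h.meanLE_coin (j + 1) (Nat.cast_nonneg _)).mono ?_
    have hp := batchProb_pos (j + 1)
    have hp1 := batchProb_le_one (j + 1)
    have h1 : (fullSize σ ε (j + 1) : ℝ) ≤
        8 * σ ^ 2 / (((batchProb (j + 1) : unitInterval) : ℝ) * ε ^ 2) + 1 :=
      (Nat.ceil_lt_add_one (by positivity)).le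
    set p := ((batchProb (j + 1) : unitInterval) : ℝ)
    have h2 := mul_le_mul_of_nonneg_left h1 hp.le
    have e : p * (8 * σ ^ 2 / (p * ε ^ 2) + 1) = 8 * σ ^ 2 / ε ^ 2 + p := by
      field_simp
    linarith
  have hN := (hb.add ((h.meanLE_noise (η₀ := η₀) hO hL hσ hε h0 K).const_mul h0.le)).const_mul
    (by positivity : 0 ≤ 112000 * L ^ 2 / ε ^ 2)
  have hall := (meanLE_const (P := P) (8 * σ ^ 2 / ε ^ 2 + 1)).add
    (MeanLE.sum fun j hj => (hcoin j hj).add ((meanLE_const (P := P) 2).add hN))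
  refine (hall.of_le hmeas'.aestronglyMeasurable (fun _ => Nat.cast_nonneg _) fun ω =>
    eHalpern_queries_le hO hF hsharp hstar hL hμ hε h0 hm (U ω) (fun j => ζ j ω) hK le_rfl).mono ?_
  rw [Finset.sum_const, Finset.card_range, nsmul_eq_mul]
  have : η₀ * (4 * η₀ * K ^ 2 * ε ^ 2) = 4 * η₀ ^ 2 * K ^ 2 * ε ^ 2 := by ring
  rw [this]
  linarith

end Call

/-! ### Restarts -/

section Past

variable {Ω Z : Type*} [MeasurableSpace Z]

/-- The information available before iteration `j` of call `k`. -/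
abbrev past (ξ : ℕ × ℕ → Ω → Seed Z) (k j : ℕ) : MeasurableSpace Ω :=
  ⨆ t ∈ {t : ℕ × ℕ | t.1 < k ∨ t.1 = k ∧ t.2 < j}, MeasurableSpace.comap (ξ t) inferInstance

theorem measurable_past (ξ : ℕ × ℕ → Ω → Seed Z) {k j : ℕ} {t : ℕ × ℕ}
    (ht : t.1 < k ∨ t.1 = k ∧ t.2 < j) : Measurable[past ξ k j] (ξ t) :=
  (comap_measurable (ξ t)).mono
    (le_iSup₂_of_le (f := fun t _ => MeasurableSpace.comap (ξ t) inferInstance) t ht le_rfl) le_rfl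

theorem past_mono (ξ : ℕ × ℕ → Ω → Seed Z) {k j k' j' : ℕ} (h : k < k' ∨ k = k' ∧ j ≤ j') :
    past ξ k j ≤ past ξ k' j' :=
  biSup_mono fun t (ht : t.1 < k ∨ t.1 = k ∧ t.2 < j) =>
    show t.1 < k' ∨ t.1 = k' ∧ t.2 < j' by omega

end Past

theorem measurable_restarted {Ω E Z : Type*} [NormedAddCommGroup E] [InnerProductSpace ℝ E]
    [MeasurableSpace E] [MeasurableSpace Z] [FiniteDimensional ℝ E] [BorelSpace E]
    {ξ : ℕ × ℕ → Ω → Seed Z} {Fhat : E → Z → E} {L μ σ ε η₀ : ℝ} {u₀ : E}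
    (h : Measurable fun q : E × Z => Fhat q.1 q.2) (k : ℕ) :
    Measurable[past ξ k 0] fun ω =>
      (restarted Fhat L μ σ ε η₀ u₀ (fun t => ξ t ω) k).1 := by
  induction k with
  | zero => exact measurable_const
  | succ k ih =>
    exact (@measurable_eHalpern E Z _ _ _ _ _ _ Fhat h L σ (callAccuracy L μ η₀ ε) η₀ Ω
      (past ξ (k + 1) 0) _ (fun j => ξ (k, j)) (ih.mono (past_mono ξ (by omega)) le_rfl)
      (callLength L μ η₀) fun j _ => measurable_past ξ (Or.inl (Nat.lt_succ_self k))).1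

/-- The past of seed `(k, j)` is generated by the seeds that precede it lexicographically, an index
set not containing `(k, j)`; hence the independence. The start of call `k` depends on earlier calls
only. -/
theorem isSeedSequence_restarted {Ω E Z : Type*} [MeasurableSpace Ω] [NormedAddCommGroup E]
    [InnerProductSpace ℝ E] [MeasurableSpace E] [MeasurableSpace Z] [FiniteDimensional ℝ E]
    [BorelSpace E] {P : Measure Ω} {Pz : Measure Z} {ξ : ℕ × ℕ → Ω → Seed Z} {Fhat : E → Z → E}
    {L μ σ ε η₀ : ℝ} {u₀ : E} (hξ : IsSeedFamily P Pz ξ)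
    (h : Measurable fun q : E × Z => Fhat q.1 q.2) (k : ℕ) :
    IsSeedSequence P Pz (past ξ k) (fun j => ξ (k, j)) fun ω =>
      (restarted Fhat L μ σ ε η₀ u₀ (fun t => ξ t ω) k).1 where
  le j := iSup₂_le fun t _ => (hξ.measurable t).comap_le
  mono i j hij := past_mono ξ (by omega)
  start := measurable_restarted h k
  adapted j := measurable_past ξ (Or.inr ⟨rfl, Nat.lt_succ_self j⟩)
  law j := hξ.law (k, j)
  indep j := by
    have := indep_iSup_of_disjoint (fun t => (hξ.measurable t).comap_le) hξ.indep.iIndep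
      (S := {t : ℕ × ℕ | t.1 < k ∨ t.1 = k ∧ t.2 < j}) (T := {(k, j)})
      (Set.disjoint_singleton_right.2 fun ht => by
        have ht : k < k ∨ k = k ∧ j < j := ht
        omega)
    rwa [iSup_singleton] at this

section Restart

variable {Ω E Z : Type*} [mΩ : MeasurableSpace Ω] [NormedAddCommGroup E] [InnerProductSpace ℝ E]
  [MeasurableSpace E] [MeasurableSpace Z] [FiniteDimensional ℝ E] [BorelSpace E]
  {P : Measure Ω} [IsProbabilityMeasure P] {Pz : Measure Z} [IsProbabilityMeasure Pz]
  {ξ : ℕ × ℕ → Ω → Seed Z}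
  {F : E → E} {Fhat : E → Z → E} {L μ σ ε η₀ : ℝ} {u₀ ustar : E}

/-- Iterating `b ↦ b/4 + ε²/4`, whose fixed point is `ε²/3`. -/
theorem meanLE_restarted (hξ : IsSeedFamily P Pz ξ) (hO : IsStochasticOracle F Fhat Pz L σ)
    (hF : IsMonotoneOp F) (hsharp : IsSharp F μ ustar) (hstar : F ustar = 0) (hL : 0 < L)
    (hμ : 0 < μ) (hσ : 0 < σ) (hε : 0 < ε) (h0 : 0 < η₀) (hm : paramM L * η₀ ^ 2 ≤ 1 / 3) (k : ℕ) :
    MeanLE P (fun ω => ‖(restarted Fhat L μ σ ε η₀ u₀ (fun t => ξ t ω) k).1 - ustar‖ ^ 2)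
      (‖u₀ - ustar‖ ^ 2 / 4 ^ k + ε ^ 2 / 3) := by
  induction k with
  | zero =>
    refine (meanLE_const (P := P) (‖u₀ - ustar‖ ^ 2)).mono ?_
    have : 0 ≤ ε ^ 2 / 3 := by positivity
    linarith
  | succ k ih =>
    refine ((isSeedSequence_restarted hξ hO.measurable k).meanLE_norm_sub_sq hO hF hsharp hstar hL
      hμ hσ hε h0 hm ih).mono (le_of_eq ?_)
    rw [pow_succ]
    field_simp
    ring

/-- The initial distance enters call `i` with weight `4^{-i}`; the geometric series is the reason
why `‖u₀ - ustar‖²` carries `4/3` and not the number of calls. -/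
theorem meanLE_restarted_queries (hξ : IsSeedFamily P Pz ξ) (hO : IsStochasticOracle F Fhat Pz L σ)
    (hF : IsMonotoneOp F) (hsharp : IsSharp F μ ustar) (hstar : F ustar = 0) (hL : 0 < L)
    (hμ : 0 < μ) (hσ : 0 < σ) (hε : 0 < ε) (h0 : 0 < η₀) (hm : paramM L * η₀ ^ 2 ≤ 1 / 3) (k : ℕ) :
    MeanLE P (fun ω => ((restarted Fhat L μ σ ε η₀ u₀ (fun t => ξ t ω) k).2 : ℝ))
      (k * ((callLength L μ η₀ + 1) * (8 * σ ^ 2 / callAccuracy L μ η₀ ε ^ 2 + 3)) +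
        callLength L μ η₀ * (112000 * L ^ 2 / callAccuracy L μ η₀ ε ^ 2 *
          (4 / 3 * ‖u₀ - ustar‖ ^ 2 + k * (ε ^ 2 / 3 +
            4 * η₀ ^ 2 * callLength L μ η₀ ^ 2 * callAccuracy L μ η₀ ε ^ 2)))) := by
  have hacc := callAccuracy_pos hL h0 hμ hε hm
  have hK := callLength_pos (L := L) h0 hμ hm
  have hK' : (0 : ℝ) < callLength L μ η₀ := by exact_mod_cast hK
  have key : MeanLE P (fun ω => ((restarted Fhat L μ σ ε η₀ u₀ (fun t => ξ t ω) k).2 : ℝ))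
      (∑ i ∈ Finset.range k,
        ((callLength L μ η₀ + 1) * (8 * σ ^ 2 / callAccuracy L μ η₀ ε ^ 2 + 3) +
        callLength L μ η₀ * (112000 * L ^ 2 / callAccuracy L μ η₀ ε ^ 2 *
          ((‖u₀ - ustar‖ ^ 2 / 4 ^ i + ε ^ 2 / 3) +
            4 * η₀ ^ 2 * callLength L μ η₀ ^ 2 * callAccuracy L μ η₀ ε ^ 2)))) := by
    induction k with
    | zero => simpa [restarted] using meanLE_const (P := P) 0
    | succ k ih =>
      rw [Finset.sum_range_succ]
      have hq := (isSeedSequence_restarted hξ hO.measurable k).meanLE_queries hO hF hsharp hstar hL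
        hμ hσ hacc h0 hm (meanLE_restarted (u₀ := u₀) hξ hO hF hsharp hstar hL hμ hσ hε h0 hm k) hK
      have := ih.add hq
      simp_rw [← Nat.cast_add] at this
      exact this
  refine key.mono ?_
  have hgeo : ∑ i ∈ Finset.range k, ‖u₀ - ustar‖ ^ 2 / 4 ^ i ≤ 4 / 3 * ‖u₀ - ustar‖ ^ 2 := by
    have : ∀ m : ℕ, ∑ i ∈ Finset.range m, ‖u₀ - ustar‖ ^ 2 / 4 ^ i =
        4 / 3 * (‖u₀ - ustar‖ ^ 2 - ‖u₀ - ustar‖ ^ 2 / 4 ^ m) := by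
      intro m
      induction m with
      | zero => simp
      | succ m ih =>
        rw [Finset.sum_range_succ, ih, pow_succ]
        field_simp
        ring
    rw [this]
    have : 0 ≤ ‖u₀ - ustar‖ ^ 2 / 4 ^ k := by positivity
    linarith
  rw [Finset.sum_add_distrib, Finset.sum_const, Finset.card_range, nsmul_eq_mul, ← Finset.mul_sum,
    ← Finset.mul_sum, Finset.sum_add_distrib, Finset.sum_add_distrib, Finset.sum_const,
    Finset.sum_const, Finset.card_range, nsmul_eq_mul, nsmul_eq_mul]
  refine add_le_add le_rfl
    (mul_le_mul_of_nonneg_left (mul_le_mul_of_nonneg_left ?_ (by positivity)) (by positivity))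
  linarith

end Restart

/-! ### Parameters -/

theorem mu_le_of_isSharp {E : Type*} [NormedAddCommGroup E] [InnerProductSpace ℝ E] {F : E → E}
    {L μ : ℝ} {ustar : E} (hlip : ∀ u v, ‖F u - F v‖ ≤ L * ‖u - v‖) (hsharp : IsSharp F μ ustar)
    (hstar : F ustar = 0) {u : E} (hu : 0 < ‖u - ustar‖) : μ ≤ L := by
  have h1 := mul_norm_le_of_isSharp hsharp hstar u
  have h2 := hlip u ustar
  rw [hstar, sub_zero] at h2
  exact le_of_mul_le_mul_right (h1.trans h2) hu

/-- The factor `√6/2` in `numCalls` is tuned to this: `4^N ≥ 3D²/(2ε²)`, so that together with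
`ε²/3` from `meanLE_restarted` the total is `ε²`. -/
theorem sq_div_four_pow_numCalls_le {D ε : ℝ} (hD : 0 ≤ D) (hε : 0 < ε) :
    D ^ 2 / 4 ^ numCalls D ε ≤ 2 / 3 * ε ^ 2 := by
  rcases hD.eq_or_lt with rfl | hD
  · simp; positivity
  have h6 : √6 ^ 2 = 6 := Real.sq_sqrt (by norm_num)
  have hx : 0 < √6 * D / (2 * ε) := by positivity
  have h1 : Real.logb 2 (√6 * D / (2 * ε)) ≤ numCalls D ε := Nat.le_ceil _
  rw [Real.logb_le_iff_le_rpow (by norm_num) hx, Real.rpow_natCast] at h1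
  have h2 : (√6 * D / (2 * ε)) ^ 2 ≤ ((2 : ℝ) ^ numCalls D ε) ^ 2 := by gcongr
  have e : ((2 : ℝ) ^ numCalls D ε) ^ 2 = 4 ^ numCalls D ε := by
    rw [← pow_mul, mul_comm, pow_mul]; norm_num
  rw [e, div_pow, mul_pow, h6, div_le_iff₀ (by positivity)] at h2
  rw [div_le_iff₀ (by positivity)]
  linarith

theorem lt_of_numCalls_pos {D ε : ℝ} (hD : 0 ≤ D) (hε : 0 < ε) (hN : 0 < numCalls D ε) :
    0 < D ∧ 2 / 3 * ε ^ 2 < D ^ 2 := by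
  rcases hD.eq_or_lt with rfl | hD
  -- For `D = 0` the logarithm takes its default value `0`, so there are no calls.
  · simp [numCalls] at hN
  refine ⟨hD, ?_⟩
  have h6 : √6 ^ 2 = 6 := Real.sq_sqrt (by norm_num)
  have hx : 0 < √6 * D / (2 * ε) := by positivity
  have h1 := (Real.logb_pos_iff (by norm_num) hx).1 (Nat.ceil_pos.1 hN)
  rw [lt_div_iff₀ (by positivity), one_mul] at h1
  have h2 : (2 * ε) ^ 2 < (√6 * D) ^ 2 := by gcongr
  rw [mul_pow, mul_pow, h6] at h2
  linarith

theorem numCalls_le {D ε : ℝ} (hD : 0 ≤ D) (hε : 0 < ε) :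
    (numCalls D ε : ℝ) ≤ 4 * max 1 (Real.log (D / ε)) := by
  have hl1 : 1 ≤ max 1 (Real.log (D / ε)) := le_max_left _ _
  have hl2 : Real.log (D / ε) ≤ max 1 (Real.log (D / ε)) := le_max_right _ _
  set l := max 1 (Real.log (D / ε))
  rcases Nat.eq_zero_or_pos (numCalls D ε) with h | hN
  · rw [h]; push_cast; linarith
  have hD := (lt_of_numCalls_pos hD hε hN).1
  have h1 : (numCalls D ε : ℝ) < Real.logb 2 (√6 * D / (2 * ε)) + 1 :=
    Nat.ceil_lt_add_one (Nat.ceil_pos.1 hN).le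
  have hlog2 := Real.log_two_gt_d9
  have h2 : Real.log (√6 * D / (2 * ε)) ≤ Real.log 2 + Real.log (D / ε) := by
    rw [← Real.log_mul (by norm_num) (by positivity)]
    apply Real.log_le_log (by positivity)
    have h6 : √6 ≤ 4 := by
      rw [Real.sqrt_le_left (by norm_num)]; norm_num
    rw [mul_div_assoc', div_le_div_iff₀ (by positivity) hε]
    have : 0 < D * ε := by positivity
    nlinarith
  have h3 : Real.logb 2 (√6 * D / (2 * ε)) ≤ 3 * l := by
    rw [Real.logb, div_le_iff₀ (by linarith)]
    nlinarith
  linarith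

/-- Lets contributions of order `ε²` per call be absorbed into `D²`. The hypothesis `h` holds as
soon as there is at least one call. -/
theorem max_log_mul_sq_le {D ε : ℝ} (hD : 0 < D) (hε : 0 < ε) (h : 2 / 3 * ε ^ 2 < D ^ 2) :
    max 1 (Real.log (D / ε)) * ε ^ 2 ≤ 2 * D ^ 2 := by
  have hlog : Real.log (D / ε) * ε ^ 2 ≤ 2 * D ^ 2 := by
    have h1 := Real.log_le_sub_one_of_pos (div_pos hD hε)
    have h2 : D / ε * ε ^ 2 = D * ε := by field_simp
    have h3 : Real.log (D / ε) * ε ^ 2 ≤ (D / ε - 1) * ε ^ 2 := by gcongr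
    nlinarith [sq_nonneg (D - ε), sq_nonneg (D + ε)]
  rcases max_cases 1 (Real.log (D / ε)) with ⟨h1, _⟩ | ⟨h1, _⟩ <;> rw [h1]
  · linarith [sq_nonneg ε]
  · exact hlog

section Parameters

variable {L μ η₀ ε c : ℝ}

theorem sqrt_callLength_le (hm : paramM L * η₀ ^ 2 ≤ 1 / 3) :
    √(L ^ 2 * η₀ * etaLow L η₀ + 1) ≤ 2 := by
  rw [Real.sqrt_le_left (by norm_num)]
  linarith [mul_etaLow_le hm]

theorem callLength_mul_le (h0 : 0 < η₀) (hμ : 0 < μ) (hm : paramM L * η₀ ^ 2 ≤ 1 / 3) :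
    callLength L μ η₀ * (μ * etaLow L η₀) ≤ 8 + μ * etaLow L η₀ := by
  have hlow := etaLow_pos h0 hm
  have hy : 0 < μ * etaLow L η₀ := by positivity
  have h1 : (callLength L μ η₀ : ℝ) ≤ 4 * √(L ^ 2 * η₀ * etaLow L η₀ + 1) / (μ * etaLow L η₀) + 1 :=
    (Nat.ceil_lt_add_one (by positivity)).le
  have h2 := mul_le_mul_of_nonneg_right h1 hy.le
  rw [add_mul, div_mul_cancel₀ _ hy.ne'] at h2
  linarith [sqrt_callLength_le (L := L) hm]

theorem callLength_add_one_le (hc : 0 < c) (hL : 0 < L) (h0 : 0 < η₀) (hμ : 0 < μ)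
    (hm : paramM L * η₀ ^ 2 ≤ 1 / 3) (hcη : c ≤ η₀ * L) (hμL : μ ≤ L) :
    (callLength L μ η₀ : ℝ) + 1 ≤ (16 / c + 2) * (L / μ) := by
  have hlow := etaLow_pos h0 hm
  have h1 := callLength_mul_le h0 hμ hm
  have h2 := half_le_etaLow h0 hm
  have h3 : (callLength L μ η₀ : ℝ) ≤ 8 / (μ * etaLow L η₀) + 1 := by
    have e : 8 / (μ * etaLow L η₀) + 1 = (8 + μ * etaLow L η₀) / (μ * etaLow L η₀) := by
      field_simp
    rw [e, le_div_iff₀ (by positivity)]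
    exact h1
  have h4 : 8 / (μ * etaLow L η₀) ≤ 16 / c * (L / μ) := by
    rw [div_mul_div_comm, div_le_div_iff₀ (by positivity) (by positivity)]
    have : c ≤ 2 * etaLow L η₀ * L := hcη.trans (by nlinarith)
    nlinarith
  have h5 : 1 ≤ L / μ := (one_le_div hμ).2 hμL
  linarith

/-- The accuracy passed to a call is at least of order `cμε`; here the lower bound on `η₀` enters.
-/
theorem sq_mul_le_callAccuracy_sq (hc : 0 < c) (hL : 0 < L) (h0 : 0 < η₀)
    (hm : paramM L * η₀ ^ 2 ≤ 1 / 3) (hcη : c ≤ η₀ * L) :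
    c ^ 2 * (μ ^ 2 * ε ^ 2) ≤ 11 * callAccuracy L μ η₀ ε ^ 2 := by
  have hlow := etaLow_pos h0 hm
  have h1 := callAccuracy_sq (μ := μ) (ε := ε) hL h0 hm
  have h2 := paramM_mul_etaLow_mul_le hm
  have h3 : c ≤ 2 * etaLow L η₀ * L := hcη.trans (by nlinarith [half_le_etaLow h0 hm])
  have h4 : 9 / 4 * c ^ 2 ≤ paramM L * etaLow L η₀ ^ 2 := by
    have : c ^ 2 ≤ (2 * etaLow L η₀ * L) ^ 2 := by gcongr
    unfold paramM
    linarith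
  have h5 : callAccuracy L μ η₀ ε ^ 2 * (20 * (1 + paramM L * etaLow L η₀ * η₀)) ≤
      callAccuracy L μ η₀ ε ^ 2 * 24 := by
    gcongr
    linarith
  have h6 : μ ^ 2 * ε ^ 2 * (9 / 4 * c ^ 2) ≤ μ ^ 2 * ε ^ 2 * (paramM L * etaLow L η₀ ^ 2) := by
    gcongr
  nlinarith [sq_nonneg (callAccuracy L μ η₀ ε)]

/-- The noise part of the displacement bound is thereby of order `ε²`: `η₀Kμ` is bounded by an
absolute constant and `callAccuracy` is of order at most `με`. -/
theorem sq_mul_callLength_sq_mul_le (hL : 0 < L) (h0 : 0 < η₀) (hμ : 0 < μ)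
    (hm : paramM L * η₀ ^ 2 ≤ 1 / 3) (hμL : μ ≤ L) :
    η₀ ^ 2 * callLength L μ η₀ ^ 2 * callAccuracy L μ η₀ ε ^ 2 ≤ 6 * ε ^ 2 := by
  have hlow := etaLow_pos h0 hm
  have h1 := callLength_mul_le h0 hμ hm
  have h2 := half_le_etaLow h0 hm
  have hle := etaLow_le h0 hm
  have h3 := callAccuracy_sq_le (μ := μ) (ε := ε) hL h0 hm
  have hM := paramM_nonneg L
  have h4 : paramM L * etaLow L η₀ ^ 2 ≤ 1 / 3 := by
    refine le_trans ?_ hm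
    gcongr
  have h5 : μ * etaLow L η₀ ≤ 1 := by
    have h6 : L * etaLow L η₀ ≤ 1 := by
      have : (L * etaLow L η₀) ^ 2 ≤ 1 := by
        unfold paramM at h4
        nlinarith [sq_nonneg (L * etaLow L η₀)]
      exact (sq_le_one_iff₀ (by positivity)).1 this
    exact (mul_le_mul_of_nonneg_right hμL hlow.le).trans h6
  have h6 : η₀ * callLength L μ η₀ * μ ≤ 18 := by
    have : η₀ * (callLength L μ η₀ * μ) ≤ 2 * etaLow L η₀ * (callLength L μ η₀ * μ) := by
      gcongr
      linarith
    linarith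
  have h7 : (η₀ * callLength L μ η₀ * μ) ^ 2 ≤ 18 ^ 2 := by gcongr
  have h8 : callAccuracy L μ η₀ ε ^ 2 ≤ μ ^ 2 * ε ^ 2 / 60 := by
    have : μ ^ 2 * ε ^ 2 * (paramM L * etaLow L η₀ ^ 2) ≤ μ ^ 2 * ε ^ 2 * (1 / 3) := by gcongr
    linarith
  calc η₀ ^ 2 * callLength L μ η₀ ^ 2 * callAccuracy L μ η₀ ε ^ 2
      ≤ η₀ ^ 2 * callLength L μ η₀ ^ 2 * (μ ^ 2 * ε ^ 2 / 60) := by gcongr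
    _ = (η₀ * callLength L μ η₀ * μ) ^ 2 * (ε ^ 2 / 60) := by ring
    _ ≤ 18 ^ 2 * (ε ^ 2 / 60) := by gcongr
    _ ≤ 6 * ε ^ 2 := by nlinarith [sq_nonneg ε]

/-- The constant in the complexity bounds. -/
noncomputable def complexityConst (c : ℝ) : ℝ :=
  (16 / c + 2) * (28 + 112000 * 203 * (11 / c ^ 2))

theorem complexityConst_pos (hc : 0 < c) : 0 < complexityConst c := by
  unfold complexityConst
  positivity

theorem totalIterations_le (hc : 0 < c) (hL : 0 < L) (h0 : 0 < η₀) (hμ : 0 < μ)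
    (hm : paramM L * η₀ ^ 2 ≤ 1 / 3) (hcη : c ≤ η₀ * L) (hμL : μ ≤ L) {D : ℝ} (hD : 0 ≤ D)
    (hε : 0 < ε) :
    (totalIterations L μ ε η₀ D : ℝ) ≤
      complexityConst c * (L / μ * max 1 (Real.log (D / ε))) := by
  have h1 := callLength_add_one_le hc hL h0 hμ hm hcη hμL
  have h2 := numCalls_le hD hε
  have hl1 : 1 ≤ max 1 (Real.log (D / ε)) := le_max_left _ _
  set l := max 1 (Real.log (D / ε))
  have h3 : (totalIterations L μ ε η₀ D : ℝ) ≤ 4 * l * ((16 / c + 2) * (L / μ)) := by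
    unfold totalIterations
    push_cast
    gcongr
    linarith
  have h4 : 4 * (16 / c + 2) ≤ complexityConst c := by
    unfold complexityConst
    rw [mul_comm]
    gcongr
    have : 0 ≤ 112000 * 203 * (11 / c ^ 2) := by positivity
    linarith
  calc _ ≤ 4 * l * ((16 / c + 2) * (L / μ)) := h3
    _ = 4 * (16 / c + 2) * (L / μ * l) := by ring
    _ ≤ _ := by gcongr

theorem queries_bound_le (hc : 0 < c) (hL : 0 < L) (h0 : 0 < η₀) (hμ : 0 < μ)
    (hm : paramM L * η₀ ^ 2 ≤ 1 / 3) (hcη : c ≤ η₀ * L) (hμL : μ ≤ L) {D σ : ℝ} (hD : 0 < D)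
    (hε : 0 < ε) (hDε : 2 / 3 * ε ^ 2 < D ^ 2) :
    numCalls D ε * ((callLength L μ η₀ + 1) * (8 * σ ^ 2 / callAccuracy L μ η₀ ε ^ 2 + 3)) +
        callLength L μ η₀ * (112000 * L ^ 2 / callAccuracy L μ η₀ ε ^ 2 *
          (4 / 3 * D ^ 2 + numCalls D ε * (ε ^ 2 / 3 +
            4 * η₀ ^ 2 * callLength L μ η₀ ^ 2 * callAccuracy L μ η₀ ε ^ 2))) ≤
      complexityConst c * ((σ ^ 2 * (μ + L) * max 1 (Real.log (D / ε)) + L ^ 3 * D ^ 2) /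
              (μ ^ 3 * ε ^ 2)) := by
  have h1 := callLength_add_one_le hc hL h0 hμ hm hcη hμL
  have h2 := numCalls_le hD.le hε
  have h3 := sq_mul_callLength_sq_mul_le (ε := ε) hL h0 hμ hm hμL
  have h4 := sq_mul_le_callAccuracy_sq (μ := μ) (ε := ε) hc hL h0 hm hcη
  have h5 := max_log_mul_sq_le hD hε hDε
  have hδ := callAccuracy_pos hL h0 hμ hε hm
  have hl1 : 1 ≤ max 1 (Real.log (D / ε)) := le_max_left _ _
  set l := max 1 (Real.log (D / ε))
  set K := (callLength L μ η₀ : ℝ)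
  set N := (numCalls D ε : ℝ)
  set δ := callAccuracy L μ η₀ ε
  have hK0 : 0 ≤ K := Nat.cast_nonneg _
  have hN0 : 0 ≤ N := Nat.cast_nonneg _
  set A := 16 / c + 2 with hA
  have hA0 : 0 < A := by positivity
  set B := 11 / c ^ 2 with hB
  have hB0 : 0 < B := by positivity
  have hδ' : 1 / δ ^ 2 ≤ B / (μ ^ 2 * ε ^ 2) := by
    rw [hB, div_div, div_le_div_iff₀ (by positivity) (by positivity)]
    linarith
  have hs : 8 * σ ^ 2 / δ ^ 2 ≤ 8 * σ ^ 2 * (B / (μ ^ 2 * ε ^ 2)) := by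
    rw [div_eq_mul_one_div]
    gcongr
  have hLδ : 112000 * L ^ 2 / δ ^ 2 ≤ 112000 * L ^ 2 * (B / (μ ^ 2 * ε ^ 2)) := by
    rw [div_eq_mul_one_div]
    gcongr
  have hsum : 4 / 3 * D ^ 2 + N * (ε ^ 2 / 3 + 4 * η₀ ^ 2 * K ^ 2 * δ ^ 2) ≤ 202 * D ^ 2 := by
    have e1 : N * (ε ^ 2 / 3 + 4 * η₀ ^ 2 * K ^ 2 * δ ^ 2) ≤ 4 * l * (ε ^ 2 / 3 + 24 * ε ^ 2) :=
      mul_le_mul h2 (by linarith) (by positivity) (by positivity)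
    nlinarith [sq_nonneg D]
  have p1 : N * ((K + 1) * (8 * σ ^ 2 / δ ^ 2 + 3)) ≤
      4 * l * (A * (L / μ) * (8 * σ ^ 2 * (B / (μ ^ 2 * ε ^ 2)) + 3)) := by gcongr
  have p2 : K * (112000 * L ^ 2 / δ ^ 2 *
      (4 / 3 * D ^ 2 + N * (ε ^ 2 / 3 + 4 * η₀ ^ 2 * K ^ 2 * δ ^ 2))) ≤
      A * (L / μ) * (112000 * L ^ 2 * (B / (μ ^ 2 * ε ^ 2)) * (202 * D ^ 2)) := by
    gcongr
    linarith
  -- The rounding of the batch sizes costs a bounded number of queries per iteration, independent of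
  -- `σ`. It is absorbed into the `L³D²` term by means of `μ ≤ L` and `lε² ≤ 2D²`.
  have p3 : 4 * l * (A * (L / μ) * 3) ≤ 24 * A * (L ^ 3 * D ^ 2 / (μ ^ 3 * ε ^ 2)) := by
    have e1 : L / μ ≤ L ^ 3 / μ ^ 3 := by
      rw [div_le_div_iff₀ (by positivity) (by positivity)]
      have : μ ^ 2 ≤ L ^ 2 := by gcongr
      nlinarith [mul_pos hL hμ]
    have e2 : l ≤ 2 * D ^ 2 / ε ^ 2 := by
      rwa [le_div_iff₀ (by positivity)]
    calc 4 * l * (A * (L / μ) * 3) ≤ 4 * (2 * D ^ 2 / ε ^ 2) * (A * (L ^ 3 / μ ^ 3) * 3) := by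
          gcongr
      _ = _ := by field_simp; ring
  have hx : 0 ≤ σ ^ 2 * L * l / (μ ^ 3 * ε ^ 2) := by positivity
  have hy : 0 ≤ L ^ 3 * D ^ 2 / (μ ^ 3 * ε ^ 2) := by positivity
  have hz : 0 ≤ σ ^ 2 * μ * l / (μ ^ 3 * ε ^ 2) := by positivity
  have e1 : 4 * l * (A * (L / μ) * (8 * σ ^ 2 * (B / (μ ^ 2 * ε ^ 2)) + 3)) =
      32 * (A * B) * (σ ^ 2 * L * l / (μ ^ 3 * ε ^ 2)) + 4 * l * (A * (L / μ) * 3) := by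
    field_simp
    ring
  have e2 : A * (L / μ) * (112000 * L ^ 2 * (B / (μ ^ 2 * ε ^ 2)) * (202 * D ^ 2)) =
      112000 * 202 * (A * B) * (L ^ 3 * D ^ 2 / (μ ^ 3 * ε ^ 2)) := by
    field_simp
  have e3 : complexityConst c * ((σ ^ 2 * (μ + L) * l + L ^ 3 * D ^ 2) / (μ ^ 3 * ε ^ 2)) =
      (28 * A + 112000 * 203 * (A * B)) * (σ ^ 2 * L * l / (μ ^ 3 * ε ^ 2)) +
      (28 * A + 112000 * 203 * (A * B)) * (σ ^ 2 * μ * l / (μ ^ 3 * ε ^ 2)) +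
      (28 * A + 112000 * 203 * (A * B)) * (L ^ 3 * D ^ 2 / (μ ^ 3 * ε ^ 2)) := by
    unfold complexityConst
    rw [← hA, ← hB]
    ring
  have hAB : 0 < A * B := by positivity
  have q1 : 32 * (A * B) * (σ ^ 2 * L * l / (μ ^ 3 * ε ^ 2)) ≤
      (28 * A + 112000 * 203 * (A * B)) * (σ ^ 2 * L * l / (μ ^ 3 * ε ^ 2)) := by
    gcongr
    linarith
  have q2 : (24 * A + 112000 * 202 * (A * B)) * (L ^ 3 * D ^ 2 / (μ ^ 3 * ε ^ 2)) ≤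
      (28 * A + 112000 * 203 * (A * B)) * (L ^ 3 * D ^ 2 / (μ ^ 3 * ε ^ 2)) := by
    gcongr <;> norm_num
  have q3 : 0 ≤ (28 * A + 112000 * 203 * (A * B)) * (σ ^ 2 * μ * l / (μ ^ 3 * ε ^ 2)) := by
    positivity
  rw [e3]
  linarith

end Parameters

end RestartedHalpern

theorem mainTheorem4 (c : ℝ) (hc : 0 < c) :
    ∃ C : ℝ, 0 < C ∧
      ∀ (E : Type*) [NormedAddCommGroup E] [InnerProductSpace ℝ E] [FiniteDimensional ℝ E]
        [MeasurableSpace E] [BorelSpace E]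
        (Z : Type*) [MeasurableSpace Z] (Pz : Measure Z) [IsProbabilityMeasure Pz]
        (Ω : Type*) [MeasurableSpace Ω] (P : Measure Ω) [IsProbabilityMeasure P]
        (F : E → E) (Fhat : E → Z → E) (L μ σ ε η₀ : ℝ) (u₀ ustar : E)
        (ξ : ℕ × ℕ → Ω → RestartedHalpern.Seed Z),
        0 < L → 0 < μ → 0 < σ → 0 < ε →
        c / L ≤ η₀ → η₀ ≤ 1 / (3 * √3 * L) →
        RestartedHalpern.IsStochasticOracle F Fhat Pz L σ →
        RestartedHalpern.IsMonotoneOp F →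
        F ustar = 0 →
        RestartedHalpern.IsSharp F μ ustar →
        RestartedHalpern.IsSeedFamily P Pz ξ →
        let D : ℝ := ‖u₀ - ustar‖
        let uN : Ω → E := fun ω =>
          RestartedHalpern.output Fhat L μ σ ε η₀ D u₀ (fun t => ξ t ω)
        let queries : Ω → ℝ := fun ω =>
          (RestartedHalpern.totalQueries Fhat L μ σ ε η₀ D u₀ (fun t => ξ t ω) : ℝ)
        (Integrable (fun ω => ‖uN ω - ustar‖ ^ 2) P ∧
          ∫ ω, ‖uN ω - ustar‖ ^ 2 ∂P ≤ ε ^ 2) ∧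
        (Integrable (fun ω => ‖F (uN ω)‖ ^ 2) P ∧
          ∫ ω, ‖F (uN ω)‖ ^ 2 ∂P ≤ L ^ 2 * ε ^ 2) ∧
        (RestartedHalpern.totalIterations L μ ε η₀ D : ℝ) ≤
          C * (L / μ * max 1 (Real.log (D / ε))) ∧
        (Integrable queries P ∧
          ∫ ω, queries ω ∂P ≤
            C * ((σ ^ 2 * (μ + L) * max 1 (Real.log (D / ε)) + L ^ 3 * D ^ 2) /
              (μ ^ 3 * ε ^ 2))) := by
  open RestartedHalpern in
  refine ⟨complexityConst c, complexityConst_pos hc, ?_⟩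
  intro E _ _ _ _ _ Z _ Pz _ Ω _ P _ F Fhat L μ σ ε η₀ u₀ ustar ξ hL hμ hσ hε hcη hη hO hF hstar
    hsharp hξ D uN queries
  have : ProperSpace E := FiniteDimensional.proper_real E
  have h0 : 0 < η₀ := (div_pos hc hL).trans_le hcη
  have hm := paramM_mul_sq_le hL h0 hη
  have hlip := hO.lipschitz_norm hL
  have hD : 0 ≤ D := norm_nonneg _
  have hc' : c ≤ η₀ * L := (div_le_iff₀ hL).1 hcη
  have hu : MeanLE P (fun ω => ‖uN ω - ustar‖ ^ 2) (ε ^ 2) := by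
    refine (meanLE_restarted hξ hO hF hsharp hstar hL hμ hσ hε h0 hm (numCalls D ε)).mono ?_
    have := sq_div_four_pow_numCalls_le hD hε
    linarith
  have hFu : MeanLE P (fun ω => ‖F (uN ω)‖ ^ 2) (L ^ 2 * ε ^ 2) := by
    have hmeas : Measurable uN := (measurable_restarted (ξ := ξ) hO.measurable
      (numCalls D ε)).mono (iSup₂_le fun t _ => (hξ.measurable t).comap_le) le_rfl
    refine (hu.const_mul (sq_nonneg L)).of_le
      (((hO.continuous hL).measurable.comp hmeas).norm.pow_const 2).aestronglyMeasurable
      (fun _ => by positivity) fun ω => ?_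
    have h1 := hlip (uN ω) ustar
    rw [hstar, sub_zero] at h1
    rw [← mul_pow]
    gcongr
  have hq := meanLE_restarted_queries (u₀ := u₀) hξ hO hF hsharp hstar hL hμ hσ hε h0 hm
    (numCalls D ε)
  have hC := complexityConst_pos hc
  have hl : 0 < max 1 (Real.log (D / ε)) := lt_max_of_lt_left one_pos
  refine ⟨hu, hFu, ?_⟩
  -- Without calls both counts vanish. This case is separate because `μ ≤ L` comes from a point
  -- other than `ustar` and may fail if `E` is trivial; one call already forces `D > 0`.
  rcases Nat.eq_zero_or_pos (numCalls D ε) with hN | hN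
  · have hq0 : queries = fun _ => 0 := by
      funext ω
      change ((restarted Fhat L μ σ ε η₀ u₀ (fun t => ξ t ω) (numCalls D ε)).2 : ℝ) = 0
      rw [hN]
      exact Nat.cast_zero
    refine ⟨?_, ?_⟩
    · rw [totalIterations, hN]
      push_cast
      rw [zero_mul]
      positivity
    · rw [hq0]
      exact (meanLE_const (P := P) 0).mono (by positivity)
  · obtain ⟨hD0, hDε⟩ := lt_of_numCalls_pos hD hε hN
    have hμL := mu_le_of_isSharp hlip hsharp hstar hD0
    exact ⟨totalIterations_le hc hL h0 hμ hm hc' hμL hD hε,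
      hq.mono (queries_bound_le hc hL h0 hμ hm hc' hμL hD0 hε hDε)⟩
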